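/- Work in the language of groups, with symbols for the binary group operation, the inverse and the identity. Let $L_{\omega_1\omega}$-formulas be in normal form (negations only in front of atomic formulas). A formula is computable $\Sigma_0$ and computable $\Pi_0$ if it is finitary and quantifier-free. For $n>0$, it is computable $\Sigma_n$ if it is a disjunction, over a computably enumerable set of indices, of formulas $(\exists\bar y)\,\psi$ with $\psi$ computable $\Pi_m$ for some $m<n$, and computable $\Pi_n$ if it is a conjunction, over a computably enumerable set of indices, of formulas $(\forall\bar y)\,\psi$ with $\psi$ computable $\Sigma_m$ for some $m<n$. A computable $d$-$\Sigma_2$ sentence is the conjunction of a computable $\Sigma_2$ sentence and a computable $\Pi_2$ sentence. A Scott sentence for a countable structure $\mathcal A$ is a sentence whose countable models are exactly the isomorphic copies of $\mathcal A$. The index set $I(\mathcal A)$ is the set of all $e\in\mathbb N$ such that the $e$-th partial computable function $\varphi_e$ is the characteristic function of the atomic diagram (the set of Gödel numbers of true atomic sentences and negated atomic sentences, with constants for the elements) of some structure $\mathcal B\cong\mathcal A$ whose universe is a subset of $\mathbb N$. A set $S\subseteq\mathbb N$ is $d$-$\Sigma^0_2$ if $S=S_1\setminus S_2$ for some $\Sigma^0_2$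 sets $S_1,S_2$, and it is $m$-complete $d$-$\Sigma^0_2$ if it is $d$-$\Sigma^0_2$ and every $d$-$\Sigma^0_2$ set is many-one reducible to it. **Theorem.** Let $G$ be a finitely generated abelian group. Then $G$ has a computable $d$-$\Sigma_2$ Scott sentence. Furthermore, if $G$ is infinite, then $I(G)$ is $m$-complete $d$-$\Sigma^0_2$, and the $d$-$\Sigma_2$ Scott sentence is optimal: neither a computable $\Sigma_2$ sentence nor a computable $\Pi_2$ sentence is a Scott sentence for $G$. -/

import Mathlib

open scoped FirstOrder

universe u v

namespace ScottGroup

/-! ### The language of groups -/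

/-- The function symbols of the language of groups: a constant for the identity, a unary symbol
for the inverse and a binary symbol for the group operation. -/
inductive GroupFunc : ℕ → Type
  | one : GroupFunc 0
  | inv : GroupFunc 1
  | mul : GroupFunc 2

/-- The language of groups. -/
def grp : FirstOrder.Language.{0, 0} where
  Functions := GroupFunc
  Relations := fun _ => Empty

/-- A group as a structure for the language of groups. -/
instance structureOfGroup (G : Type u) [Group G] : grp.Structure G where
  funMap {_} f x :=
    match f, x with
    | GroupFunc.one, _ => 1
    | GroupFunc.inv, x => (x 0)⁻¹
    | GroupFunc.mul, x => x 0 * x 1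
  RelMap {_} r _ := nomatch r

/-! ### Terms and finitary quantifier-free formulas, with Goedel numbers -/

/-- The Goedel number of a term whose variables (or constants) are named by natural numbers. -/
def termCode : grp.Term ℕ → ℕ
  | .var n => Nat.pair 0 n
  | .func GroupFunc.one _ => Nat.pair 1 0
  | .func GroupFunc.inv ts => Nat.pair 2 (termCode (ts 0))
  | .func GroupFunc.mul ts => Nat.pair 3 (Nat.pair (termCode (ts 0)) (termCode (ts 1)))

/-- Finitary quantifier-free formulas in normal form (negations occur only in front of atomic
formulas) in the variables `x₀, x₁, x₂, …`. -/
inductive QFFormula : Type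
  | eq (s t : grp.Term ℕ) : QFFormula
  | ne (s t : grp.Term ℕ) : QFFormula
  | and (θ η : QFFormula) : QFFormula
  | or (θ η : QFFormula) : QFFormula

namespace QFFormula

/-- The Goedel number of a finitary quantifier-free formula. -/
def code : QFFormula → ℕ
  | eq s t => Nat.pair 0 (Nat.pair (termCode s) (termCode t))
  | ne s t => Nat.pair 1 (Nat.pair (termCode s) (termCode t))
  | and θ η => Nat.pair 2 (Nat.pair θ.code η.code)
  | or θ η => Nat.pair 3 (Nat.pair θ.code η.code)

/-- The variables that occur in a quantifier-free formula. -/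
def vars : QFFormula → Finset ℕ
  | eq s t => s.varFinset ∪ t.varFinset
  | ne s t => s.varFinset ∪ t.varFinset
  | and θ η => θ.vars ∪ η.vars
  | or θ η => θ.vars ∪ η.vars

/-- Satisfaction of a quantifier-free formula under an assignment `a` of the variables. -/
def Realize {M : Type v} [grp.Structure M] : QFFormula → (ℕ → M) → Prop
  | eq s t, a => s.realize a = t.realize a
  | ne s t, a => s.realize a ≠ t.realize a
  | and θ η, a => θ.Realize a ∧ η.Realize a
  | or θ η, a => θ.Realize a ∨ η.Realize a

end QFFormula

/-! ### Computability -/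

/-- The `e`-th partial computable function `φ_e` of one variable. -/
def phi (e : ℕ) : ℕ →. ℕ :=
  (Denumerable.ofNat Nat.Partrec.Code e).eval

/-- The `e`-th computably enumerable set `W_e`, the domain of `φ_e`. -/
def W (e : ℕ) : Set ℕ :=
  {i | (phi e i).Dom}

/-- `A` is a `Σ⁰₂` set of natural numbers. -/
def IsSigma02 (A : Set ℕ) : Prop :=
  ∃ R : ℕ × ℕ × ℕ → Prop, ComputablePred R ∧ ∀ n, n ∈ A ↔ ∃ x, ∀ y, R (n, x, y)

/-- `A` is a `d-Σ⁰₂` set: a difference of two `Σ⁰₂` sets. -/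
def IsDSigma02 (A : Set ℕ) : Prop :=
  ∃ S₁ S₂ : Set ℕ, IsSigma02 S₁ ∧ IsSigma02 S₂ ∧ A = S₁ \ S₂

/-- `A` is `m`-complete for the class `Γ` of sets of natural numbers. -/
def IsMComplete (Γ : Set ℕ → Prop) (A : Set ℕ) : Prop :=
  Γ A ∧ ∀ S : Set ℕ, Γ S → (fun n => n ∈ S) ≤₀ (fun n => n ∈ A)

/-! ### Infinitary formulas -/

/-- Formulas of `L_{ω₁ω}` in normal form: quantifier-free finitary formulas, countable
disjunctions `⋁_{i ∈ I} (∃ xs i) ψ i` and countable conjunctions `⋀_{i ∈ I} (∀ xs i) ψ i`, where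
`xs i` is a finite (possibly empty) tuple of variables. Only the values at `i ∈ I` matter. -/
inductive InfFormula : Type
  | qf (θ : QFFormula) : InfFormula
  | disjEx (I : Set ℕ) (xs : ℕ → List ℕ) (ψ : ℕ → InfFormula) : InfFormula
  | conjAll (I : Set ℕ) (xs : ℕ → List ℕ) (ψ : ℕ → InfFormula) : InfFormula

/-- The two sides of the hierarchy of computable infinitary formulas. -/
inductive Polarity : Type
  | sigma : Polarity
  | pi : Polarity

namespace InfFormula

/-- The free variables of a formula. -/
def freeVars : InfFormula → Set ℕ
  | qf θ => θ.vars
  | disjEx I xs ψ => {x | ∃ i ∈ I, x ∈ (ψ i).freeVars ∧ x ∉ xs i}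
  | conjAll I xs ψ => {x | ∃ i ∈ I, x ∈ (ψ i).freeVars ∧ x ∉ xs i}

/-- Satisfaction of a formula under an assignment `a` of the variables. -/
def Realize {M : Type v} [grp.Structure M] : InfFormula → (ℕ → M) → Prop
  | qf θ, a => θ.Realize a
  | disjEx I xs ψ, a => ∃ i ∈ I, ∃ b : ℕ → M, (∀ x, x ∉ xs i → b x = a x) ∧ (ψ i).Realize b
  | conjAll I xs ψ, a => ∀ i ∈ I, ∀ b : ℕ → M, (∀ x, x ∉ xs i → b x = a x) → (ψ i).Realize b

/-- The formula is a sentence. -/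
def IsSentence (φ : InfFormula) : Prop :=
  φ.freeVars = ∅

/-- The conjunction of two formulas. -/
def conj (φ ψ : InfFormula) : InfFormula :=
  conjAll {0, 1} (fun _ => []) (fun i => if i = 0 then φ else ψ)

/-- `φ.IsIndex p n e`: the number `e` is an index of `φ` as a computable `Σ_n` formula if
`p = Polarity.sigma`, and as a computable `Π_n` formula if `p = Polarity.pi`. For `n = 0` it is the
Goedel number of the quantifier-free formula `φ`. For `n > 0` a computable `Σ_n` formula is the
disjunction, over the computably enumerable set `W_e`, of formulas `(∃ xs) ψ`, where each element
of `W_e` codes a triple `(m, xs, j)` such that `m < n` and `j` is an index of `ψ` as a computable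
`Π_m` formula. Computable `Π_n` formulas are the dual conjunctions. -/
def IsIndex : InfFormula → Polarity → ℕ → ℕ → Prop
  | qf θ, _, n, e => n = 0 ∧ e = θ.code
  | disjEx I xs ψ, p, n, e => p = Polarity.sigma ∧ 0 < n ∧ I = W e ∧
      ∀ i ∈ I, ∃ m < n, ∃ j, i = Nat.pair m (Nat.pair (Encodable.encode (xs i)) j) ∧
        (ψ i).IsIndex Polarity.pi m j
  | conjAll I xs ψ, p, n, e => p = Polarity.pi ∧ 0 < n ∧ I = W e ∧
      ∀ i ∈ I, ∃ m < n, ∃ j, i = Nat.pair m (Nat.pair (Encodable.encode (xs i)) j) ∧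
        (ψ i).IsIndex Polarity.sigma m j

/-- `φ` is a computable `Σ_n` formula. -/
def IsComputableSigma (n : ℕ) (φ : InfFormula) : Prop :=
  ∃ e, φ.IsIndex Polarity.sigma n e

/-- `φ` is a computable `Π_n` formula. -/
def IsComputablePi (n : ℕ) (φ : InfFormula) : Prop :=
  ∃ e, φ.IsIndex Polarity.pi n e

/-- `φ` is a computable `d-Σ₂` sentence: the conjunction of a computable `Σ₂` sentence and a
computable `Π₂` sentence. -/
def IsComputableDSigmaTwoSentence (φ : InfFormula) : Prop :=
  ∃ σ π : InfFormula, σ.IsSentence ∧ π.IsSentence ∧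
    IsComputableSigma 2 σ ∧ IsComputablePi 2 π ∧ φ = conj σ π

/-- `M` is a model of the sentence `φ`. (Structures for the language of groups are non-empty, and
the truth value of a sentence does not depend on the assignment.) -/
def Models (M : Type v) [grp.Structure M] (φ : InfFormula) : Prop :=
  ∀ a : ℕ → M, φ.Realize a

/-- `φ` is a Scott sentence for the structure `A`: a sentence whose countable models, among all
structures for the language of groups, are exactly the isomorphic copies of `A`. -/
def IsScottSentence (φ : InfFormula) (A : Type u) [grp.Structure A] : Prop :=
  φ.IsSentence ∧
    ∀ (M : Type v) [grp.Structure M] [Countable M],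
      Models M φ ↔ Nonempty (M ≃[grp] A)

end InfFormula

/-! ### Atomic diagrams and index sets -/

/-- The atomic diagram of a structure with universe `U ⊆ ℕ`: the set of Goedel numbers of the
atomic sentences and negated atomic sentences, with the elements of `U` as additional constants,
that are true in the structure. The constant for `n ∈ U` has the code of the variable `xₙ`. -/
def atomicDiagram (U : Set ℕ) [grp.Structure U] : Set ℕ :=
  {c | ∃ s t : grp.Term U,
    (s.realize id = t.realize id ∧
      c = (QFFormula.eq (s.relabel Subtype.val) (t.relabel Subtype.val)).code) ∨
    (s.realize id ≠ t.realize id ∧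
      c = (QFFormula.ne (s.relabel Subtype.val) (t.relabel Subtype.val)).code)}

/-- The index set `I(A)`: all `e` such that `φ_e` is the (total) characteristic function of the
atomic diagram of some structure `B ≅ A` with universe a set of natural numbers. -/
def indexSet (A : Type u) [grp.Structure A] : Set ℕ :=
  {e | ∃ (U : Set ℕ) (_ : grp.Structure U), Nonempty (U ≃[grp] A) ∧
    ∀ c, phi e c = Part.some ((atomicDiagram U).indicator 1 c)}

end ScottGroup

/-!
By the structure theorem, a finitely generated abelian group is isomorphic to `ℤ ^ r × T` for a
finite group `T`. Abelian groups are written additively in this comment.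

*The Scott sentence.* A structure `M` is a copy of `ℤ ^ r × T` iff three conditions hold
(`nonempty_equiv_iff`). First, `M` is an abelian group. Second, any `r + 1` elements of `M` satisfy
an equation that fails for the standard basis of `ℤ ^ (r + 1)` (`RankCond`). Third (`SigmaCond`),
some tuple in `M` has the atomic type of the free generators and the elements of `T`, and only the
elements of the copy of `T` satisfy equations `a + n • y = 0` such that `a` is in the span of the
free generators, `n ≠ 0`, and `n` divides `a` in this span only if `a = 0`. These conditions
suffice: by the rank condition, every `y` satisfies some equation `a + n • y = 0` with `n ≠ 0`. If
`n` does not divide `a`, the third condition puts `y` into the copy of `T`, and if `a = n • b`, it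
puts `y + b` there. So the tuple generates `M`. The first two conditions are computable `Π₂` and
the third is computable `Σ₂` (`exists_scottSentence`).

*Optimality.* Let `r > 0`. If a `Σ₂` sentence holds in `K = ℤ ^ r × T`, it holds in `K × ℤ`,
because there are retractions from `K × ℤ` onto `K` that do not vanish on a given finite set of
nonzero elements. If a `Π₂` sentence holds in `K = ℤ × K'`, it holds in `ℚ × K'`, because every
finite subset of `ℚ × K'` lies in a copy of `K`. Neither group is isomorphic to `K`
(`not_isScottSentence_of_sigma_or_pi`).

*The index set is `d-Σ⁰₂`.* That `e` is an index of an atomic diagram is a `Π⁰₂` property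
(`isPi02_diagramAxioms`, `exists_isDiagramIndex_iff`). The atomic diagram decides the equations
between terms at tuples of elements, by substitution into Goedel numbers, so that for indices of
atomic diagrams the three conditions are `Π⁰₂`, `Π⁰₂` and `Σ⁰₂` (`isDSigma02_indexSet`).

*Hardness.* Let `r > 0`, and let `S₁` and `S₂` be `Σ⁰₂` sets. There are computable sequences of
events such that `n ∉ S₁` iff infinitely many of the events `A n` happen, and `n ∉ S₂` iff
infinitely many of the events `E n` happen (`IsSigma02.exists_events`). Let `L` be the limit of a
sequence `ℤ ^ 2 → ℤ ^ 2 → ⋯` in which stage `s` maps the second generator to `s + 1` times the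
first one if `E n s`, and then doubles the result if `A n s`. If `A n` happens infinitely often,
`L` has an element of infinite order that is divisible by all powers of `2`. Otherwise `L` is
isomorphic to `ℤ` if `E n` happens infinitely often, and to `ℤ ^ 2` if not. Hence
`L × ℤ ^ (r - 1) × T` is a copy of `ℤ ^ r × T` iff `n ∈ S₁ \ S₂` (`nonempty_limit_prod_equiv_iff`).
The factor `s + 1` makes the word problem of `L` solvable uniformly in `n`, because the collapse at
stage `s` moves every element `(a, b) ≠ 0` with `|a| ≤ s` to a nonzero element
(`toGerm_eq_one_iff`). So an index of a copy of the group with universe a subset of `ℕ` can be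
computed from `n` (`exists_computable_copies`, `manyOneReducible_indexSet`).
-/

universe w

namespace ScottGroup

open FirstOrder FirstOrder.Language Multiplicative

/-! ### Terms of the language of groups -/

section Terms

variable {α : Type u} {β : Type v}

/-- The term `1`. -/
def tOne : grp.Term α := .func (l := 0) GroupFunc.one ![]

/-- The term `s⁻¹`. -/
def tInv (s : grp.Term α) : grp.Term α := .func (l := 1) GroupFunc.inv ![s]

/-- The term `s * t`. -/
def tMul (s t : grp.Term α) : grp.Term α := .func (l := 2) GroupFunc.mul ![s, t]

/-- Induction on terms of the language of groups, by their last operation. -/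
theorem term_induction {P : grp.Term α → Prop} (hvar : ∀ a, P (.var a)) (hone : P tOne)
    (hinv : ∀ s, P s → P (tInv s)) (hmul : ∀ s t, P s → P t → P (tMul s t)) : ∀ s, P s := by
  intro s
  induction s with
  | var a => exact hvar a
  | func f ts ih =>
    cases f with
    | one =>
      have h : ts = ![] := by funext i; exact i.elim0
      rw [h]; exact hone
    | inv =>
      have h : ts = ![ts 0] := by funext i; fin_cases i; rfl
      rw [h]; exact hinv _ (ih 0)
    | mul =>
      have h : ts = ![ts 0, ts 1] := by funext i; fin_cases i <;> rfl
      rw [h]; exact hmul _ _ (ih 0) (ih 1)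

@[simp] theorem termCode_var (n : ℕ) : termCode (.var n) = Nat.pair 0 n := by
  simp [termCode]
@[simp] theorem termCode_tOne : termCode tOne = Nat.pair 1 0 := by
  simp [termCode, tOne]
@[simp] theorem termCode_tInv (s : grp.Term ℕ) :
    termCode (tInv s) = Nat.pair 2 (termCode s) := by
  simp [termCode, tInv]
@[simp] theorem termCode_tMul (s t : grp.Term ℕ) :
    termCode (tMul s t) = Nat.pair 3 (Nat.pair (termCode s) (termCode t)) := by
  simp [termCode, tMul]

@[simp] theorem relabel_tOne (g : α → β) : (tOne : grp.Term α).relabel g = tOne := by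
  simp only [tOne, Term.relabel]; congr 1; funext i; exact i.elim0
@[simp] theorem relabel_tInv (g : α → β) (s : grp.Term α) :
    (tInv s).relabel g = tInv (s.relabel g) := by
  simp only [tInv, Term.relabel]; congr 1; funext i; fin_cases i; rfl
@[simp] theorem relabel_tMul (g : α → β) (s t : grp.Term α) :
    (tMul s t).relabel g = tMul (s.relabel g) (t.relabel g) := by
  simp only [tMul, Term.relabel]; congr 1; funext i; fin_cases i <;> rfl

@[simp] theorem varFinset_var [DecidableEq α] (a : α) :
    (Term.var a : grp.Term α).varFinset = {a} := rfl
@[simp] theorem varFinset_tOne [DecidableEq α] : (tOne : grp.Term α).varFinset = ∅ := rfl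
@[simp] theorem varFinset_tInv [DecidableEq α] (s : grp.Term α) :
    (tInv s).varFinset = s.varFinset := by
  ext; simp [tInv, Term.varFinset]
@[simp] theorem varFinset_tMul [DecidableEq α] (s t : grp.Term α) :
    (tMul s t).varFinset = s.varFinset ∪ t.varFinset := by
  ext; simp [tMul, Term.varFinset]

variable {M : Type w}

/-- The interpretation of the symbol for the identity. -/
def sOne (M : Type w) [grp.Structure M] : M :=
  Structure.funMap (L := grp) (n := 0) GroupFunc.one ![]

/-- The interpretation of the symbol for the inverse. -/
def sInv [grp.Structure M] (x : M) : M :=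
  Structure.funMap (L := grp) (n := 1) GroupFunc.inv ![x]

/-- The interpretation of the symbol for the group operation. -/
def sMul [grp.Structure M] (x y : M) : M :=
  Structure.funMap (L := grp) (n := 2) GroupFunc.mul ![x, y]

section
variable [grp.Structure M] (a : α → M)

@[simp] theorem realize_tOne : (tOne : grp.Term α).realize a = sOne M := by
  simp only [tOne, Term.realize, sOne]; congr 1; funext i; exact i.elim0
@[simp] theorem realize_tInv (s : grp.Term α) :
    (tInv s).realize a = sInv (s.realize a) := by
  simp only [tInv, Term.realize, sInv]; congr 1; funext i; fin_cases i; rfl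
@[simp] theorem realize_tMul (s t : grp.Term α) :
    (tMul s t).realize a = sMul (s.realize a) (t.realize a) := by
  simp only [tMul, Term.realize, sMul]; congr 1; funext i; fin_cases i <;> rfl
end

@[simp] theorem sOne_eq [Group M] : sOne M = 1 := rfl
@[simp] theorem sInv_eq [Group M] (x : M) : sInv x = x⁻¹ := rfl
@[simp] theorem sMul_eq [Group M] (x y : M) : sMul x y = x * y := rfl

theorem funMap_one [grp.Structure M] (x : Fin 0 → M) :
    Structure.funMap (L := grp) (n := 0) GroupFunc.one x = sOne M := by
  unfold sOne; congr 1; funext i; exact i.elim0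
theorem funMap_inv [grp.Structure M] (x : Fin 1 → M) :
    Structure.funMap (L := grp) (n := 1) GroupFunc.inv x = sInv (x 0) := by
  unfold sInv; congr 1; funext i; fin_cases i; rfl
theorem funMap_mul [grp.Structure M] (x : Fin 2 → M) :
    Structure.funMap (L := grp) (n := 2) GroupFunc.mul x = sMul (x 0) (x 1) := by
  unfold sMul; congr 1; funext i; fin_cases i <;> rfl

/-- A bijection that preserves the three operations is an isomorphism of structures. -/
def grpEquiv {N : Type u} [grp.Structure M] [grp.Structure N] (e : M ≃ N)
    (h1 : e (sOne M) = sOne N) (h2 : ∀ x, e (sInv x) = sInv (e x))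
    (h3 : ∀ x y, e (sMul x y) = sMul (e x) (e y)) : M ≃[grp] N where
  toEquiv := e
  map_fun' {n} f x := by
    cases f with
    | one => exact (congrArg e (funMap_one x)).trans (h1.trans (funMap_one _).symm)
    | inv =>
      exact (congrArg e (funMap_inv x)).trans
        ((h2 _).trans (funMap_inv (fun i => e (x i))).symm)
    | mul =>
      exact (congrArg e (funMap_mul x)).trans
        ((h3 _ _).trans (funMap_mul (fun i => e (x i))).symm)
  map_rel' {n} r := nomatch r

/-- For groups, isomorphisms of structures are isomorphisms of groups. -/
theorem nonempty_grpEquiv_iff {N : Type u} [Group M] [Group N] :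
    Nonempty (M ≃[grp] N) ↔ Nonempty (M ≃* N) := by
  constructor
  · rintro ⟨e⟩
    refine ⟨{ e.toEquiv with map_mul' := fun x y => ?_ }⟩
    have := e.map_fun (show grp.Functions 2 from GroupFunc.mul) ![x, y]
    exact this
  · rintro ⟨e⟩
    exact ⟨grpEquiv e.toEquiv (map_one e) (map_inv e) (map_mul e)⟩

/-- Group homomorphisms commute with the evaluation of terms. -/
theorem map_realize {N : Type u} [Group M] [Group N] (f : M →* N) (a : β → M)
    (s : grp.Term β) : f (s.realize a) = s.realize (fun i => f (a i)) := by
  induction s using term_induction with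
  | hvar a => rfl
  | hone => simp
  | hinv s ih => simp [ih]
  | hmul s t ih₁ ih₂ => simp [ih₁, ih₂]

theorem realize_congr [DecidableEq α] [grp.Structure M] {a b : α → M} {s : grp.Term α}
    (h : ∀ i ∈ s.varFinset, a i = b i) : s.realize a = s.realize b := by
  induction s using term_induction with
  | hvar i => exact h i (by simp)
  | hone => simp
  | hinv s ih => simp [ih (by simpa using h)]
  | hmul s t ih₁ ih₂ =>
    simp only [varFinset_tMul, Finset.mem_union] at h
    simp [ih₁ fun i hi => h i (.inl hi), ih₂ fun i hi => h i (.inr hi)]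

/-- The elements of the subgroup generated by a set of values are the values of terms. -/
theorem exists_realize_eq_of_mem_closure [DecidableEq α] [Group M] {a : α → M} {X : Set α} {x : M}
    (hx : x ∈ Subgroup.closure (a '' X)) :
    ∃ s : grp.Term α, ↑s.varFinset ⊆ X ∧ s.realize a = x := by
  induction hx using Subgroup.closure_induction with
  | mem x hx =>
    obtain ⟨i, hi, rfl⟩ := hx
    exact ⟨.var i, by simpa using hi, rfl⟩
  | one => exact ⟨tOne, by simp, by simp⟩
  | mul x y _ _ hx hy =>
    obtain ⟨s, hs, rfl⟩ := hx
    obtain ⟨t, ht, rfl⟩ := hy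
    exact ⟨tMul s t, by simpa using ⟨hs, ht⟩, by simp⟩
  | inv x _ hx =>
    obtain ⟨s, hs, rfl⟩ := hx
    exact ⟨tInv s, by simpa using hs, by simp⟩

theorem termCode_injective : Function.Injective termCode := by
  intro s
  induction s using term_induction with
  | hvar i =>
    intro t h
    induction t using term_induction <;> simp_all
  | hone =>
    intro t h
    induction t using term_induction <;> simp_all
  | hinv s ih =>
    intro t h
    induction t using term_induction with
    | hinv t _ =>
      simp only [termCode_tInv, Nat.pair_eq_pair, true_and] at h
      rw [ih h]
    | _ => simp_all
  | hmul s₁ s₂ ih₁ ih₂ =>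
    intro t h
    induction t using term_induction with
    | hmul t₁ t₂ _ _ =>
      simp only [termCode_tMul, Nat.pair_eq_pair, true_and] at h
      rw [ih₁ h.1, ih₂ h.2]
    | _ => simp_all

theorem QFFormula.code_injective : Function.Injective QFFormula.code := by
  intro θ
  induction θ with
  | eq s t =>
    intro η h
    cases η <;> simp_all [QFFormula.code, termCode_injective.eq_iff]
  | ne s t =>
    intro η h
    cases η <;> simp_all [QFFormula.code, termCode_injective.eq_iff]
  | and θ₁ θ₂ ih₁ ih₂ =>
    intro η h
    cases η <;> simp [QFFormula.code] at h
    rw [ih₁ h.1, ih₂ h.2]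
  | or θ₁ θ₂ ih₁ ih₂ =>
    intro η h
    cases η <;> simp [QFFormula.code] at h
    rw [ih₁ h.1, ih₂ h.2]

end Terms

/-! ### Truth depends only on the free variables and the isomorphism type -/

section Invariance

variable {M : Type u} {N : Type v} [grp.Structure M] [grp.Structure N]

theorem QFFormula.realize_congr {a b : ℕ → M} (θ : QFFormula) (h : ∀ i ∈ θ.vars, a i = b i) :
    θ.Realize a ↔ θ.Realize b := by
  induction θ with
  | eq s t | ne s t =>
    simp only [QFFormula.vars, Finset.mem_union] at h
    simp only [QFFormula.Realize]
    rw [ScottGroup.realize_congr fun i hi => h i (.inl hi),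
      ScottGroup.realize_congr fun i hi => h i (.inr hi)]
  | and θ η ih₁ ih₂ | or θ η ih₁ ih₂ =>
    simp only [QFFormula.vars, Finset.mem_union] at h
    simp only [QFFormula.Realize]
    rw [ih₁ fun i hi => h i (.inl hi), ih₂ fun i hi => h i (.inr hi)]

/-- The key step for quantifiers: an assignment changed on `xs` can be imitated from any assignment
with the same values at the free variables of `∃ xs, ψ`. -/
theorem InfFormula.realize_congr (φ : InfFormula) : ∀ {a b : ℕ → M},
    (∀ i ∈ φ.freeVars, a i = b i) → (φ.Realize a ↔ φ.Realize b) := by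
  classical
  induction φ with
  | qf θ => exact fun h => θ.realize_congr h
  | disjEx I xs ψ ih =>
    have key : ∀ {a b : ℕ → M}, (∀ i ∈ (disjEx I xs ψ).freeVars, a i = b i) →
        (disjEx I xs ψ).Realize a → (disjEx I xs ψ).Realize b := by
      rintro a b h ⟨i, hi, c, hc, hψ⟩
      refine ⟨i, hi, fun x => if x ∈ xs i then c x else b x, fun x hx => by simp [hx], ?_⟩
      refine (ih i fun x hx => ?_).1 hψ
      by_cases hxs : x ∈ xs i
      · simp [hxs]
      · simp only [hxs, if_false]
        rw [hc x hxs, h x ⟨i, hi, hx, hxs⟩]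
    exact fun {_ _} h => ⟨key h, key fun i hi => (h i hi).symm⟩
  | conjAll I xs ψ ih =>
    have key : ∀ {a b : ℕ → M}, (∀ i ∈ (conjAll I xs ψ).freeVars, a i = b i) →
        (conjAll I xs ψ).Realize a → (conjAll I xs ψ).Realize b := by
      intro a b h H i hi c hc
      refine (ih i fun x hx => ?_).1
        (H i hi (fun x => if x ∈ xs i then c x else a x) fun x hx => by simp [hx])
      by_cases hxs : x ∈ xs i
      · simp [hxs]
      · simp only [hxs, if_false]
        rw [hc x hxs, h x ⟨i, hi, hx, hxs⟩]
    exact fun {_ _} h => ⟨key h, key fun i hi => (h i hi).symm⟩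

theorem QFFormula.realize_equiv (e : M ≃[grp] N) (θ : QFFormula) (a : ℕ → M) :
    θ.Realize (fun i => e (a i)) ↔ θ.Realize a := by
  have key : ∀ s : grp.Term ℕ, s.realize (fun i => e (a i)) = e (s.realize a) :=
    fun s => HomClass.realize_term e
  induction θ with
  | eq s t | ne s t => simp only [QFFormula.Realize, key, e.injective.eq_iff, ne_eq]
  | and θ η ih₁ ih₂ | or θ η ih₁ ih₂ => simp only [QFFormula.Realize, ih₁, ih₂]

theorem InfFormula.realize_equiv (e : M ≃[grp] N) (φ : InfFormula) : ∀ a : ℕ → M,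
    φ.Realize (fun i => e (a i)) ↔ φ.Realize a := by
  have he : ∀ b : ℕ → N, (fun i => e (e.symm (b i))) = b := fun b => by funext i; simp
  induction φ with
  | qf θ => exact fun a => θ.realize_equiv e a
  | disjEx I xs ψ ih =>
    refine fun a => ⟨?_, ?_⟩
    · rintro ⟨i, hi, b, hb, h⟩
      refine ⟨i, hi, fun x => e.symm (b x), fun x hx => by simp [hb x hx], ?_⟩
      rw [← ih, he]; exact h
    · rintro ⟨i, hi, b, hb, h⟩
      exact ⟨i, hi, fun x => e (b x), fun x hx => by simp [hb x hx], (ih i b).2 h⟩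
  | conjAll I xs ψ ih =>
    refine fun a => ⟨?_, ?_⟩
    · exact fun H i hi b hb =>
        (ih i b).1 (H i hi (fun x => e (b x)) fun x hx => by simp [hb x hx])
    · intro H i hi b hb
      rw [← he b, ih]
      exact H i hi _ fun x hx => by simp [hb x hx]

theorem InfFormula.models_iff_of_equiv (e : M ≃[grp] N) (φ : InfFormula) :
    Models M φ ↔ Models N φ := by
  constructor
  · intro h b
    have : (fun i => e (e.symm (b i))) = b := by funext i; simp
    rw [← this, φ.realize_equiv e]; exact h _
  · exact fun h a => (φ.realize_equiv e a).1 (h _)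

/-- A sentence is true in a structure as soon as some assignment satisfies it. -/
theorem InfFormula.IsSentence.models_iff {φ : InfFormula} (hφ : φ.IsSentence) (a : ℕ → M) :
    Models M φ ↔ φ.Realize a := by
  refine ⟨fun h => h a, fun h b => (φ.realize_congr fun i hi => ?_).1 h⟩
  rw [IsSentence] at hφ
  simp [hφ] at hi

end Invariance

/-! ### Free abelian groups of finite rank -/

section FreeAbelian

/-- The free abelian group of rank `m`, written multiplicatively. -/
abbrev Zpow (m : ℕ) : Type := Fin m → Multiplicative ℤ

/-- The standard basis of `Zpow m`, continued by `1` to a sequence indexed by `ℕ`. -/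
def bas (m : ℕ) (i : ℕ) : Zpow m :=
  if h : i < m then Pi.mulSingle ⟨i, h⟩ (ofAdd 1) else 1

variable {M : Type u} [CommGroup M]

/-- The homomorphism from `Zpow m` that sends the basis to the first `m` elements of `x`. -/
def zpowHom (m : ℕ) (x : ℕ → M) : Zpow m →* M :=
  ∏ i : Fin m, (zpowersHom M (x i)).comp (Pi.evalMonoidHom _ i)

theorem zpowHom_apply (m : ℕ) (x : ℕ → M) (a : Zpow m) :
    zpowHom m x a = ∏ i : Fin m, x i ^ (a i).toAdd := by
  simp [zpowHom, MonoidHom.finsetProd_apply]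

theorem zpowHom_bas {m : ℕ} (x : ℕ → M) {i : ℕ} (hi : i < m) :
    zpowHom m x (bas m i) = x i := by
  rw [zpowHom_apply, Finset.prod_eq_single (⟨i, hi⟩ : Fin m)]
  · simp [bas, hi]
  · intro j _ hj
    simp [bas, hi, Pi.mulSingle_eq_of_ne hj]
  · simp

theorem zpow_eq_prod_bas {m : ℕ} (a : Zpow m) : a = ∏ i : Fin m, bas m i ^ (a i).toAdd := by
  funext j
  rw [Finset.prod_apply, Finset.prod_eq_single j]
  · simp [bas, ← ofAdd_zsmul]
  · intro i _ hi
    simp [bas, Pi.mulSingle_eq_of_ne hi.symm]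
  · simp

theorem map_eq_prod_bas {m : ℕ} (f : Zpow m →* M) (a : Zpow m) :
    f a = ∏ i : Fin m, f (bas m i) ^ (a i).toAdd := by
  conv_lhs => rw [zpow_eq_prod_bas a]
  rw [map_prod]
  simp

theorem closure_bas (m : ℕ) : Subgroup.closure (bas m '' Set.Iio m) = ⊤ := by
  refine (Subgroup.eq_top_iff' _).2 fun a => ?_
  rw [zpow_eq_prod_bas a]
  exact Subgroup.prod_mem _ fun i _ =>
    Subgroup.zpow_mem _ (Subgroup.subset_closure
      (Set.mem_image_of_mem (bas m) (Set.mem_Iio.2 i.isLt))) _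

theorem zpow_torsionfree {m : ℕ} {a : Zpow m} {n : ℤ} (hn : n ≠ 0) (h : a ^ n = 1) : a = 1 := by
  funext i
  have := congrFun h i
  rw [Pi.pow_apply, Pi.one_apply, ← toAdd_eq_zero, toAdd_zpow, smul_eq_mul] at this
  rw [Pi.one_apply, ← toAdd_eq_zero]
  exact (mul_eq_zero.1 this).resolve_left hn

/-- More than `m` elements of a group that is free abelian of rank `m` up to finite torsion satisfy
a nontrivial relation. -/
theorem exists_relation {m N : ℕ} {T : Type v} [CommGroup T] (hN : N ≠ 0) (hT : ∀ t : T, t ^ N = 1)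
    (z : ℕ → Zpow m × T) : ∃ a : Zpow (m + 1), a ≠ 1 ∧ zpowHom (m + 1) z a = 1 := by
  have hdep : ¬ LinearIndependent ℤ (fun (i : Fin (m + 1)) (j : Fin m) => ((z i).1 j).toAdd) := by
    intro h
    have := h.fintype_card_le_finrank
    simp at this
  rw [Fintype.not_linearIndependent_iff] at hdep
  obtain ⟨c, hc, i, hi⟩ := hdep
  refine ⟨fun j => ofAdd (N * c j), fun h => ?_, ?_⟩
  · have := congrFun h i
    simp [hN, hi] at this
  · rw [zpowHom_apply]
    refine Prod.ext ?_ ?_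
    · funext j
      have := congrFun hc j
      simp only [Finset.sum_apply, Pi.smul_apply, smul_eq_mul, Pi.zero_apply] at this
      simp only [toAdd_ofAdd, Prod.fst_prod, Prod.pow_fst, Finset.prod_apply, Pi.pow_apply,
        Prod.fst_one, Pi.one_apply]
      rw [← toAdd_eq_zero, toAdd_prod]
      simp only [toAdd_zpow, smul_eq_mul, mul_assoc]
      rw [← Finset.mul_sum, this, mul_zero]
    · simp only [toAdd_ofAdd, Prod.snd_prod, Prod.pow_snd, Prod.snd_one]
      exact Finset.prod_eq_one fun j _ => by rw [zpow_mul, zpow_natCast, hT, one_zpow]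

end FreeAbelian

/-! ### An algebraic characterization of a finitely generated abelian group -/

section Characterization

variable (r : ℕ) {N : ℕ} {T : Type} [CommGroup T] (τ : Fin N ≃ T)

/-- The generators of `Zpow r × T`: the basis of `Zpow r`, then all elements of `T`, then `1`. -/
def gen (i : ℕ) : Zpow r × T :=
  if i < r then (bas r i, 1) else if h : i - r < N then (1, τ ⟨i - r, h⟩) else 1

/-- The assignment in `Zpow r × ℤ` that remembers the exponents of the variables `x₀, …, x_{r-1}`
and of `x_k`. -/
def expAssign (k : ℕ) (i : ℕ) : Zpow r × Multiplicative ℤ :=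
  if i < r then (bas r i, 1) else if i = k then (1, ofAdd 1) else 1

/-- For `q = (a, n)`: in a group `Zpow r × T`, the equation `a * y ^ n = 1` forces `y ∈ T` for the
trivial reason that `n ≠ 0` and that `n` divides `a` only if `a = 1`. -/
def ForcesTorsion (q : Zpow r × Multiplicative ℤ) : Prop :=
  q.2 ≠ 1 ∧ ((∀ i, q.2.toAdd ∣ (q.1 i).toAdd) → q.1 = 1)

variable (M : Type u) [grp.Structure M]

/-- The `Σ₂` part of the characterization of `Zpow r × T`: some tuple `x` has the atomic type of
the generators, and the elements outside the copy of `T` in `x` satisfy none of the equations with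
coefficients in `x` that force torsion. -/
def SigmaCond : Prop :=
  ∃ x : ℕ → M,
    (∀ s t : grp.Term ℕ, ↑s.varFinset ⊆ Set.Iio (r + N) → ↑t.varFinset ⊆ Set.Iio (r + N) →
      (s.realize x = t.realize x ↔ s.realize (gen r τ) = t.realize (gen r τ))) ∧
    ∀ y : M, ∀ s t : grp.Term ℕ,
      ↑s.varFinset ⊆ Set.Iio (r + N + 1) → ↑t.varFinset ⊆ Set.Iio (r + N + 1) →
      ForcesTorsion r (s.realize (expAssign r (r + N)) / t.realize (expAssign r (r + N))) →
      s.realize (Function.update x (r + N) y) = t.realize (Function.update x (r + N) y) →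
      ∃ j < N, y = x (r + j)

/-- The axioms of abelian groups. -/
def AbelianAxioms : Prop :=
  ∀ x y z : M, sMul (sMul x y) z = sMul x (sMul y z) ∧ sMul (sOne M) x = x ∧
    sMul (sInv x) x = sOne M ∧ sMul x y = sMul y x

/-- Any `r + 1` elements satisfy a nontrivial relation of abelian groups. -/
def RankCond : Prop :=
  ∀ z : ℕ → M, ∃ s t : grp.Term ℕ,
    ↑s.varFinset ⊆ Set.Iio (r + 1) ∧ ↑t.varFinset ⊆ Set.Iio (r + 1) ∧
    s.realize (bas (r + 1)) ≠ t.realize (bas (r + 1)) ∧ s.realize z = t.realize z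

variable {M}

theorem exists_commGroup {M : Type u} [inst : grp.Structure M] (h : AbelianAxioms M) :
    ∃ _ : CommGroup M, structureOfGroup M = inst := by
  let : Mul M := ⟨sMul⟩
  let : Inv M := ⟨sInv⟩
  let : One M := ⟨sOne M⟩
  let g : Group M := Group.ofLeftAxioms (fun x y z => (h x y z).1) (fun x => (h x x x).2.1)
    (fun x => (h x x x).2.2.1)
  refine ⟨{ g with mul_comm := fun x y => (h x y x).2.2.2 }, ?_⟩
  refine Structure.ext ?_ ?_
  · funext n f x
    cases f with
    | one => exact (funMap_one (M := M) x).symm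
    | inv => exact (funMap_inv (M := M) x).symm
    | mul => exact (funMap_mul (M := M) x).symm
  · funext n r
    exact nomatch r

variable {r τ}

theorem gen_of_lt {i : ℕ} (h : i < r) : gen r τ i = (bas r i, 1) := by
  simp [gen, h]

theorem gen_add (j : Fin N) : gen r τ (r + j) = (1, τ j) := by
  simp [gen]

theorem closure_gen : Subgroup.closure (gen r τ '' Set.Iio (r + N)) = ⊤ := by
  refine (Subgroup.eq_top_iff' _).2 fun a => ?_
  have h1 : ((a.1, 1) : Zpow r × T) ∈ Subgroup.closure (gen r τ '' Set.Iio (r + N)) := by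
    have : ((a.1, 1) : Zpow r × T) = ∏ i : Fin r, gen r τ i ^ (a.1 i).toAdd := by
      refine (map_eq_prod_bas (MonoidHom.inl _ T) a.1).trans ?_
      simp [gen_of_lt]
    rw [this]
    exact Subgroup.prod_mem _ fun i _ => Subgroup.zpow_mem _
      (Subgroup.subset_closure (Set.mem_image_of_mem _ (Set.mem_Iio.2 (by omega)))) _
  have h2 : ((1, a.2) : Zpow r × T) ∈ Subgroup.closure (gen r τ '' Set.Iio (r + N)) := by
    refine Subgroup.subset_closure ⟨r + τ.symm a.2, by simp, ?_⟩
    rw [gen_add, Equiv.apply_symm_apply]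
  have : a = (a.1, 1) * (1, a.2) := by simp
  rw [this]
  exact Subgroup.mul_mem _ h1 h2

theorem forcesTorsion_sound (y : Zpow r × T) {s t : grp.Term ℕ}
    (hs : ↑s.varFinset ⊆ Set.Iio (r + N + 1)) (ht : ↑t.varFinset ⊆ Set.Iio (r + N + 1))
    (hF : ForcesTorsion r (s.realize (expAssign r (r + N)) / t.realize (expAssign r (r + N))))
    (h : s.realize (Function.update (gen r τ) (r + N) y) =
      t.realize (Function.update (gen r τ) (r + N) y)) :
    ∃ j < N, y = gen r τ (r + j) := by
  let p : Zpow r × Multiplicative ℤ →* Zpow r :=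
    (MonoidHom.fst _ _) * ((zpowersHom _ y.1).comp (MonoidHom.snd _ _))
  have hp : ∀ q, p q = q.1 * y.1 ^ q.2.toAdd := fun q => by simp [p]
  have key : ∀ i < r + N + 1, (Function.update (gen r τ) (r + N) y i).1 =
      p (expAssign r (r + N) i) := by
    intro i hi
    rcases eq_or_ne i (r + N) with rfl | hne
    · rcases N with _ | N
      · simp [hp, expAssign]
      · simp [hp, expAssign]
    · rw [Function.update_of_ne hne, hp]
      by_cases hr : i < r
      · simp [gen, expAssign, hr]
      · have : i - r < N := by omega
        simp [gen, expAssign, hr, hne, this]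
  have key' : ∀ u : grp.Term ℕ, ↑u.varFinset ⊆ Set.Iio (r + N + 1) →
      (u.realize (Function.update (gen r τ) (r + N) y)).1 =
        p (u.realize (expAssign r (r + N))) := by
    intro u hu
    rw [map_realize]
    refine (map_realize (MonoidHom.fst (Zpow r) T) _ u).trans
      (ScottGroup.realize_congr fun i hi => ?_)
    exact key i (hu hi)
  have h1 : p (s.realize (expAssign r (r + N)) / t.realize (expAssign r (r + N))) = 1 := by
    rw [map_div, ← key' s hs, ← key' t ht, h, div_self']
  generalize s.realize (expAssign r (r + N)) / t.realize (expAssign r (r + N)) = q at hF h1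
  rw [hp] at h1
  have hq : q.1 = 1 := by
    refine hF.2 fun i => ?_
    have := congrArg toAdd (congrFun h1 i)
    simp only [Pi.mul_apply, Pi.pow_apply, toAdd_mul, toAdd_zpow, smul_eq_mul, Pi.one_apply,
      toAdd_one] at this
    exact ⟨-(y.1 i).toAdd, by linarith⟩
  rw [hq, one_mul] at h1
  have hy : y.1 = 1 := zpow_torsionfree (by simpa using hF.1) h1
  refine ⟨τ.symm y.2, (τ.symm y.2).2, ?_⟩
  rw [gen_add, Equiv.apply_symm_apply, ← hy]

theorem pos_of_equiv (τ : Fin N ≃ T) : N ≠ 0 := by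
  rintro rfl
  exact (τ.symm 1).elim0

theorem pow_eq_one_of_equiv (τ : Fin N ≃ T) (t : T) : t ^ N = 1 := by
  have := Nat.card_congr τ
  rw [Nat.card_fin] at this
  rw [this]
  exact pow_card_eq_one'

theorem rankCond_model (τ : Fin N ≃ T) : RankCond r (Zpow r × T) := by
  intro z
  obtain ⟨a, ha, hz⟩ := exists_relation (pos_of_equiv τ) (pow_eq_one_of_equiv τ) z
  obtain ⟨s, hs, rfl⟩ := exists_realize_eq_of_mem_closure (a := bas (r + 1)) (X := Set.Iio (r + 1))
    (x := a) (by rw [closure_bas]; trivial)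
  refine ⟨s, tOne, hs, by simp, by simpa using ha, ?_⟩
  rw [map_realize] at hz
  rw [realize_tOne, sOne_eq, ← hz]
  exact ScottGroup.realize_congr fun i hi => (zpowHom_bas z (hs hi)).symm

section Converse

variable {M : Type u} [CommGroup M]

/-- A tuple with the atomic type of the generators spans a copy of the group. -/
theorem exists_embedding {x : ℕ → M}
    (hx : ∀ s t : grp.Term ℕ, ↑s.varFinset ⊆ Set.Iio (r + N) → ↑t.varFinset ⊆ Set.Iio (r + N) →
      (s.realize x = t.realize x ↔ s.realize (gen r τ) = t.realize (gen r τ))) :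
    ∃ f : Zpow r × T →* M, Function.Injective f ∧ ∀ i < r + N, f (gen r τ i) = x i := by
  have hex : ∀ g : Zpow r × T, ∃ s : grp.Term ℕ, ↑s.varFinset ⊆ Set.Iio (r + N) ∧
      s.realize (gen r τ) = g := fun g =>
    exists_realize_eq_of_mem_closure (by rw [closure_gen]; trivial)
  choose S hS hSg using hex
  refine ⟨MonoidHom.mk' (fun g => (S g).realize x) fun g h => ?_, fun g h hgh => ?_, ?_⟩
  · change (S (g * h)).realize x = (S g).realize x * (S h).realize x
    rw [← sMul_eq ((S g).realize x), ← realize_tMul, hx _ _ (hS _) (by simp [hS])]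
    simp [hSg]
  · change (S g).realize x = (S h).realize x at hgh
    rw [hx _ _ (hS _) (hS _), hSg, hSg] at hgh
    exact hgh
  · intro i hi
    refine (hx _ (.var i) (hS _) (by simpa using hi)).2 ?_
    rw [hSg]; rfl

/-- The purity argument: by `RankCond` every element `y` has a nontrivial power in the copy of
`Zpow r × T`, and the second clause of `SigmaCond`, applied to `y` or to `y` times an element of
the copy, puts `y` into the copy. -/
theorem nonempty_mulEquiv_of_conds (hσ : SigmaCond r τ M) (hr : RankCond r M) :
    Nonempty (M ≃* Zpow r × T) := by
  obtain ⟨x, hx, hy⟩ := hσ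
  obtain ⟨f, hf, hfx⟩ := exists_embedding hx
  have hfa : ∀ a : Zpow r, f (a, 1) = zpowHom r x a := by
    intro a
    have : ((a, 1) : Zpow r × T) = ∏ i : Fin r, gen r τ i ^ (a i).toAdd := by
      refine (map_eq_prod_bas (MonoidHom.inl _ T) a).trans ?_
      simp [gen_of_lt]
    rw [this, map_prod, zpowHom_apply]
    refine Finset.prod_congr rfl fun i _ => ?_
    rw [map_zpow, hfx _ (by omega)]
  have pure : ∀ (y : M) (n : ℤ) (a : Zpow r), n ≠ 0 → ((∀ i, n ∣ (a i).toAdd) → a = 1) →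
      f (a, 1) * y ^ n = 1 → y ∈ f.range := by
    intro y n a hn hdiv h
    let p : Zpow r × Multiplicative ℤ →* M :=
      ((zpowHom r x).comp (MonoidHom.fst _ _)) * ((zpowersHom _ y).comp (MonoidHom.snd _ _))
    have hp : ∀ q, p q = zpowHom r x q.1 * y ^ q.2.toAdd := fun q => by simp [p]
    obtain ⟨s, hs, hsv⟩ := exists_realize_eq_of_mem_closure (a := expAssign r (r + N))
      (X := Set.Iio r ∪ {r + N}) (x := (a, ofAdd n)) (by
        have : ((a, ofAdd n) : Zpow r × Multiplicative ℤ) =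
            (∏ i : Fin r, expAssign r (r + N) i ^ (a i).toAdd) *
              expAssign r (r + N) (r + N) ^ n := by
          have ha := map_eq_prod_bas (MonoidHom.inl _ (Multiplicative ℤ)) a
          rw [show ((a, ofAdd n) : Zpow r × Multiplicative ℤ) =
            MonoidHom.inl _ (Multiplicative ℤ) a * (1, ofAdd n) by simp, ha]
          congr 1
          · simp [expAssign]
          · simp [expAssign, ← ofAdd_zsmul]
        rw [this]
        refine Subgroup.mul_mem _ (Subgroup.prod_mem _ fun i _ => Subgroup.zpow_mem _ ?_ _)
          (Subgroup.zpow_mem _ ?_ _)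
        · exact Subgroup.subset_closure ⟨i, .inl i.2, rfl⟩
        · exact Subgroup.subset_closure ⟨r + N, .inr rfl, rfl⟩)
    obtain ⟨j, hj, rfl⟩ := hy y s tOne
      (fun i hi => by
        rcases hs hi with h | h
        · simp only [Set.mem_Iio] at h ⊢; omega
        · simp only [Set.mem_singleton_iff] at h; simp [h])
      (by simp) (by simpa [hsv, ForcesTorsion, hn] using hdiv) (by
        rw [realize_tOne, sOne_eq, ← h, hfa]
        have : zpowHom r x a * y ^ n = p (a, ofAdd n) := by simp [hp]
        rw [this, ← hsv, map_realize]
        refine ScottGroup.realize_congr fun i hi => ?_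
        rw [hp]
        rcases hs hi with h | h
        · simp only [Set.mem_Iio] at h
          rw [Function.update_of_ne (by omega)]
          simp [expAssign, h, zpowHom_bas]
        · simp only [Set.mem_singleton_iff] at h
          subst h
          simp [expAssign])
    exact ⟨_, hfx _ (by omega)⟩
  have hsurj : Function.Surjective f := by
    intro y
    obtain ⟨s, t, hs, ht, hne, hst⟩ := hr (Function.update x r y)
    have hval : ∀ u : grp.Term ℕ, ↑u.varFinset ⊆ Set.Iio (r + 1) →
        u.realize (Function.update x r y) =
          zpowHom (r + 1) (Function.update x r y) (u.realize (bas (r + 1))) := by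
      intro u hu
      rw [map_realize]
      exact ScottGroup.realize_congr fun i hi => (zpowHom_bas _ (hu hi)).symm
    have hq : zpowHom (r + 1) (Function.update x r y)
        (s.realize (bas (r + 1)) / t.realize (bas (r + 1))) = 1 := by
      rw [map_div, ← hval s hs, ← hval t ht, hst, div_self']
    have hne' := div_ne_one.2 hne
    generalize s.realize (bas (r + 1)) / t.realize (bas (r + 1)) = q at hq hne'
    set a : Zpow r := fun i => q i.castSucc with ha
    set n : ℤ := (q (Fin.last r)).toAdd with hn
    have hrel : f (a, 1) * y ^ n = 1 := by
      rw [hfa, zpowHom_apply, ← hq, zpowHom_apply, Fin.prod_univ_castSucc]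
      congr 1
      · refine Finset.prod_congr rfl fun i _ => ?_
        rw [Function.update_of_ne (by simpa using i.2.ne)]
        simp [ha]
      · simp [hn]
    have hn0 : n ≠ 0 := by
      intro h0
      rw [h0, zpow_zero, mul_one, map_eq_one_iff f hf] at hrel
      refine hne' (funext fun i => ?_)
      induction i using Fin.lastCases with
      | last => simpa [hn] using h0
      | cast i => exact congrFun (congrArg Prod.fst hrel) i
    change y ∈ f.range
    by_cases hd : ∀ i, n ∣ (a i).toAdd
    · choose b hb using hd
      have hab : a = (fun i => ofAdd (b i) : Zpow r) ^ n := by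
        funext i
        rw [Pi.pow_apply, ← ofAdd_zsmul, smul_eq_mul, ← hb, ofAdd_toAdd]
      have : f (fun i => ofAdd (b i), 1) * y ∈ f.range := by
        refine pure _ n 1 hn0 (fun _ => rfl) ?_
        rw [mul_zpow, ← map_zpow, Prod.pow_mk, ← hab, one_zpow, hrel, mul_one]
        exact map_one f
      exact (Subgroup.mul_mem_cancel_left _ (MonoidHom.mem_range.2 ⟨_, rfl⟩)).1 this
    · exact pure y n a hn0 (fun h => absurd h hd) hrel
  exact ⟨(MulEquiv.ofBijective f ⟨hf, hsurj⟩).symm⟩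

end Converse

/-- The characterization of the copies of `Zpow r × T` by a `Σ₂` and a `Π₂` condition. -/
theorem nonempty_equiv_iff {M : Type u} [grp.Structure M] :
    Nonempty (M ≃[grp] Zpow r × T) ↔ SigmaCond r τ M ∧ AbelianAxioms M ∧ RankCond r M := by
  constructor
  · rintro ⟨e⟩
    have hreal : ∀ (s : grp.Term ℕ) (a : ℕ → M),
        s.realize (fun i => e (a i)) = e (s.realize a) :=
      fun s a => HomClass.realize_term e
    have hreal' : ∀ (s : grp.Term ℕ) (a : ℕ → Zpow r × T),
        s.realize (fun i => e.symm (a i)) = e.symm (s.realize a) :=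
      fun s a => HomClass.realize_term e.symm
    have h1 : e (sOne M) = 1 := by
      simpa using (hreal tOne (fun _ => sOne M)).symm
    have h2 : ∀ x, e (sInv x) = (e x)⁻¹ := fun x => by
      simpa using (hreal (tInv (.var 0)) (fun _ => x)).symm
    have h3 : ∀ x y, e (sMul x y) = e x * e y := fun x y => by
      simpa using (hreal (tMul (.var 0) (.var 1)) (fun i => if i = 0 then x else y)).symm
    refine ⟨⟨fun i => e.symm (gen r τ i), fun s t _ _ => ?_, fun y s t hs ht hF h => ?_⟩, ?_, ?_⟩
    · rw [hreal', hreal', e.symm.injective.eq_iff]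
    · have hup : (fun i => e (Function.update (fun i => e.symm (gen r τ i)) (r + N) y i)) =
          Function.update (gen r τ) (r + N) (e y) := by
        funext i
        rcases eq_or_ne i (r + N) with rfl | hne
        · simp
        · simp [hne]
      obtain ⟨j, hj, hyj⟩ := forcesTorsion_sound (τ := τ) (e y) hs ht hF (by
        rw [← hup, hreal, hreal, h])
      exact ⟨j, hj, by simp [← hyj]⟩
    · intro x y z
      refine ⟨?_, ?_, ?_, ?_⟩ <;> apply e.injective
      · simp [h3, mul_assoc]
      · simp [h3, h1]
      · simp [h3, h2, h1]
      · simp [h3, mul_comm]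
    · intro z
      obtain ⟨s, t, hs, ht, hne, hst⟩ := rankCond_model (r := r) τ (fun i => e (z i))
      rw [hreal, hreal, e.injective.eq_iff] at hst
      exact ⟨s, t, hs, ht, hne, hst⟩
  · rintro ⟨hσ, hA, hR⟩
    obtain ⟨_, rfl⟩ := exists_commGroup hA
    exact nonempty_grpEquiv_iff.2 (nonempty_mulEquiv_of_conds hσ hR)

end Characterization

/-! ### Optimality of the complexity of the sentence -/

section Preservation

variable {M : Type u} {N : Type v} [Group M] [Group N]

theorem QFFormula.realize_of_injective {f : M →* N} (hf : Function.Injective f)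
    (θ : QFFormula) (a : ℕ → M) : θ.Realize (fun i => f (a i)) ↔ θ.Realize a := by
  induction θ with
  | eq s t | ne s t => simp only [QFFormula.Realize, ← map_realize, hf.eq_iff, ne_eq]
  | and θ η ih₁ ih₂ | or θ η ih₁ ih₂ => simp only [QFFormula.Realize, ih₁, ih₂]

/-- Only finitely many nontrivial elements matter for the truth of a quantifier-free formula under
homomorphisms. -/
theorem QFFormula.exists_finset_realize_iff (θ : QFFormula) (a : ℕ → M) :
    ∃ F : Finset M, (1 : M) ∉ F ∧ ∀ f : M →* N, (∀ x ∈ F, f x ≠ 1) →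
      (θ.Realize (fun i => f (a i)) ↔ θ.Realize a) := by
  classical
  have key : ∀ s t : grp.Term ℕ, ∃ F : Finset M, (1 : M) ∉ F ∧ ∀ f : M →* N,
      (∀ x ∈ F, f x ≠ 1) → (s.realize (fun i => f (a i)) = t.realize (fun i => f (a i)) ↔
        s.realize a = t.realize a) := by
    intro s t
    by_cases h : s.realize a = t.realize a
    · exact ⟨∅, by simp, fun f _ => by simp only [← map_realize, h]⟩
    · refine ⟨{s.realize a / t.realize a},
        fun h1 => h (div_eq_one.1 (Finset.mem_singleton.1 h1).symm),
        fun f hf => ?_⟩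
      have := hf _ (Finset.mem_singleton_self _)
      rw [map_div, div_ne_one] at this
      simp only [← map_realize, this, h]
  induction θ with
  | eq s t => exact key s t
  | ne s t =>
    obtain ⟨F, hF, h⟩ := key s t
    exact ⟨F, hF, fun f hf => not_congr (h f hf)⟩
  | and θ η ih₁ ih₂ =>
    obtain ⟨F₁, h1, h1'⟩ := ih₁
    obtain ⟨F₂, h2, h2'⟩ := ih₂
    exact ⟨F₁ ∪ F₂, by simp [h1, h2], fun f hf => and_congr
      (h1' f fun x hx => hf x (by simp [hx])) (h2' f fun x hx => hf x (by simp [hx]))⟩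
  | or θ η ih₁ ih₂ =>
    obtain ⟨F₁, h1, h1'⟩ := ih₁
    obtain ⟨F₂, h2, h2'⟩ := ih₂
    exact ⟨F₁ ∪ F₂, by simp [h1, h2], fun f hf => or_congr
      (h1' f fun x hx => hf x (by simp [hx])) (h2' f fun x hx => hf x (by simp [hx]))⟩

namespace InfFormula

theorem IsIndex.exists_qf {φ : InfFormula} {p : Polarity} {e : ℕ} (h : φ.IsIndex p 0 e) :
    ∃ θ, φ = qf θ := by
  cases φ with
  | qf θ => exact ⟨θ, rfl⟩
  | disjEx I xs ψ => exact absurd h.2.1 (lt_irrefl 0)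
  | conjAll I xs ψ => exact absurd h.2.1 (lt_irrefl 0)

/-- Computable `Σ₁` formulas are preserved by embeddings. -/
theorem IsIndex.realize_map {φ : InfFormula} {m e : ℕ} (hm : m < 2)
    (h : φ.IsIndex Polarity.sigma m e) {f : M →* N} (hf : Function.Injective f) {a : ℕ → M}
    (ha : φ.Realize a) : φ.Realize (fun i => f (a i)) := by
  cases φ with
  | qf θ => exact (θ.realize_of_injective hf a).2 ha
  | conjAll I xs ψ => exact absurd h.1 (by simp)
  | disjEx I xs ψ =>
    obtain ⟨i, hi, b, hb, hψ⟩ := ha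
    refine ⟨i, hi, fun x => f (b x), fun x hx => by simp [hb x hx], ?_⟩
    obtain ⟨m', hm', j, -, hj⟩ := h.2.2.2 i hi
    obtain rfl : m' = 0 := by omega
    obtain ⟨θ, hθ⟩ := hj.exists_qf
    rw [hθ] at hψ ⊢
    exact (θ.realize_of_injective hf b).2 hψ

/-- Computable `Π₁` formulas are preserved by embeddings `g` that have enough left inverses. -/
theorem IsIndex.realize_map_of_retract {φ : InfFormula} {m e : ℕ} (hm : m < 2)
    (h : φ.IsIndex Polarity.pi m e) {g : N →* M}
    (hg : ∀ F : Finset M, (1 : M) ∉ F → ∃ f : M →* N, (∀ x, f (g x) = x) ∧ ∀ x ∈ F, f x ≠ 1)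
    {a : ℕ → N} (ha : φ.Realize a) : φ.Realize (fun i => g (a i)) := by
  have hinj : Function.Injective g := by
    obtain ⟨f, hf, -⟩ := hg ∅ (by simp)
    exact Function.LeftInverse.injective hf
  cases φ with
  | qf θ => exact (θ.realize_of_injective hinj a).2 ha
  | disjEx I xs ψ => exact absurd h.1 (by simp)
  | conjAll I xs ψ =>
    intro i hi b hb
    obtain ⟨m', hm', j, -, hj⟩ := h.2.2.2 i hi
    obtain rfl : m' = 0 := by omega
    obtain ⟨θ, hθ⟩ := hj.exists_qf
    obtain ⟨F, hF, hFθ⟩ := θ.exists_finset_realize_iff (N := N) b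
    obtain ⟨f, hfg, hf⟩ := hg F hF
    have := ha i hi (fun x => f (b x)) fun x hx => by simp [hb x hx, hfg]
    rw [hθ] at this ⊢
    exact (hFθ f hf).1 this

theorem IsComputableSigma.models_of_retract {φ : InfFormula} (hφ : φ.IsComputableSigma 2)
    (hs : φ.IsSentence) {g : N →* M}
    (hg : ∀ F : Finset M, (1 : M) ∉ F → ∃ f : M →* N, (∀ x, f (g x) = x) ∧ ∀ x ∈ F, f x ≠ 1)
    (h : Models N φ) : Models M φ := by
  rw [hs.models_iff fun _ => g 1]
  obtain ⟨e, he⟩ := hφ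
  have := h fun _ => 1
  cases φ with
  | qf θ => exact absurd he.1 (by simp)
  | conjAll I xs ψ => exact absurd he.1 (by simp)
  | disjEx I xs ψ =>
    obtain ⟨i, hi, b, hb, hψ⟩ := this
    obtain ⟨m, hm, j, -, hj⟩ := he.2.2.2 i hi
    exact ⟨i, hi, fun x => g (b x), fun x hx => by simp only [hb x hx],
      hj.realize_map_of_retract hm hg hψ⟩

theorem IsComputablePi.models_of_local {φ : InfFormula} (hφ : φ.IsComputablePi 2)
    (hs : φ.IsSentence)
    (hg : ∀ F : Finset N, ∃ f : M →* N, Function.Injective f ∧ ∀ x ∈ F, x ∈ f.range)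
    (h : Models M φ) : Models N φ := by
  classical
  rw [hs.models_iff fun _ => 1]
  obtain ⟨e, he⟩ := hφ
  cases φ with
  | qf θ => exact absurd he.1 (by simp)
  | disjEx I xs ψ => exact absurd he.1 (by simp)
  | conjAll I xs ψ =>
    intro i hi b hb
    obtain ⟨m, hm, j, -, hj⟩ := he.2.2.2 i hi
    obtain ⟨f, hf, hF⟩ := hg ((xs i).toFinset.image b)
    have hrange : ∀ x, ∃ y, f y = b x := by
      intro x
      by_cases hx : x ∈ xs i
      · exact hF (b x) (Finset.mem_image_of_mem _ (by simpa using hx))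
      · exact ⟨1, by rw [hb x hx, map_one]⟩
    choose a ha using hrange
    have hb' : b = fun x => f (a x) := by funext x; exact (ha x).symm
    rw [hb']
    refine hj.realize_map hm hf (h (fun _ => 1) i hi a fun x hx => hf ?_)
    rw [ha, hb x hx, map_one]

end InfFormula

end Preservation

section Optimality

variable {r N : ℕ} {T : Type} [CommGroup T]

/-- The infinitely `2`-divisible elements are torsion elements. -/
theorem pow_eq_one_of_divisible (τ : Fin N ≃ T) {x : Zpow r × T}
    (h : ∀ k, ∃ y, y ^ 2 ^ k = x) : x ^ N = 1 := by
  have h1 : x.1 = 1 := by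
    funext i
    rw [Pi.one_apply, ← toAdd_eq_zero]
    refine Int.eq_zero_of_abs_lt_dvd (m := 2 ^ ((x.1 i).toAdd.natAbs)) ?_ ?_
    · obtain ⟨y, hy⟩ := h (x.1 i).toAdd.natAbs
      have := congrArg (fun z : Zpow r × T => (z.1 i).toAdd) hy
      simp only [Prod.pow_fst, Pi.pow_apply, toAdd_pow, nsmul_eq_mul, Nat.cast_pow,
        Nat.cast_ofNat] at this
      exact ⟨_, this.symm⟩
    · rw [Int.abs_eq_natAbs]
      exact_mod_cast Nat.lt_two_pow_self
  exact Prod.ext (by simp [h1]) (by simp [pow_eq_one_of_equiv τ])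

/-- An isomorphism would make the projection onto `Zpow r × T` a surjective endomorphism of a
Noetherian group with nontrivial kernel. -/
theorem not_mulEquiv_prod_int [Finite T] :
    IsEmpty ((Zpow r × T) × Multiplicative ℤ ≃* Zpow r × T) := by
  refine ⟨fun e => ?_⟩
  have : Module.Finite ℤ (Additive (Zpow r × T)) := by
    have : Module.Finite ℤ (Additive (Zpow r)) :=
      Module.Finite.equiv (M := Fin r → ℤ) (AddEquiv.toIntLinearEquiv
        { toFun := fun a => Additive.ofMul fun i => ofAdd (a i)
          invFun := fun a i => (a.toMul i).toAdd
          left_inv := fun _ => rfl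
          right_inv := fun _ => rfl
          map_add' := fun _ _ => rfl })
    have : Module.Finite ℤ (Additive T) := Module.Finite.of_finite
    exact Module.Finite.equiv (M := Additive (Zpow r) × Additive T)
      (AddEquiv.toIntLinearEquiv (AddEquiv.prodAdditive _ _).symm)
  let f : Additive (Zpow r × T) →ₗ[ℤ] Additive (Zpow r × T) :=
    (MonoidHom.toAdditive ((MonoidHom.fst _ _).comp e.symm.toMonoidHom)).toIntLinearMap
  have hf : Function.Surjective f := fun y => ⟨Additive.ofMul (e (y.toMul, 1)), by
    change Additive.ofMul (e.symm (e (y.toMul, 1))).1 = y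
    rw [e.symm_apply_apply]; rfl⟩
  have hinj := OrzechProperty.injective_of_surjective_endomorphism f hf
  have h1 : f (Additive.ofMul (e (1, ofAdd 1))) = f (Additive.ofMul (e (1, 1))) := by
    change Additive.ofMul (e.symm (e (1, ofAdd 1))).1 = Additive.ofMul (e.symm (e (1, 1))).1
    rw [e.symm_apply_apply, e.symm_apply_apply]
  have h2 : e (1, ofAdd 1) = e (1, 1) := hinj h1
  have h3 := congrArg (fun z => z.2.toAdd) (e.injective h2)
  simp at h3

/-- `Zpow (r + 1) × T` with its first coordinate split off. -/
def splitFirst (r : ℕ) (T : Type) [CommGroup T] :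
    Zpow (r + 1) × T ≃* Multiplicative ℤ × (Zpow r × T) where
  toFun x := (x.1 0, (fun i => x.1 i.succ, x.2))
  invFun y := (Fin.cons y.1 y.2.1, y.2.2)
  left_inv x := by
    refine Prod.ext ?_ rfl
    funext i
    refine Fin.cases ?_ (fun i => ?_) i <;> simp
  right_inv y := by simp
  map_mul' x y := rfl

theorem exists_retract (F : Finset ((Zpow (r + 1) × T) × Multiplicative ℤ))
    (hF : (1 : (Zpow (r + 1) × T) × Multiplicative ℤ) ∉ F) :
    ∃ f : (Zpow (r + 1) × T) × Multiplicative ℤ →* Zpow (r + 1) × T,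
      (∀ x, f (MonoidHom.inl _ _ x) = x) ∧ ∀ x ∈ F, f x ≠ 1 := by
  let n : ℕ := F.sup fun x => (x.1.1 0).toAdd.natAbs
  let b : Zpow (r + 1) × T := (bas (r + 1) 0 ^ (n + 1), 1)
  refine ⟨(MonoidHom.fst _ _) * ((zpowersHom _ b).comp (MonoidHom.snd _ _)), fun x => by simp,
    fun x hx h => ?_⟩
  have h1 : x.1 * b ^ x.2.toAdd = 1 := by simpa using h
  have hle : (x.1.1 0).toAdd.natAbs ≤ n :=
    Finset.le_sup (f := fun x => (x.1.1 0).toAdd.natAbs) hx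
  have h2 := congrArg (fun z : Zpow (r + 1) × T => (z.1 0).toAdd) h1
  simp only [b, bas, Prod.fst_mul, Pi.mul_apply, Prod.pow_fst, Pi.pow_apply, toAdd_mul, toAdd_zpow,
    toAdd_pow, smul_eq_mul, nsmul_eq_mul, Prod.fst_one, Pi.one_apply, toAdd_one,
    Nat.zero_lt_succ, dif_pos, Fin.mk_zero', Pi.mulSingle_eq_same, toAdd_ofAdd,
    mul_one] at h2
  have h3 : x.2.toAdd = 0 := by
    by_contra hne
    have h4 : (x.1.1 0).toAdd = -(x.2.toAdd * ((n + 1 : ℕ) : ℤ)) := by linarith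
    have h5 := congrArg Int.natAbs h4
    rw [Int.natAbs_neg, Int.natAbs_mul, Int.natAbs_natCast] at h5
    have h6 : 1 ≤ x.2.toAdd.natAbs := Int.natAbs_pos.2 hne
    nlinarith
  have h4 : x.1 = 1 := by simpa [h3] using h1
  exact hF (by
    have : x = 1 := Prod.ext h4 (by simpa using h3)
    rwa [this] at hx)

/-- Any finite set of rational numbers lies in an infinite cyclic group. -/
theorem exists_common_denominator (F : Finset ℚ) :
    ∃ d : ℕ, d ≠ 0 ∧ ∀ q ∈ F, ∃ a : ℤ, q = a / d := by
  refine ⟨∏ q ∈ F, q.den, Finset.prod_ne_zero_iff.2 fun q _ => q.den_nz, fun q hq => ?_⟩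
  obtain ⟨c, hc⟩ := Finset.dvd_prod_of_mem (fun q : ℚ => q.den) hq
  refine ⟨q.num * c, ?_⟩
  have hc0 : (c : ℚ) ≠ 0 := by
    rintro h
    have h0 : c = 0 := by exact_mod_cast h
    rw [h0, mul_zero] at hc
    exact Finset.prod_ne_zero_iff.2 (fun q _ => q.den_nz) hc
  rw [hc]
  push_cast
  rw [mul_div_mul_right _ _ hc0, Rat.num_div_den]

/-- `ℚ × Zpow r × T` is locally isomorphic to `Zpow (r + 1) × T`. -/
theorem exists_local_embedding (F : Finset (Multiplicative ℚ × (Zpow r × T))) :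
    ∃ f : Zpow (r + 1) × T →* Multiplicative ℚ × (Zpow r × T),
      Function.Injective f ∧ ∀ x ∈ F, x ∈ f.range := by
  classical
  obtain ⟨d, hd, hF⟩ := exists_common_denominator (F.image fun x => x.1.toAdd)
  have hd' : (d : ℚ)⁻¹ ≠ 0 := inv_ne_zero (by exact_mod_cast hd)
  let g : Multiplicative ℤ →* Multiplicative ℚ := zpowersHom _ (ofAdd ((d : ℚ)⁻¹))
  have hg : ∀ a, (g a).toAdd = a.toAdd / d := fun a => by
    simp [g, toAdd_zpow, div_eq_mul_inv]
  have hgi : Function.Injective g := by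
    intro a b hab
    have h1 := congrArg toAdd hab
    rw [hg, hg, div_eq_mul_inv, div_eq_mul_inv, mul_left_inj' hd'] at h1
    exact toAdd.injective (by exact_mod_cast h1)
  refine ⟨(MonoidHom.prodMap g (MonoidHom.id _)).comp (splitFirst r T).toMonoidHom, ?_, ?_⟩
  · exact (Function.Injective.prodMap hgi Function.injective_id).comp (splitFirst r T).injective
  · intro x hx
    obtain ⟨a, ha⟩ := hF _ (Finset.mem_image_of_mem _ hx)
    refine ⟨(splitFirst r T).symm (ofAdd a, x.2), ?_⟩
    refine Prod.ext ?_ ?_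
    · apply toAdd.injective
      simp [hg, ha]
    · simp

theorem not_mulEquiv_rat (τ : Fin N ≃ T) :
    IsEmpty (Multiplicative ℚ × (Zpow r × T) ≃* Zpow (r + 1) × T) := by
  refine ⟨fun e => ?_⟩
  have h := pow_eq_one_of_divisible τ (x := e (ofAdd 1, 1)) fun k =>
    ⟨e (ofAdd (1 / 2 ^ k), 1), by
      rw [← map_pow, Prod.pow_mk, one_pow, ← ofAdd_nsmul]
      simp⟩
  rw [← map_pow, map_eq_one_iff e e.injective] at h
  have := congrArg (fun z => z.1.toAdd) h
  simp [pos_of_equiv τ] at this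

/-- An isomorphism between a group and its copy in another universe. -/
def ulEquiv (H : Type u) [Group H] : ULift.{v} H ≃[grp] H :=
  grpEquiv Equiv.ulift rfl (fun _ => rfl) (fun _ _ => rfl)

/-- If a sentence that is true in `H` is true in a countable group `H'` which is not isomorphic to
`H`, then it is not a Scott sentence for `H`. -/
theorem not_isScottSentence {H H' : Type} [Group H] [Group H'] [Countable H] [Countable H']
    {G : Type u} [Group G] (e : G ≃* H) (hne : IsEmpty (H' ≃* H)) {φ : InfFormula}
    (h : φ.IsSentence → InfFormula.Models H φ → InfFormula.Models H' φ) :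
    ¬ InfFormula.IsScottSentence.{u, v} φ G := by
  rintro ⟨hs, hφ⟩
  obtain ⟨eG⟩ := nonempty_grpEquiv_iff.2 ⟨e⟩
  have h1 : InfFormula.Models (ULift.{v} H) φ :=
    (hφ (ULift.{v} H)).2 ⟨eG.symm.comp (ulEquiv H)⟩
  have h2 : InfFormula.Models (ULift.{v} H') φ :=
    (InfFormula.models_iff_of_equiv (ulEquiv.{0, v} H') φ).2
      (h hs ((InfFormula.models_iff_of_equiv (ulEquiv.{0, v} H) φ).1 h1))
  obtain ⟨e'⟩ := (hφ (ULift.{v} H')).1 h2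
  obtain ⟨e''⟩ := nonempty_grpEquiv_iff.1 ⟨eG.comp (e'.comp (ulEquiv.{0, v} H').symm)⟩
  exact hne.false e''

theorem not_isScottSentence_of_sigma_or_pi (τ : Fin N ≃ T) {G : Type u} [Group G]
    (e : G ≃* Zpow (r + 1) × T) {φ : InfFormula}
    (hφ : φ.IsComputableSigma 2 ∨ φ.IsComputablePi 2) :
    ¬ InfFormula.IsScottSentence.{u, v} φ G := by
  have : Finite T := Finite.of_equiv _ τ
  rcases hφ with hφ | hφ
  · exact not_isScottSentence e not_mulEquiv_prod_int fun hs h =>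
      hφ.models_of_retract hs exists_retract h
  · have : Countable (Multiplicative ℚ) := inferInstanceAs (Countable ℚ)
    exact not_isScottSentence e (not_mulEquiv_rat τ) fun hs h =>
      hφ.models_of_local hs exists_local_embedding h

end Optimality

/-! ### Computable and recursively enumerable predicates -/

section Predicates

variable {α : Type u} {β : Type v} [Primcodable α] [Primcodable β]

theorem computablePred_comp {p : β → Prop} (hp : ComputablePred p) {f : α → β}
    (hf : Computable f) : ComputablePred fun a => p (f a) := by
  obtain ⟨_, hp⟩ := hp
  exact ⟨inferInstance, hp.comp hf⟩

theorem computablePred_and {p q : α → Prop} (hp : ComputablePred p) (hq : ComputablePred q) :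
    ComputablePred fun a => p a ∧ q a := by
  obtain ⟨_, hp⟩ := hp
  obtain ⟨_, hq⟩ := hq
  exact ⟨inferInstance, (Primrec.and.to_comp.comp hp hq).of_eq fun a => by simp⟩

theorem computablePred_or {p q : α → Prop} (hp : ComputablePred p) (hq : ComputablePred q) :
    ComputablePred fun a => p a ∨ q a := by
  obtain ⟨_, hp⟩ := hp
  obtain ⟨_, hq⟩ := hq
  exact ⟨inferInstance, (Primrec.or.to_comp.comp hp hq).of_eq fun a => by simp⟩

theorem computablePred_const (p : Prop) : ComputablePred fun _ : α => p := by
  classical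
  exact ⟨inferInstance, Computable.const (decide p)⟩

theorem computablePred_eq {f g : α → β} (hf : Computable f) (hg : Computable g) :
    ComputablePred fun a => f a = g a := by
  classical
  exact ⟨inferInstance, (Primrec.eq (α := β)).decide.to_comp.comp hf hg⟩

theorem computablePred_lt {f g : α → ℕ} (hf : Computable f) (hg : Computable g) :
    ComputablePred fun a => f a < g a :=
  ⟨inferInstance, Primrec.nat_lt.decide.to_comp.comp hf hg⟩

theorem computablePred_le {f g : α → ℕ} (hf : Computable f) (hg : Computable g) :
    ComputablePred fun a => f a ≤ g a :=
  ⟨inferInstance, Primrec.nat_le.decide.to_comp.comp hf hg⟩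

theorem computable_ite {σ : Type w} [Primcodable σ] {p : α → Prop} [DecidablePred p]
    (hp : ComputablePred p) {f g : α → σ} (hf : Computable f) (hg : Computable g) :
    Computable fun a => if p a then f a else g a :=
  (Computable.cond hp.decide hf hg).of_eq fun a => by by_cases h : p a <;> simp [h]

theorem computablePred_forall_lt {p : α → ℕ → Prop}
    (hp : ComputablePred fun x : α × ℕ => p x.1 x.2) {f : α → ℕ} (hf : Computable f) :
    ComputablePred fun a => ∀ x < f a, p a x := by
  classical
  have h : Computable fun a => (Nat.rec true (fun x b => b && decide (p a x)) (f a) : Bool) := by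
    refine Computable.nat_rec hf (Computable.const true)
      (h := fun a y => y.2 && decide (p a y.1)) ?_
    exact Primrec.and.to_comp.comp (Computable.snd.comp Computable.snd)
      (hp.decide.comp (Computable.fst.pair (Computable.fst.comp Computable.snd)))
  have key : ∀ a n, (Nat.rec true (fun x b => b && decide (p a x)) n : Bool) =
      decide (∀ x < n, p a x) := by
    intro a n
    induction n with
    | zero => simp
    | succ n ih => simp only [ih, Nat.forall_lt_succ_right, Bool.decide_and]
  exact ⟨inferInstance, h.of_eq fun a => key a (f a)⟩

theorem computablePred_exists_lt {p : α → ℕ → Prop}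
    (hp : ComputablePred fun x : α × ℕ => p x.1 x.2) {f : α → ℕ} (hf : Computable f) :
    ComputablePred fun a => ∃ x < f a, p a x :=
  (computablePred_forall_lt (p := fun a x => ¬ p a x) hp.not hf).not.of_eq fun a => by simp

/-- A predicate is recursively enumerable iff it is the projection of a computable one. -/
theorem rePred_iff {p : α → Prop} :
    REPred p ↔ ∃ q : α × ℕ → Prop, ComputablePred q ∧ ∀ a, p a ↔ ∃ k, q (a, k) := by
  constructor
  · intro h
    obtain ⟨c, hc⟩ := Nat.Partrec.Code.exists_code.1 (show Nat.Partrec _ from h)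
    refine ⟨fun x => (Nat.Partrec.Code.evaln x.2 c (Encodable.encode x.1)).isSome = true,
      computablePred_eq ?_ (Computable.const true), fun a => ?_⟩
    · exact Primrec.option_isSome.to_comp.comp (Nat.Partrec.Code.primrec_evaln.to_comp.comp
        ((Computable.snd.pair (Computable.const c)).pair (Computable.encode.comp Computable.fst)))
    · have h1 : p a ↔ (c.eval (Encodable.encode a)).Dom := by
        rw [hc]; simp [Part.dom_iff_mem]
      rw [h1, Part.dom_iff_mem]
      simp only [Nat.Partrec.Code.evaln_complete, Option.isSome_iff_exists, Option.mem_def]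
      exact exists_comm
  · rintro ⟨q, ⟨_, hq⟩, h⟩
    have h1 : Partrec fun a => Nat.rfind fun k => Part.some (decide (q (a, k))) :=
      Partrec.rfind hq.partrec
    refine h1.dom_re.of_eq fun a => ?_
    rw [h]
    exact Nat.rfind_dom.trans (by simp)

theorem rePred_comp {p : β → Prop} (hp : REPred p) {f : α → β} (hf : Computable f) :
    REPred fun a => p (f a) :=
  Partrec.comp hp hf

theorem rePred_and {p q : α → Prop} (hp : REPred p) (hq : REPred q) :
    REPred fun a => p a ∧ q a := by
  rw [rePred_iff] at *
  obtain ⟨p', hp', h1⟩ := hp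
  obtain ⟨q', hq', h2⟩ := hq
  refine ⟨fun x => p' (x.1, x.2.unpair.1) ∧ q' (x.1, x.2.unpair.2), computablePred_and
    (computablePred_comp hp' ?_) (computablePred_comp hq' ?_), fun a => ?_⟩
  · exact Computable.fst.pair (Computable.fst.comp (Computable.unpair.comp Computable.snd))
  · exact Computable.fst.pair (Computable.snd.comp (Computable.unpair.comp Computable.snd))
  · rw [h1, h2]
    constructor
    · rintro ⟨⟨k, hk⟩, l, hl⟩
      exact ⟨Nat.pair k l, by simp [hk, hl]⟩
    · rintro ⟨k, hk, hl⟩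
      exact ⟨⟨_, hk⟩, _, hl⟩

theorem rePred_or {p q : α → Prop} (hp : REPred p) (hq : REPred q) :
    REPred fun a => p a ∨ q a := by
  rw [rePred_iff] at *
  obtain ⟨p', hp', h1⟩ := hp
  obtain ⟨q', hq', h2⟩ := hq
  refine ⟨fun x => p' x ∨ q' x, computablePred_or hp' hq', fun a => ?_⟩
  rw [h1, h2, exists_or]

theorem rePred_exists {p : α × β → Prop} (hp : REPred p) : REPred fun a => ∃ b, p (a, b) := by
  rw [rePred_iff] at *
  obtain ⟨p', ⟨_, hp'⟩, h1⟩ := hp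
  refine ⟨fun x => ∃ b ∈ (Encodable.decode x.2.unpair.1 : Option β),
    p' ((x.1, b), x.2.unpair.2), ?_, fun a => ?_⟩
  · refine ComputablePred.of_eq (p := fun x : α × ℕ =>
      ((Encodable.decode x.2.unpair.1 : Option β).map fun b =>
        decide (p' ((x.1, b), x.2.unpair.2))) = some true)
      (computablePred_eq ?_ (Computable.const _)) fun x => by simp
    refine Computable.option_map (Computable.decode.comp (Computable.fst.comp
      (Computable.unpair.comp Computable.snd))) (hp'.comp ?_)
    exact ((Computable.fst.comp Computable.fst).pair Computable.snd).pair
      (Computable.snd.comp (Computable.unpair.comp (Computable.snd.comp Computable.fst)))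
  · simp only [h1]
    constructor
    · rintro ⟨b, k, hk⟩
      exact ⟨Nat.pair (Encodable.encode b) k, b, by simp, by simpa using hk⟩
    · rintro ⟨k, b, -, h⟩
      exact ⟨b, _, h⟩

theorem rePred_forall_lt_const (n : ℕ) {p : α → ℕ → Prop}
    (hp : ∀ i, REPred fun a => p a i) : REPred fun a => ∀ i < n, p a i := by
  induction n with
  | zero => exact (computablePred_const True).to_re.of_eq fun a => by simp
  | succ n ih =>
    exact (rePred_and ih (hp n)).of_eq fun a => by rw [Nat.forall_lt_succ_right]

theorem exists_W_eq {S : Set ℕ} (hS : REPred fun n => n ∈ S) : ∃ e, W e = S := by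
  obtain ⟨c, hc⟩ := Nat.Partrec.Code.exists_code.1 (Partrec.nat_iff.1
    (Partrec.map hS (Computable.const 0).to₂))
  refine ⟨Encodable.encode c, Set.ext fun n => ?_⟩
  simp only [W, phi, Denumerable.ofNat_encode, Set.mem_ofPred_eq, hc]
  simp [Part.dom_iff_mem]

end Predicates

/-! ### Computability of the arithmetic of integers and of groups -/

section Integers

theorem encode_natCast_int (n : ℕ) : Encodable.encode (n : ℤ) = 2 * n := by
  change Equiv.intEquivNat (n : ℤ) = _
  rfl

theorem encode_negSucc_int (n : ℕ) : Encodable.encode (Int.negSucc n) = 2 * n + 1 := by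
  change Equiv.intEquivNat (Int.negSucc n) = _
  rfl

theorem primrec_toNat : Primrec Int.toNat := by
  have h : Primrec fun z : ℤ => if Encodable.encode z % 2 = 0 then Encodable.encode z / 2 else 0 :=
    Primrec.ite (Primrec.eq.comp (Primrec.nat_mod.comp Primrec.encode (Primrec.const 2))
      (Primrec.const 0)) (Primrec.nat_div.comp Primrec.encode (Primrec.const 2)) (Primrec.const 0)
  refine h.of_eq fun z => ?_
  cases z with
  | ofNat n =>
    rw [Int.ofNat_eq_natCast, encode_natCast_int]; simp
  | negSucc n =>
    rw [encode_negSucc_int, if_neg (by omega)]; rfl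

theorem primrec_toNat_neg : Primrec fun z : ℤ => (-z).toNat := by
  have h : Primrec fun z : ℤ =>
      if Encodable.encode z % 2 = 0 then 0 else Encodable.encode z / 2 + 1 :=
    Primrec.ite (Primrec.eq.comp (Primrec.nat_mod.comp Primrec.encode (Primrec.const 2))
      (Primrec.const 0)) (Primrec.const 0)
      (Primrec.succ.comp (Primrec.nat_div.comp Primrec.encode (Primrec.const 2)))
  refine h.of_eq fun z => ?_
  cases z with
  | ofNat n =>
    rw [Int.ofNat_eq_natCast, encode_natCast_int]; simp
  | negSucc n =>
    rw [encode_negSucc_int, if_neg (by omega)]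
    simp only [Int.neg_negSucc]
    omega

theorem primrec_natSub : Primrec₂ fun a b : ℕ => (a : ℤ) - b := by
  refine Primrec.encode_iff.1 (Primrec.of_eq (f := fun x : ℕ × ℕ =>
    if x.2 ≤ x.1 then 2 * (x.1 - x.2) else 2 * (x.2 - x.1 - 1) + 1) ?_ fun x => ?_)
  · have h1 : Primrec fun x : ℕ × ℕ => x.1 - x.2 := Primrec.nat_sub.comp Primrec.fst Primrec.snd
    have h2 : Primrec fun x : ℕ × ℕ => x.2 - x.1 := Primrec.nat_sub.comp Primrec.snd Primrec.fst
    exact Primrec.ite (Primrec.nat_le.comp Primrec.snd Primrec.fst)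
      (Primrec.nat_mul.comp (Primrec.const 2) h1)
      (Primrec.succ.comp (Primrec.nat_mul.comp (Primrec.const 2)
        (Primrec.nat_sub.comp h2 (Primrec.const 1))))
  · obtain ⟨a, b⟩ := x
    dsimp only
    split_ifs with h
    · rw [← Nat.cast_sub h, encode_natCast_int]
    · have : (a : ℤ) - b = Int.negSucc (b - a - 1) := by
        rw [Int.negSucc_eq]; omega
      rw [this, encode_negSucc_int]

theorem primrec_int_add : Primrec₂ fun a b : ℤ => a + b := by
  refine Primrec.of_eq (primrec_natSub.comp
    (Primrec.nat_add.comp (primrec_toNat.comp Primrec.fst) (primrec_toNat.comp Primrec.snd))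
    (Primrec.nat_add.comp (primrec_toNat_neg.comp Primrec.fst)
      (primrec_toNat_neg.comp Primrec.snd))) fun x => ?_
  push_cast
  omega

theorem primrec_int_neg : Primrec fun a : ℤ => -a :=
  Primrec.of_eq (primrec_natSub.comp primrec_toNat_neg primrec_toNat) fun _ => by omega

theorem primrec_natAbs : Primrec Int.natAbs :=
  Primrec.of_eq (Primrec.nat_add.comp primrec_toNat primrec_toNat_neg) fun x => by omega

theorem primrec_natCast_mul : Primrec₂ fun (n : ℕ) (a : ℤ) => (n : ℤ) * a := by
  refine Primrec.of_eq (primrec_natSub.comp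
    (Primrec.nat_mul.comp Primrec.fst (primrec_toNat.comp Primrec.snd))
    (Primrec.nat_mul.comp Primrec.fst (primrec_toNat_neg.comp Primrec.snd))) fun x => ?_
  have : x.2 = (x.2.toNat : ℤ) - ((-x.2).toNat : ℤ) := by omega
  conv_rhs => rw [this]
  push_cast
  ring

instance : Primcodable (Multiplicative ℤ) := Primcodable.ofEquiv ℤ toAdd

theorem primrec_toAdd : Primrec (toAdd : Multiplicative ℤ → ℤ) :=
  Primrec.of_equiv (e := toAdd)

theorem primrec_ofAdd : Primrec (ofAdd : ℤ → Multiplicative ℤ) :=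
  Primrec.of_equiv_symm (e := toAdd)

end Integers

/-- A structure for the language of groups with computable operations. -/
class ComputableStructure (D : Type) [Primcodable D] [grp.Structure D] : Prop where
  computable_inv : Computable (sInv : D → D)
  computable_mul : Computable₂ (sMul : D → D → D)

section Groups

variable (D D' : Type) [Primcodable D] [Primcodable D'] [Group D] [Group D']

theorem computable_inv [ComputableStructure D] : Computable fun x : D => x⁻¹ :=
  ComputableStructure.computable_inv

theorem computable_mul [ComputableStructure D] : Computable₂ fun x y : D => x * y :=
  ComputableStructure.computable_mul

theorem computable_div [ComputableStructure D] : Computable₂ fun x y : D => x / y :=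
  Computable.of_eq ((computable_mul D).comp Computable.fst
    ((computable_inv D).comp Computable.snd)) fun _ => (div_eq_mul_inv _ _).symm

instance : ComputableStructure (Multiplicative ℤ) where
  computable_inv := (primrec_ofAdd.comp (primrec_int_neg.comp primrec_toAdd)).to_comp
  computable_mul := (primrec_ofAdd.comp (primrec_int_add.comp (primrec_toAdd.comp Primrec.fst)
    (primrec_toAdd.comp Primrec.snd))).to_comp

instance [ComputableStructure D] [ComputableStructure D'] : ComputableStructure (D × D') where
  computable_inv := ((computable_inv D).comp Computable.fst).pair
    ((computable_inv D').comp Computable.snd)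
  computable_mul := ((computable_mul D).comp (Computable.fst.comp Computable.fst)
    (Computable.fst.comp Computable.snd)).pair ((computable_mul D').comp
      (Computable.snd.comp Computable.fst) (Computable.snd.comp Computable.snd))

theorem primrec_finArrow_apply {α : Type} [Primcodable α] {n : ℕ} (i : Fin n) :
    Primrec fun a : Fin n → α => a i :=
  Primrec.fin_app.comp Primrec.id (Primrec.const i)

theorem computable_finArrow {α β : Type} [Primcodable α] [Primcodable β] {n : ℕ}
    {f : α → Fin n → β} (hf : ∀ i, Computable fun a => f a i) : Computable f := by
  have h1 : Computable fun a => List.Vector.ofFn (f a) := Computable.vector_ofFn hf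
  have h2 : Primrec fun (w : List.Vector β n) (i : Fin n) => w.get i :=
    Primrec.fin_curry.2 Primrec.vector_get
  exact (h2.to_comp.comp h1).of_eq fun a => by funext i; simp

instance (m : ℕ) : ComputableStructure (Zpow m) where
  computable_inv := computable_finArrow fun i =>
    (computable_inv (Multiplicative ℤ)).comp (primrec_finArrow_apply i).to_comp
  computable_mul := computable_finArrow fun i => (computable_mul (Multiplicative ℤ)).comp
    ((primrec_finArrow_apply i).to_comp.comp Computable.fst)
    ((primrec_finArrow_apply i).to_comp.comp Computable.snd)

theorem computableStructure_of_finite [Finite D] : ComputableStructure D where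
  computable_inv := (Primrec.dom_finite _).to_comp
  computable_mul := (Primrec.dom_finite fun x : D × D => sMul x.1 x.2).to_comp

end Groups

/-! ### Evaluation of terms from their Goedel numbers -/

section Evaluation

theorem unpair_snd_lt {c : ℕ} (h : c.unpair.1 ≠ 0) : c.unpair.2 < c := by
  have := Nat.add_le_pair c.unpair.1 c.unpair.2
  rw [Nat.pair_unpair] at this
  omega

variable {D : Type} [grp.Structure D]

/-- The value of the term with Goedel number `c` if the variable `xᵢ` has the value `v i`. There is
no value if `c` is not the Goedel number of a term or if `v` is not defined at some variable. -/
def evalCode (v : ℕ → Option D) (c : ℕ) : Option D :=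
  if c.unpair.1 = 0 then v c.unpair.2
  else if c.unpair.1 = 1 then (if c.unpair.2 = 0 then some (sOne D) else none)
  else if h : c.unpair.1 = 2 then
    have : c.unpair.2 < c := unpair_snd_lt (by omega)
    (evalCode v c.unpair.2).map sInv
  else if h : c.unpair.1 = 3 then
    have : c.unpair.2.unpair.1 < c :=
      (Nat.unpair_left_le _).trans_lt (unpair_snd_lt (by omega))
    have : c.unpair.2.unpair.2 < c :=
      (Nat.unpair_right_le _).trans_lt (unpair_snd_lt (by omega))
    (evalCode v c.unpair.2.unpair.1).bind fun x => (evalCode v c.unpair.2.unpair.2).map (sMul x)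
  else none
termination_by c

theorem evalCode_termCode {v : ℕ → Option D} {a : ℕ → D} (s : grp.Term ℕ)
    (h : ∀ i ∈ s.varFinset, v i = some (a i)) : evalCode v (termCode s) = some (s.realize a) := by
  induction s using term_induction with
  | hvar i => rw [evalCode]; simpa using h i
  | hone => rw [evalCode]; simp
  | hinv s ih => rw [evalCode]; simp [ih (by simpa using h)]
  | hmul s t ih₁ ih₂ =>
    simp only [varFinset_tMul, Finset.mem_union] at h
    rw [evalCode]
    simp [ih₁ fun i hi => h i (.inl hi), ih₂ fun i hi => h i (.inr hi)]

theorem exists_termCode_of_evalCode {v : ℕ → Option D} (c : ℕ) :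
    (evalCode v c).isSome → ∃ s : grp.Term ℕ, termCode s = c ∧
      ∀ i ∈ s.varFinset, (v i).isSome := by
  induction c using Nat.strong_induction_on with
  | _ c ih =>
    intro h
    rw [evalCode] at h
    split_ifs at h with h0 h1 h1' h2 h3
    · exact ⟨.var c.unpair.2, by rw [termCode_var, ← h0, Nat.pair_unpair], by simpa using h⟩
    · exact ⟨tOne, by rw [termCode_tOne, ← h1, ← h1', Nat.pair_unpair], by simp⟩
    · simp at h
    · obtain ⟨s, hs, hv⟩ := ih _ (unpair_snd_lt h0) (by simpa using h)
      exact ⟨tInv s, by rw [termCode_tInv, hs, ← h2, Nat.pair_unpair], by simpa using hv⟩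
    · have hl := unpair_snd_lt h0
      rw [Option.isSome_bind] at h
      cases h4 : evalCode v c.unpair.2.unpair.1 with
      | none => simp [h4] at h
      | some x =>
        obtain ⟨s, hs, hsv⟩ := ih _ ((Nat.unpair_left_le _).trans_lt hl) (by simp [h4])
        obtain ⟨t, ht, htv⟩ := ih _ ((Nat.unpair_right_le _).trans_lt hl)
          (by simpa [h4] using h)
        refine ⟨tMul s t, ?_, fun i hi => ?_⟩
        · rw [termCode_tMul, hs, ht, Nat.pair_unpair, ← h3, Nat.pair_unpair]
        · simp only [varFinset_tMul, Finset.mem_union] at hi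
          exact hi.elim (hsv i) (htv i)
    · simp at h

/-- `restrict X a` is the assignment `a`, restricted to the variables in `X`. -/
def restrict (X : ℕ → Prop) [DecidablePred X] (a : ℕ → D) (i : ℕ) : Option D :=
  if X i then some (a i) else none

theorem evalCode_eq_some_iff {X : ℕ → Prop} [DecidablePred X] {a : ℕ → D} {c : ℕ} {d : D} :
    evalCode (restrict X a) c = some d ↔
      ∃ s : grp.Term ℕ, termCode s = c ∧ ↑s.varFinset ⊆ {i | X i} ∧ s.realize a = d := by
  constructor
  · intro h
    obtain ⟨s, hs, hv⟩ := exists_termCode_of_evalCode (v := restrict X a) c (by simp [h])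
    have hX : ∀ i ∈ s.varFinset, X i := fun i hi => by
      have := hv i hi
      by_contra hn
      simp [restrict, hn] at this
    refine ⟨s, hs, fun i hi => hX i hi, ?_⟩
    have := evalCode_termCode (v := restrict X a) (a := a) s
      fun i hi => by simp [restrict, hX i hi]
    rw [hs, h] at this
    exact (Option.some.inj this).symm
  · rintro ⟨s, rfl, hX, rfl⟩
    refine evalCode_termCode s fun i hi => ?_
    have : X i := hX hi
    simp [restrict, this]

variable {α : Type} [Primcodable α] [Primcodable D] [ComputableStructure D]

theorem computable_evalCode {v : α → ℕ → Option D} (hv : Computable₂ v) :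
    Computable₂ fun a c => evalCode (v a) c := by
  let g : α → List (Option D) → Option D := fun a l =>
    if l.length.unpair.1 = 0 then v a l.length.unpair.2
    else if l.length.unpair.1 = 1 then
      (if l.length.unpair.2 = 0 then some (sOne D) else none)
    else if l.length.unpair.1 = 2 then (l[l.length.unpair.2]?.getD none).map sInv
    else if l.length.unpair.1 = 3 then
      (l[l.length.unpair.2.unpair.1]?.getD none).bind fun x =>
        (l[l.length.unpair.2.unpair.2]?.getD none).map (sMul x)
    else none
  have hl : Computable fun x : α × List (Option D) => x.2.length.unpair :=
    Computable.unpair.comp (Computable.list_length.comp Computable.snd)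
  have hl1 : Computable fun x : α × List (Option D) => x.2.length.unpair.1 := Computable.fst.comp hl
  have hl2 : Computable fun x : α × List (Option D) => x.2.length.unpair.2 := Computable.snd.comp hl
  have hl22 := Computable.unpair.comp hl2
  have hget : ∀ {f : α × List (Option D) → ℕ}, Computable f →
      Computable fun x : α × List (Option D) => x.2[f x]?.getD none := fun hf =>
    Computable.option_getD (Computable.list_getElem?.comp Computable.snd hf) (Computable.const _)
  have hg : Computable₂ g := by
    refine computable_ite (computablePred_eq hl1 (Computable.const 0))
      (hv.comp Computable.fst hl2) ?_
    refine computable_ite (computablePred_eq hl1 (Computable.const 1))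
      (computable_ite (computablePred_eq hl2 (Computable.const 0)) (Computable.const _)
        (Computable.const _)) ?_
    refine computable_ite (computablePred_eq hl1 (Computable.const 2))
      (Computable.option_map (hget hl2)
        (ComputableStructure.computable_inv.comp Computable.snd)) ?_
    refine computable_ite (computablePred_eq hl1 (Computable.const 3)) ?_ (Computable.const _)
    refine Computable.option_bind (hget (Computable.fst.comp hl22)) ?_
    exact Computable.option_map ((hget (Computable.snd.comp hl22)).comp Computable.fst)
      (ComputableStructure.computable_mul.comp (Computable.snd.comp Computable.fst) Computable.snd)
  refine Computable.nat_strong_rec (fun a c => evalCode (v a) c)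
    (g := fun a l => some (g a l)) (Computable.option_some.comp hg) fun a n => ?_
  have hlen : ((List.range n).map fun c => evalCode (v a) c).length = n := by simp
  have hnth : ∀ i < n, ((List.range n).map fun c => evalCode (v a) c)[i]?.getD none =
      evalCode (v a) i := fun i hi => by simp [hi]
  simp only [g, hlen]
  rw [evalCode]
  congr 1
  split_ifs with h0 h1 h1' h2 h3
  · rfl
  · rfl
  · rfl
  · rw [hnth _ (unpair_snd_lt h0)]
  · rw [hnth _ ((Nat.unpair_left_le _).trans_lt (unpair_snd_lt h0)),
      hnth _ ((Nat.unpair_right_le _).trans_lt (unpair_snd_lt h0))]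
  · rfl

/-- A computable relation between the values of two terms is a computable relation between their
Goedel numbers. -/
theorem computablePred_realize {a : α → ℕ → D} (ha : Computable₂ a) {X : α → ℕ → Prop}
    (hX : ComputablePred fun x : α × ℕ => X x.1 x.2) {R : α → D → D → Prop}
    (hR : ComputablePred fun x : α × D × D => R x.1 x.2.1 x.2.2) :
    ComputablePred fun x : α × ℕ => ∃ s t : grp.Term ℕ,
      x.2 = Nat.pair (termCode s) (termCode t) ∧ ↑s.varFinset ⊆ {i | X x.1 i} ∧
      ↑t.varFinset ⊆ {i | X x.1 i} ∧ R x.1 (s.realize (a x.1)) (t.realize (a x.1)) := by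
  classical
  have hv : Computable₂ fun (x : α) i => restrict (X x) (a x) i :=
    computable_ite hX (Computable.option_some.comp ha) (Computable.const _)
  have he := computable_evalCode hv
  have hu : Computable fun x : α × ℕ => x.2.unpair := Computable.unpair.comp Computable.snd
  have he1 : Computable fun x : α × ℕ => evalCode (restrict (X x.1) (a x.1)) x.2.unpair.1 :=
    he.comp Computable.fst (Computable.fst.comp hu)
  have he2 : Computable fun x : α × ℕ => evalCode (restrict (X x.1) (a x.1)) x.2.unpair.2 :=
    he.comp Computable.fst (Computable.snd.comp hu)
  have hRd : Computable fun x : α × D × D => decide (R x.1 x.2.1 x.2.2) := hR.decide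
  have hp : Computable fun x : ((α × ℕ) × D) × D => (x.1.1.1, x.1.2, x.2) :=
    (Computable.fst.comp (Computable.fst.comp Computable.fst)).pair
        ((Computable.snd.comp Computable.fst).pair Computable.snd)
  have hR' : Computable fun x : ((α × ℕ) × D) × D => decide (R x.1.1.1 x.1.2 x.2) :=
    (hRd.comp hp).of_eq fun _ => rfl
  have hR'' : Computable fun x : (α × ℕ) × D =>
      (evalCode (restrict (X x.1.1) (a x.1.1)) x.1.2.unpair.2).map
        fun d' => decide (R x.1.1 x.2 d') :=
    Computable.option_map
      (f := fun x : (α × ℕ) × D => evalCode (restrict (X x.1.1) (a x.1.1)) x.1.2.unpair.2)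
      (he2.comp Computable.fst) hR'.to₂
  have hc := Computable.option_bind he1 hR''.to₂
  have h1 := computablePred_eq hc (Computable.const (some true))
  refine h1.of_eq fun x => ?_
  · simp only [Option.bind_eq_some_iff, Option.map_eq_some_iff, decide_eq_true_eq,
      evalCode_eq_some_iff]
    constructor
    · rintro ⟨_, ⟨s, hs, hsX, rfl⟩, _, ⟨t, ht, htX, rfl⟩, h⟩
      exact ⟨s, t, by rw [hs, ht, Nat.pair_unpair], hsX, htX, h⟩
    · rintro ⟨s, t, hx, hsX, htX, h⟩
      rw [hx]
      exact ⟨_, ⟨s, by simp, hsX, rfl⟩, _, ⟨t, by simp, htX, rfl⟩, h⟩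

end Evaluation

/-! ### The Scott sentence -/

section Formulas

/-- The code of the index triple of a formula with quantifiers over `xs` and with matrix of level
`m` and index `j`. -/
def quantCode (m : ℕ) (xs : List ℕ) (j : ℕ) : ℕ :=
  Nat.pair m (Nat.pair (Encodable.encode xs) j)

/-- The quantifier-free formula whose Goedel number is the last component of an index triple. -/
noncomputable def matrixOf (i : ℕ) : QFFormula :=
  have : Nonempty QFFormula := ⟨.eq tOne tOne⟩
  Function.invFun QFFormula.code i.unpair.2.unpair.2

theorem matrixOf_quantCode (m : ℕ) (xs : List ℕ) (θ : QFFormula) :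
    matrixOf (quantCode m xs θ.code) = θ := by
  have : Nonempty QFFormula := ⟨θ⟩
  simpa [matrixOf, quantCode] using Function.leftInverse_invFun QFFormula.code_injective θ

/-- The formula `⋀_{θ ∈ S} (∀ xs) θ`. -/
noncomputable def piOne (xs : List ℕ) (S : Set QFFormula) : InfFormula :=
  .conjAll ((fun θ => quantCode 0 xs θ.code) '' S) (fun _ => xs) fun i => .qf (matrixOf i)

/-- The formula `⋁_{θ ∈ S} (∃ xs) θ`. -/
noncomputable def sigmaOne (xs : List ℕ) (S : Set QFFormula) : InfFormula :=
  .disjEx ((fun θ => quantCode 0 xs θ.code) '' S) (fun _ => xs) fun i => .qf (matrixOf i)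

/-- The formula `(∃ xs) ψ`, where `e` is an index of `ψ` as a computable `Π₁` formula. -/
def sigmaTwo (xs : List ℕ) (e : ℕ) (ψ : InfFormula) : InfFormula :=
  .disjEx {quantCode 1 xs e} (fun _ => xs) fun _ => ψ

/-- The formula `(∀ xs) ψ ∧ ⋀_{θ ∈ S} (∀ ys) θ`, where `e` is an index of `ψ` as a computable `Σ₁`
formula. The level in the index triple separates `ψ` from the formulas in `S`. -/
noncomputable def piTwo (xs : List ℕ) (e : ℕ) (ψ : InfFormula) (ys : List ℕ) (S : Set QFFormula) :
    InfFormula :=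
  .conjAll (insert (quantCode 1 xs e) ((fun θ => quantCode 0 ys θ.code) '' S))
    (fun i => if i.unpair.1 = 1 then xs else ys)
    fun i => if i.unpair.1 = 1 then ψ else .qf (matrixOf i)

theorem rePred_image {S : Set ℕ} (hS : REPred fun n => n ∈ S) {f : ℕ → ℕ} (hf : Computable f) :
    REPred fun n => n ∈ f '' S := by
  refine (rePred_exists (p := fun x : ℕ × ℕ => x.2 ∈ S ∧ f x.2 = x.1) (rePred_and
    (rePred_comp hS Computable.snd) ?_)).of_eq fun n => by simp
  exact (computablePred_eq (hf.comp Computable.snd) Computable.fst).to_re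

theorem rePred_image_quantCode {S : Set QFFormula} (hS : REPred fun n => n ∈ QFFormula.code '' S)
    (m : ℕ) (xs : List ℕ) : REPred fun n => n ∈ (fun θ => quantCode m xs θ.code) '' S := by
  have h : Computable fun c => quantCode m xs c :=
    (Primrec₂.natPair.comp (Primrec.const m) (Primrec₂.natPair.comp (Primrec.const _)
      Primrec.id)).to_comp
  refine (rePred_image hS h).of_eq fun n => ?_
  rw [Set.image_image]

theorem isComputable_piOne {S : Set QFFormula} (hS : REPred fun n => n ∈ QFFormula.code '' S)
    (xs : List ℕ) : ∃ e, (piOne xs S).IsIndex .pi 1 e := by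
  obtain ⟨e, he⟩ := exists_W_eq (rePred_image_quantCode hS 0 xs)
  refine ⟨e, rfl, one_pos, he.symm, ?_⟩
  rintro _ ⟨θ, -, rfl⟩
  exact ⟨0, one_pos, θ.code, rfl, rfl, by rw [matrixOf_quantCode]⟩

theorem isComputable_sigmaOne {S : Set QFFormula} (hS : REPred fun n => n ∈ QFFormula.code '' S)
    (xs : List ℕ) : ∃ e, (sigmaOne xs S).IsIndex .sigma 1 e := by
  obtain ⟨e, he⟩ := exists_W_eq (rePred_image_quantCode hS 0 xs)
  refine ⟨e, rfl, one_pos, he.symm, ?_⟩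
  rintro _ ⟨θ, -, rfl⟩
  exact ⟨0, one_pos, θ.code, rfl, rfl, by rw [matrixOf_quantCode]⟩

theorem isComputable_sigmaTwo {ψ : InfFormula} {j : ℕ} (hψ : ψ.IsIndex .pi 1 j) (xs : List ℕ) :
    (sigmaTwo xs j ψ).IsComputableSigma 2 := by
  obtain ⟨e, he⟩ := exists_W_eq (S := {quantCode 1 xs j})
    (computablePred_eq Computable.id (Computable.const _)).to_re
  refine ⟨e, rfl, two_pos, he.symm, ?_⟩
  rintro _ rfl
  exact ⟨1, one_lt_two, j, rfl, hψ⟩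

theorem isComputable_piTwo {ψ : InfFormula} {j : ℕ} (hψ : ψ.IsIndex .sigma 1 j) (xs ys : List ℕ)
    {S : Set QFFormula} (hS : REPred fun n => n ∈ QFFormula.code '' S) :
    (piTwo xs j ψ ys S).IsComputablePi 2 := by
  obtain ⟨e, he⟩ := exists_W_eq
    (S := insert (quantCode 1 xs j) ((fun θ => quantCode 0 ys θ.code) '' S))
    (rePred_or (computablePred_eq Computable.id (Computable.const _)).to_re
      (rePred_image_quantCode hS 0 ys))
  refine ⟨e, rfl, two_pos, he.symm, ?_⟩
  rintro _ (rfl | ⟨θ, -, rfl⟩)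
  · exact ⟨1, one_lt_two, j, by simp [quantCode], by simpa [quantCode] using hψ⟩
  · refine ⟨0, two_pos, θ.code, by simp [quantCode], ?_⟩
    beta_reduce
    rw [matrixOf_quantCode]
    simp [quantCode, InfFormula.IsIndex]

variable {M : Type u} [grp.Structure M] {a : ℕ → M}

theorem realize_piOne {xs : List ℕ} {S : Set QFFormula} :
    (piOne xs S).Realize a ↔ ∀ θ ∈ S, ∀ b : ℕ → M, (∀ i, i ∉ xs → b i = a i) → θ.Realize b := by
  simp [piOne, InfFormula.Realize, matrixOf_quantCode]

theorem realize_sigmaOne_nil {S : Set QFFormula} :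
    (sigmaOne [] S).Realize a ↔ ∃ θ ∈ S, θ.Realize a := by
  simp only [sigmaOne, InfFormula.Realize, Set.exists_mem_image, matrixOf_quantCode]
  refine exists_congr fun θ => and_congr_right fun _ => ⟨?_, fun h => ⟨a, fun _ _ => rfl, h⟩⟩
  rintro ⟨b, hb, h⟩
  rwa [show a = b from funext fun i => (hb i (by simp)).symm]

theorem realize_sigmaTwo {xs : List ℕ} {e : ℕ} {ψ : InfFormula} :
    (sigmaTwo xs e ψ).Realize a ↔ ∃ b : ℕ → M, (∀ i, i ∉ xs → b i = a i) ∧ ψ.Realize b := by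
  simp [sigmaTwo, InfFormula.Realize]

theorem realize_piTwo {xs ys : List ℕ} {e : ℕ} {ψ : InfFormula} {S : Set QFFormula} :
    (piTwo xs e ψ ys S).Realize a ↔
      (∀ b : ℕ → M, (∀ i, i ∉ xs → b i = a i) → ψ.Realize b) ∧
      ∀ θ ∈ S, ∀ b : ℕ → M, (∀ i, i ∉ ys → b i = a i) → θ.Realize b := by
  simp only [piTwo, InfFormula.Realize, Set.forall_mem_insert, Set.forall_mem_image,
    matrixOf_quantCode]
  simp [quantCode, InfFormula.Realize]

theorem freeVars_piOne {xs : List ℕ} {S : Set QFFormula} {x : ℕ} :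
    x ∈ (piOne xs S).freeVars ↔ ∃ θ ∈ S, x ∈ θ.vars ∧ x ∉ xs := by
  simp [piOne, InfFormula.freeVars, matrixOf_quantCode]

theorem freeVars_sigmaOne {xs : List ℕ} {S : Set QFFormula} {x : ℕ} :
    x ∈ (sigmaOne xs S).freeVars ↔ ∃ θ ∈ S, x ∈ θ.vars ∧ x ∉ xs := by
  simp [sigmaOne, InfFormula.freeVars, matrixOf_quantCode]

theorem isSentence_sigmaTwo {xs : List ℕ} {e : ℕ} {ψ : InfFormula}
    (h : ∀ x ∈ ψ.freeVars, x ∈ xs) : (sigmaTwo xs e ψ).IsSentence := by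
  refine Set.eq_empty_of_forall_notMem ?_
  rintro x ⟨_, rfl, h1, h2⟩
  exact h2 (h x h1)

theorem isSentence_piTwo {xs ys : List ℕ} {e : ℕ} {ψ : InfFormula} {S : Set QFFormula}
    (h : ∀ x ∈ ψ.freeVars, x ∈ xs) (hS : ∀ θ ∈ S, ∀ x ∈ θ.vars, x ∈ ys) :
    (piTwo xs e ψ ys S).IsSentence := by
  refine Set.eq_empty_of_forall_notMem ?_
  rintro x ⟨_, (rfl | ⟨θ, hθ, rfl⟩), h1, h2⟩
  · simp only [quantCode, Nat.unpair_pair, if_true] at h1 h2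
    exact h2 (h x h1)
  · beta_reduce at h1 h2
    rw [matrixOf_quantCode] at h1
    simp only [quantCode, Nat.unpair_pair, zero_ne_one, if_false] at h1 h2
    exact h2 (hS θ hθ x h1)

theorem InfFormula.realize_conj {φ ψ : InfFormula} :
    (conj φ ψ).Realize a ↔ φ.Realize a ∧ ψ.Realize a := by
  have hφ : ∀ b : ℕ → M, (∀ x, x ∉ ([] : List ℕ) → b x = a x) ↔ b = a := fun b => by
    simp [funext_iff]
  simp [conj, InfFormula.Realize, ← funext_iff]

theorem InfFormula.IsSentence.conj {φ ψ : InfFormula} (hφ : φ.IsSentence) (hψ : ψ.IsSentence) :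
    (InfFormula.conj φ ψ).IsSentence := by
  refine Set.eq_empty_of_forall_notMem ?_
  rintro x ⟨_, (rfl | rfl), h1, -⟩
  · simp only [if_true] at h1
    rw [hφ] at h1; exact h1
  · simp only [one_ne_zero, if_false] at h1
    rw [hψ] at h1; exact h1

end Formulas

section ScottSentence

variable (r : ℕ) {N : ℕ} {T : Type} [CommGroup T] (τ : Fin N ≃ T)

/-- The formula `⋁_{j < n} x_{r+N} = x_{r+j}`: for `n = N`, the last variable is one of the
variables that stand for the elements of the torsion subgroup. -/
def torsionDisj (N : ℕ) : ℕ → QFFormula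
  | 0 => .ne tOne tOne
  | n + 1 => .or (.eq (.var (r + N)) (.var (r + n))) (torsionDisj N n)

/-- The matrices of the `Σ₂` part of the Scott sentence. -/
def sigmaSet : Set QFFormula :=
  {θ | (∃ s t : grp.Term ℕ, ↑s.varFinset ⊆ Set.Iio (r + N) ∧ ↑t.varFinset ⊆ Set.Iio (r + N) ∧
      s.realize (gen r τ) = t.realize (gen r τ) ∧ θ = .eq s t) ∨
    (∃ s t : grp.Term ℕ, ↑s.varFinset ⊆ Set.Iio (r + N) ∧ ↑t.varFinset ⊆ Set.Iio (r + N) ∧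
      s.realize (gen r τ) ≠ t.realize (gen r τ) ∧ θ = .ne s t) ∨
    (∃ s t : grp.Term ℕ, ↑s.varFinset ⊆ Set.Iio (r + N + 1) ∧
      ↑t.varFinset ⊆ Set.Iio (r + N + 1) ∧
      ForcesTorsion r (s.realize (expAssign r (r + N)) / t.realize (expAssign r (r + N))) ∧
      θ = .or (.ne s t) (torsionDisj r N N))}

/-- The matrices of the disjunction which says that `x₀, …, x_r` are dependent. -/
def rankSet : Set QFFormula :=
  {θ | ∃ s t : grp.Term ℕ, ↑s.varFinset ⊆ Set.Iio (r + 1) ∧ ↑t.varFinset ⊆ Set.Iio (r + 1) ∧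
    s.realize (bas (r + 1)) ≠ t.realize (bas (r + 1)) ∧ θ = .eq s t}

/-- The axioms of abelian groups as quantifier-free formulas. -/
def axiomSet : Set QFFormula :=
  {.eq (tMul (tMul (.var 0) (.var 1)) (.var 2)) (tMul (.var 0) (tMul (.var 1) (.var 2))),
    .eq (tMul tOne (.var 0)) (.var 0), .eq (tMul (tInv (.var 0)) (.var 0)) tOne,
    .eq (tMul (.var 0) (.var 1)) (tMul (.var 1) (.var 0))}

variable {r τ}

theorem vars_torsionDisj (n : ℕ) (hn : n ≤ N) :
    ∀ x ∈ (torsionDisj r N n).vars, x < r + N + 1 := by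
  induction n with
  | zero => simp [torsionDisj, QFFormula.vars]
  | succ n ih =>
    intro x hx
    simp only [torsionDisj, QFFormula.vars, varFinset_var, Finset.mem_union,
      Finset.mem_singleton] at hx
    rcases hx with (h | h) | h
    · omega
    · omega
    · exact ih (by omega) x h

theorem vars_sigmaSet {θ : QFFormula} (hθ : θ ∈ sigmaSet r τ) : ∀ x ∈ θ.vars, x < r + N + 1 := by
  rcases hθ with ⟨s, t, hs, ht, -, rfl⟩ | ⟨s, t, hs, ht, -, rfl⟩ | ⟨s, t, hs, ht, -, rfl⟩ <;>
    intro x hx <;> simp only [QFFormula.vars, Finset.mem_union] at hx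
  · exact Nat.lt_succ_of_lt (hx.elim (fun h => hs h) fun h => ht h)
  · exact Nat.lt_succ_of_lt (hx.elim (fun h => hs h) fun h => ht h)
  · exact hx.elim (fun h => h.elim (fun h => hs h) fun h => ht h) (vars_torsionDisj N le_rfl x)

theorem vars_rankSet {θ : QFFormula} (hθ : θ ∈ rankSet r) : ∀ x ∈ θ.vars, x < r + 1 := by
  obtain ⟨s, t, hs, ht, -, rfl⟩ := hθ
  intro x hx
  simp only [QFFormula.vars, Finset.mem_union] at hx
  exact hx.elim (fun h => hs h) fun h => ht h

variable {M : Type u} [grp.Structure M]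

theorem realize_torsionDisj {n : ℕ} (hn : n ≤ N) {x : ℕ → M} {y : M} :
    (torsionDisj r N n).Realize (Function.update x (r + N) y) ↔ ∃ j < n, y = x (r + j) := by
  induction n with
  | zero => simp [torsionDisj, QFFormula.Realize]
  | succ n ih =>
    have h1 : (torsionDisj r N (n + 1)).Realize (Function.update x (r + N) y) ↔
        y = x (r + n) ∨ (torsionDisj r N n).Realize (Function.update x (r + N) y) := by
      refine or_congr ?_ Iff.rfl
      simp only [QFFormula.Realize, Term.realize]
      rw [Function.update_self, Function.update_of_ne (by omega)]
    rw [h1, ih (by omega)]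
    constructor
    · rintro (h | ⟨j, hj, h⟩)
      · exact ⟨n, by omega, h⟩
      · exact ⟨j, by omega, h⟩
    · rintro ⟨j, hj, h⟩
      rcases Nat.lt_succ_iff_lt_or_eq.1 hj with hj | rfl
      · exact .inr ⟨j, hj, h⟩
      · exact .inl h

theorem realize_update_of_vars {s : grp.Term ℕ} {k : ℕ} (hs : ↑s.varFinset ⊆ Set.Iio k)
    (x : ℕ → M) (y : M) : s.realize (Function.update x k y) = s.realize x :=
  ScottGroup.realize_congr fun _ hi => Function.update_of_ne (hs hi).ne _ _

theorem sigmaCond_iff : SigmaCond r τ M ↔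
    ∃ x : ℕ → M, ∀ θ ∈ sigmaSet r τ, ∀ y, θ.Realize (Function.update x (r + N) y) := by
  refine exists_congr fun x => ⟨?_, fun h => ⟨fun s t hs ht => ?_, fun y s t hs ht hF h1 => ?_⟩⟩
  · rintro ⟨h1, h2⟩ θ (⟨s, t, hs, ht, h, rfl⟩ | ⟨s, t, hs, ht, h, rfl⟩ | ⟨s, t, hs, ht, h, rfl⟩) y
    · simp only [QFFormula.Realize]
      rwa [realize_update_of_vars hs, realize_update_of_vars ht, h1 s t hs ht]
    · simp only [QFFormula.Realize]
      rwa [realize_update_of_vars hs, realize_update_of_vars ht, ne_eq, h1 s t hs ht]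
    · by_cases h3 : s.realize (Function.update x (r + N) y) =
          t.realize (Function.update x (r + N) y)
      · exact .inr ((realize_torsionDisj le_rfl).2 (h2 y s t hs ht h h3))
      · exact .inl h3
  · by_cases h1 : s.realize (gen r τ) = t.realize (gen r τ)
    · have := h _ (.inl ⟨s, t, hs, ht, h1, rfl⟩) (x 0)
      simp only [QFFormula.Realize] at this
      rw [realize_update_of_vars hs, realize_update_of_vars ht] at this
      exact iff_of_true this h1
    · have := h _ (.inr (.inl ⟨s, t, hs, ht, h1, rfl⟩)) (x 0)
      simp only [QFFormula.Realize] at this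
      rw [realize_update_of_vars hs, realize_update_of_vars ht] at this
      exact iff_of_false this h1
  · have := h _ (.inr (.inr ⟨s, t, hs, ht, hF, rfl⟩)) y
    exact (realize_torsionDisj le_rfl).1 (this.resolve_left fun h2 => h2 h1)

theorem rankCond_iff : RankCond r M ↔ ∀ z : ℕ → M, ∃ θ ∈ rankSet r, θ.Realize z := by
  refine forall_congr' fun z => ⟨?_, ?_⟩
  · rintro ⟨s, t, hs, ht, h, h'⟩
    exact ⟨_, ⟨s, t, hs, ht, h, rfl⟩, h'⟩
  · rintro ⟨_, ⟨s, t, hs, ht, h, rfl⟩, h'⟩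
    exact ⟨s, t, hs, ht, h, h'⟩

theorem abelianAxioms_iff : AbelianAxioms M ↔ ∀ θ ∈ axiomSet, ∀ z : ℕ → M, θ.Realize z := by
  simp only [axiomSet, Set.mem_insert_iff, Set.mem_singleton_iff, forall_eq_or_imp, forall_eq,
    QFFormula.Realize, realize_tMul, realize_tOne, realize_tInv, Term.realize]
  constructor
  · exact fun h => ⟨fun z => (h (z 0) (z 1) (z 2)).1, fun z => (h (z 0) (z 0) (z 0)).2.1,
      fun z => (h (z 0) (z 0) (z 0)).2.2.1, fun z => (h (z 0) (z 1) (z 1)).2.2.2⟩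
  · rintro ⟨h1, h2, h3, h4⟩ x y z
    exact ⟨h1 fun i => if i = 0 then x else if i = 1 then y else z, h2 fun _ => x, h3 fun _ => x,
      h4 fun i => if i = 0 then x else y⟩

/-- The pairs of Goedel numbers of terms in the variables `x₀, …, x_{k-1}` whose values satisfy a
computable condition. -/
theorem computablePred_termPair {D : Type} [grp.Structure D] [Primcodable D]
    [ComputableStructure D] {a : ℕ → D} (ha : Computable a) (k : ℕ) {R : D → D → Prop}
    (hR : ComputablePred fun x : D × D => R x.1 x.2) :
    ComputablePred fun n : ℕ => ∃ s t : grp.Term ℕ, n = Nat.pair (termCode s) (termCode t) ∧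
      ↑s.varFinset ⊆ Set.Iio k ∧ ↑t.varFinset ⊆ Set.Iio k ∧ R (s.realize a) (t.realize a) := by
  have h := computablePred_realize (α := Unit) (a := fun _ => a) (X := fun _ i => i < k)
    (R := fun _ => R) (ha.comp Computable.snd)
    (computablePred_lt Computable.snd (Computable.const k))
    (computablePred_comp hR Computable.snd)
  exact computablePred_comp h ((Computable.const ()).pair Computable.id)

/-- A computable set of quantifier-free formulas, given by a computable condition on the values of
two terms. -/
theorem rePred_code {D : Type} [grp.Structure D] [Primcodable D] [ComputableStructure D]
    {a : ℕ → D} (ha : Computable a) (k : ℕ) {R : D → D → Prop}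
    (hR : ComputablePred fun x : D × D => R x.1 x.2) {F : grp.Term ℕ → grp.Term ℕ → QFFormula}
    {f : ℕ → ℕ} (hf : Computable f)
    (hF : ∀ s t, (F s t).code = f (Nat.pair (termCode s) (termCode t))) :
    REPred fun n => n ∈ QFFormula.code '' {θ | ∃ s t : grp.Term ℕ, ↑s.varFinset ⊆ Set.Iio k ∧
      ↑t.varFinset ⊆ Set.Iio k ∧ R (s.realize a) (t.realize a) ∧ θ = F s t} := by
  refine (rePred_image (S := {n | ∃ s t : grp.Term ℕ,
      n = Nat.pair (termCode s) (termCode t) ∧ (s.varFinset : Set ℕ) ⊆ Set.Iio k ∧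
      (t.varFinset : Set ℕ) ⊆ Set.Iio k ∧ R (s.realize a) (t.realize a)})
        (computablePred_termPair ha k hR).to_re hf).of_eq fun n => ?_
  constructor
  · rintro ⟨_, ⟨s, t, rfl, hs, ht, h⟩, rfl⟩
    exact ⟨F s t, ⟨s, t, hs, ht, h, rfl⟩, hF s t⟩
  · rintro ⟨_, ⟨s, t, hs, ht, h, rfl⟩, rfl⟩
    exact ⟨_, ⟨s, t, rfl, hs, ht, h⟩, (hF s t).symm⟩

theorem computable_of_eventually_const {D : Type} [Primcodable D] {a : ℕ → D} (k : ℕ) {d : D}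
    (h : ∀ i, k ≤ i → a i = d) : Computable a := by
  have : Primrec fun i => ((List.range k).map a).getD i d :=
    (Primrec.list_getD d).comp (Primrec.const _) Primrec.id
  refine (this.of_eq fun i => ?_).to_comp
  by_cases hi : i < k
  · simp [hi]
  · simp [hi, h i (by omega)]

theorem computable_bas (m : ℕ) : Computable (bas m) :=
  computable_of_eventually_const m (d := 1) fun _ hi => by simp [bas, hi]

theorem computable_gen [Primcodable T] : Computable (gen r τ) :=
  computable_of_eventually_const (r + N) (d := 1) fun i hi => by
    simp [gen, show ¬ i < r by omega, show ¬ i - r < N by omega]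

theorem computable_expAssign (k : ℕ) : Computable (expAssign r k) :=
  computable_of_eventually_const (r + k + 1) (d := 1) fun i hi => by
    simp [expAssign, show ¬ i < r by omega, show ¬ i = k by omega]

theorem computablePred_forall_fin {α : Type} [Primcodable α] {n : ℕ} {p : α → Fin n → Prop}
    (hp : ∀ i, ComputablePred fun a => p a i) : ComputablePred fun a => ∀ i, p a i := by
  induction n with
  | zero => exact (computablePred_const True).of_eq fun a => by simp
  | succ n ih =>
    exact (computablePred_and (hp 0) (ih fun i => hp i.succ)).of_eq fun a => by
      rw [Fin.forall_fin_succ]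

theorem computablePred_forcesTorsion : ComputablePred (ForcesTorsion r) := by
  have h1 : Computable fun q : Zpow r × Multiplicative ℤ => q.2 := Computable.snd
  have h2 : ∀ i : Fin r, Computable fun q : Zpow r × Multiplicative ℤ => q.1 i := fun i =>
    (primrec_finArrow_apply i).to_comp.comp Computable.fst
  have habs : Computable fun a : Multiplicative ℤ => a.toAdd.natAbs :=
    (primrec_natAbs.comp primrec_toAdd).to_comp
  have hdvd : ∀ i : Fin r, ComputablePred fun q : Zpow r × Multiplicative ℤ =>
      q.2.toAdd ∣ (q.1 i).toAdd := fun i => by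
    have : ComputablePred fun q : Zpow r × Multiplicative ℤ =>
        (q.1 i).toAdd.natAbs % q.2.toAdd.natAbs = 0 :=
      computablePred_eq (Primrec.nat_mod.to_comp.comp (habs.comp (h2 i)) (habs.comp h1))
        (Computable.const 0)
    refine this.of_eq fun q => ?_
    rw [← Nat.dvd_iff_mod_eq_zero, Int.natAbs_dvd_natAbs]
  refine (computablePred_and (computablePred_eq h1 (Computable.const 1)).not (computablePred_or
    (computablePred_forall_fin hdvd).not
    (computablePred_eq Computable.fst (Computable.const 1)))).of_eq fun q => ?_
  simp only [ForcesTorsion, ne_eq]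
  tauto

theorem rePred_sigmaSet : REPred fun n => n ∈ QFFormula.code '' sigmaSet r τ := by
  let _ : Primcodable T := Primcodable.ofEquiv (Fin N) τ.symm
  have : Finite T := Finite.of_equiv _ τ
  have := computableStructure_of_finite T
  have heq : ComputablePred fun x : (Zpow r × T) × (Zpow r × T) => x.1 = x.2 :=
    computablePred_eq Computable.fst Computable.snd
  have hpair : ∀ m, Computable fun n => Nat.pair m n := fun m =>
    (Primrec₂.natPair.comp (Primrec.const m) Primrec.id).to_comp
  have h1 := rePred_code (computable_gen (τ := τ)) (r + N) heq (F := .eq) (hpair 0)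
    fun s t => rfl
  have h2 := rePred_code (computable_gen (τ := τ)) (r + N) (R := fun x y => x ≠ y) heq.not
    (F := .ne) (hpair 1) fun s t => rfl
  have h3 := rePred_code (computable_expAssign (r := r) (r + N)) (r + N + 1)
    (R := fun x y => ForcesTorsion r (x / y))
    (computablePred_comp computablePred_forcesTorsion
      ((computable_div _).comp Computable.fst Computable.snd))
    (F := fun s t => .or (.ne s t) (torsionDisj r N N))
    (f := fun n => Nat.pair 3 (Nat.pair (Nat.pair 1 n) (torsionDisj r N N).code))
    ((Primrec₂.natPair.comp (Primrec.const 3) (Primrec₂.natPair.comp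
      (Primrec₂.natPair.comp (Primrec.const 1) Primrec.id) (Primrec.const _))).to_comp)
    fun s t => rfl
  refine (rePred_or h1 (rePred_or h2 h3)).of_eq fun n => ?_
  rw [← Set.mem_union, ← Set.mem_union, ← Set.image_union, ← Set.image_union]
  rfl

theorem rePred_rankSet : REPred fun n => n ∈ QFFormula.code '' rankSet r := by
  have heq : ComputablePred fun x : Zpow (r + 1) × Zpow (r + 1) => x.1 ≠ x.2 :=
    (computablePred_eq Computable.fst Computable.snd).not
  exact rePred_code (computable_bas (r + 1)) (r + 1) (R := fun x y => x ≠ y) heq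
    (F := .eq) (f := fun n => Nat.pair 0 n)
    (Primrec₂.natPair.comp (Primrec.const 0) Primrec.id).to_comp fun s t => rfl

theorem rePred_axiomSet : REPred fun n => n ∈ QFFormula.code '' axiomSet := by
  have h : ∀ m : ℕ, ComputablePred fun n : ℕ => n = m := fun m =>
    computablePred_eq Computable.id (Computable.const m)
  obtain ⟨a, b, c, d, hS⟩ : ∃ a b c d, QFFormula.code '' axiomSet = {a, b, c, d} := by
    rw [axiomSet, Set.image_insert_eq, Set.image_insert_eq, Set.image_insert_eq,
      Set.image_singleton]
    exact ⟨_, _, _, _, rfl⟩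
  rw [hS]
  exact (computablePred_or (h a) (computablePred_or (h b) (computablePred_or (h c) (h d)))).to_re

theorem vars_axiomSet {θ : QFFormula} (hθ : θ ∈ axiomSet) : ∀ x ∈ θ.vars, x ∈ [0, 1, 2] := by
  simp only [axiomSet, Set.mem_insert_iff, Set.mem_singleton_iff] at hθ
  rcases hθ with rfl | rfl | rfl | rfl <;> simp [QFFormula.vars]

/-- Every finitely generated abelian group has a computable `d-Σ₂` Scott sentence. -/
theorem exists_scottSentence (τ : Fin N ≃ T) {G : Type v} [Group G] (e : G ≃* Zpow r × T) :
    ∃ φ : InfFormula, φ.IsComputableDSigmaTwoSentence ∧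
      InfFormula.IsScottSentence.{v, w} φ G := by
  obtain ⟨j₁, h₁⟩ := isComputable_piOne (rePred_sigmaSet (r := r) (τ := τ)) [r + N]
  obtain ⟨j₂, h₂⟩ := isComputable_sigmaOne (rePred_rankSet (r := r)) []
  let σ := sigmaTwo (List.range (r + N)) j₁ (piOne [r + N] (sigmaSet r τ))
  let π := piTwo (List.range (r + 1)) j₂ (sigmaOne [] (rankSet r)) [0, 1, 2] axiomSet
  have hσ : σ.IsSentence := isSentence_sigmaTwo fun x hx => by
    obtain ⟨θ, hθ, h1, h2⟩ := freeVars_piOne.1 hx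
    have := vars_sigmaSet hθ x h1
    simp only [List.mem_singleton, List.mem_range] at h2 ⊢
    omega
  have hπ : π.IsSentence := isSentence_piTwo (fun x hx => by
    obtain ⟨θ, hθ, h1, -⟩ := freeVars_sigmaOne.1 hx
    simpa using vars_rankSet hθ x h1) fun θ hθ => vars_axiomSet hθ
  refine ⟨InfFormula.conj σ π, ⟨σ, π, hσ, hπ, isComputable_sigmaTwo h₁ _,
    isComputable_piTwo h₂ _ _ rePred_axiomSet, rfl⟩, hσ.conj hπ, fun M _ _ => ?_⟩
  obtain ⟨eG⟩ := nonempty_grpEquiv_iff.2 ⟨e⟩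
  have hM : Nonempty (M ≃[grp] G) ↔ Nonempty (M ≃[grp] Zpow r × T) :=
    ⟨fun ⟨f⟩ => ⟨eG.comp f⟩, fun ⟨f⟩ => ⟨eG.symm.comp f⟩⟩
  rw [hM, nonempty_equiv_iff (τ := τ), (hσ.conj hπ).models_iff (fun _ => sOne M),
    InfFormula.realize_conj]
  refine and_congr ?_ ?_
  · rw [realize_sigmaTwo, sigmaCond_iff]
    simp only [realize_piOne]
    constructor
    · rintro ⟨x, -, hx⟩
      exact ⟨x, fun θ hθ y => hx θ hθ _ fun _ hi => Function.update_of_ne (by simpa using hi) _ _⟩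
    · rintro ⟨x, hx⟩
      refine ⟨fun i => if i < r + N then x i else sOne M, fun i hi =>
        if_neg (by simpa using hi), fun θ hθ b hb => ?_⟩
      refine (θ.realize_congr fun i hi => ?_).1 (hx θ hθ (b (r + N)))
      rcases eq_or_ne i (r + N) with rfl | hne
      · simp
      · have := vars_sigmaSet hθ i hi
        rw [Function.update_of_ne hne, hb i (by simpa using hne)]
        exact (if_pos (by omega)).symm
  · rw [realize_piTwo, and_comm]
    refine and_congr ?_ ?_
    · rw [abelianAxioms_iff]
      refine forall₂_congr fun θ hθ => ⟨fun h z => ?_, fun h b _ => h b⟩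
      refine (θ.realize_congr fun i hi => ?_).1
        (h (fun i => if i ∈ [0, 1, 2] then z i else sOne M) fun i hi => if_neg hi)
      rw [if_pos (vars_axiomSet hθ i hi)]
    · rw [rankCond_iff]
      simp only [realize_sigmaOne_nil]
      refine ⟨fun h z => ?_, fun h b _ => h b⟩
      obtain ⟨θ, hθ, h1⟩ := h (fun i => if i < r + 1 then z i else sOne M)
        fun i hi => if_neg (by simpa using hi)
      refine ⟨θ, hθ, (θ.realize_congr fun i hi => ?_).1 h1⟩
      rw [if_pos (vars_rankSet hθ i hi)]

end ScottSentence

/-! ### Arithmetical complexity of properties of indices -/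

section Arithmetical

variable {α : Type u} {β : Type v} [Primcodable α] [Primcodable β]

/-- The number `e` is an index of a function with value `1` at `c`. -/
def Acc (e c : ℕ) : Prop := 1 ∈ phi e c

/-- The number `e` is an index of a function with value `0` at `c`. -/
def Rej (e c : ℕ) : Prop := 0 ∈ phi e c

theorem rePred_mem_phi (k : ℕ) {f g : α → ℕ} (hf : Computable f) (hg : Computable g) :
    REPred fun a => k ∈ phi (f a) (g a) := by
  refine rePred_iff.2 ⟨fun x => Nat.Partrec.Code.evaln x.2
    (Denumerable.ofNat Nat.Partrec.Code (f x.1)) (g x.1) = some k, computablePred_eq ?_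
      (Computable.const _), fun a => ?_⟩
  · exact (Nat.Partrec.Code.primrec_evaln.to_comp.comp ((Computable.snd.pair
      ((Computable.ofNat _).comp (hf.comp Computable.fst))).pair
        (hg.comp Computable.fst))).of_eq fun _ => rfl
  · exact Nat.Partrec.Code.evaln_complete

theorem rePred_acc {f g : α → ℕ} (hf : Computable f) (hg : Computable g) :
    REPred fun a => Acc (f a) (g a) :=
  rePred_mem_phi 1 hf hg

theorem rePred_rej {f g : α → ℕ} (hf : Computable f) (hg : Computable g) :
    REPred fun a => Rej (f a) (g a) :=
  rePred_mem_phi 0 hf hg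

theorem rePred_ex {p : α → β → Prop} (hp : REPred fun x : α × β => p x.1 x.2) :
    REPred fun a => ∃ b, p a b :=
  rePred_exists hp

theorem computable_natPair {f g : α → ℕ} (hf : Computable f) (hg : Computable g) :
    Computable fun a => Nat.pair (f a) (g a) :=
  Primrec₂.natPair.to_comp.comp hf hg

/-- A `Π⁰₂` property of natural numbers. -/
def IsPi02 (p : ℕ → Prop) : Prop :=
  ∃ q : ℕ × ℕ → Prop, REPred q ∧ ∀ e, p e ↔ ∀ x, q (e, x)

theorem IsPi02.and {p q : ℕ → Prop} (hp : IsPi02 p) (hq : IsPi02 q) :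
    IsPi02 fun e => p e ∧ q e := by
  obtain ⟨p', hp', h1⟩ := hp
  obtain ⟨q', hq', h2⟩ := hq
  exact ⟨_, rePred_and hp' hq', fun e => by beta_reduce; rw [h1, h2, forall_and]⟩

theorem isPi02_forall {q : ℕ → β → Prop} (hq : REPred fun x : ℕ × β => q x.1 x.2) :
    IsPi02 fun e => ∀ b, q e b := by
  refine ⟨fun x => (Encodable.decode x.2 : Option β) = none ∨
    ∃ b, (Encodable.decode x.2 : Option β) = some b ∧ q x.1 b, ?_, fun e => ?_⟩
  · have hd : Computable fun x : ℕ × ℕ => (Encodable.decode x.2 : Option β) :=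
      Computable.decode.comp Computable.snd
    refine rePred_or (computablePred_eq hd (Computable.const none)).to_re
      (rePred_ex (rePred_and (computablePred_eq (hd.comp Computable.fst)
        (Computable.option_some.comp Computable.snd)).to_re ?_))
    exact rePred_comp hq ((Computable.fst.comp Computable.fst).pair Computable.snd)
  · constructor
    · intro h x
      cases hx : (Encodable.decode x : Option β) with
      | none => exact .inl rfl
      | some b => exact .inr ⟨b, rfl, h b⟩
    · intro h b
      rcases h (Encodable.encode b) with h | ⟨b', h, h'⟩
      · simp at h
      · simp only [Encodable.encodek, Option.some.injEq] at h
        rwa [h]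

theorem IsPi02.isSigma02 {p : ℕ → Prop} (hp : IsPi02 p) : IsSigma02 {e | ¬ p e} := by
  obtain ⟨q, hq, h⟩ := hp
  obtain ⟨R, hR, h'⟩ := rePred_iff.1 hq
  refine ⟨fun x => ¬ R ((x.1, x.2.1), x.2.2), (computablePred_comp hR ?_).not, fun e => ?_⟩
  · exact (Computable.fst.pair (Computable.fst.comp Computable.snd)).pair
      (Computable.snd.comp Computable.snd)
  · simp [h, h']

end Arithmetical

/-! ### The indices of atomic diagrams -/

section Diagrams

/-- The code of the atomic formula between the terms with codes `s` and `t`. -/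
def eqc (s t : ℕ) : ℕ := Nat.pair 0 (Nat.pair s t)

/-- The code of the negated atomic formula between the terms with codes `s` and `t`. -/
def nec (s t : ℕ) : ℕ := Nat.pair 1 (Nat.pair s t)

/-- The code of the atomic formula which says that the term with code `c` has the value `n`. -/
def valc (c n : ℕ) : ℕ := eqc c (Nat.pair 0 n)

/-- The properties that characterize atomic diagrams of structures with universe a subset of `ℕ`,
for the set `P` of codes and its complement `Q`. The universe consists of the numbers `n` for which
`P` contains `xₙ = xₙ`. All implications are written as disjunctions, so that `P` and `Q` occur only
positively. -/
def DiagramAxioms (P Q : ℕ → Prop) : Prop :=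
  ∀ x : ℕ × ℕ × ℕ × ℕ × ℕ × ℕ,
    let c := x.1
    let c' := x.2.1
    let n := x.2.2.1
    let n' := x.2.2.2.1
    let m := x.2.2.2.2.1
    let m' := x.2.2.2.2.2
    (P c ∨ Q c) ∧
    -- Constants name themselves, and the value of a term is a unique element of the universe.
    (Q (valc (Nat.pair 0 c) n) ∨ n = c) ∧
    (Q (valc c n) ∨ P (valc (Nat.pair 0 n) n)) ∧
    (Q (valc c n) ∨ Q (valc c n') ∨ n = n') ∧
    -- The identity.
    (∃ k, P (valc (Nat.pair 1 0) k)) ∧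
    -- Inverses: the values of terms are compositional and always exist.
    (Q (valc (Nat.pair 2 c) n) ∨ ∃ k, P (valc c k) ∧ P (valc (Nat.pair 2 (Nat.pair 0 k)) n)) ∧
    (Q (valc c m) ∨ Q (valc (Nat.pair 2 (Nat.pair 0 m)) n) ∨ P (valc (Nat.pair 2 c) n)) ∧
    (Q (valc c m) ∨ ∃ k, P (valc (Nat.pair 2 c) k)) ∧
    -- Products, likewise.
    (Q (valc (Nat.pair 3 (Nat.pair c c')) n) ∨ ∃ k k', P (valc c k) ∧ P (valc c' k') ∧
      P (valc (Nat.pair 3 (Nat.pair (Nat.pair 0 k) (Nat.pair 0 k'))) n)) ∧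
    (Q (valc c m) ∨ Q (valc c' m') ∨
      Q (valc (Nat.pair 3 (Nat.pair (Nat.pair 0 m) (Nat.pair 0 m'))) n) ∨
      P (valc (Nat.pair 3 (Nat.pair c c')) n)) ∧
    (Q (valc c m) ∨ Q (valc c' m') ∨ ∃ k, P (valc (Nat.pair 3 (Nat.pair c c')) k)) ∧
    -- Only Goedel numbers of terms have values.
    (Q (valc c n) ∨ (c.unpair.1 < 4 ∧ (¬ c.unpair.1 = 1 ∨ c.unpair.2 = 0))) ∧
    -- The truth of literals is determined by the values of their terms.
    (Q (eqc c c') ∨ ∃ k, P (valc c k) ∧ P (valc c' k)) ∧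
    (Q (valc c n) ∨ Q (valc c' n) ∨ P (eqc c c')) ∧
    (Q (nec c c') ∨ ∃ k k', ¬ k = k' ∧ P (valc c k) ∧ P (valc c' k')) ∧
    (Q (valc c n) ∨ Q (valc c' n') ∨ n = n' ∨ P (nec c c')) ∧
    -- All elements are codes of literals.
    (Q c ∨ c.unpair.1 < 2)

theorem isPi02_diagramAxioms : IsPi02 fun e => DiagramAxioms (Acc e) (Rej e) := by
  refine isPi02_forall ?_
  simp only [valc, eqc, nec]
  repeat' with_reducible first
    | apply rePred_or
    | apply rePred_ex
    | apply rePred_and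
    | apply rePred_acc
    | apply rePred_rej
    | apply ComputablePred.to_re
    | apply computablePred_and
    | apply computablePred_or
    | apply ComputablePred.not
    | apply computablePred_lt
    | apply computablePred_eq
    | apply computable_natPair
    | exact Computable.id
    | exact Computable.fst
    | exact Computable.snd
    | exact Computable.const _
    | apply Computable.fst.comp
    | apply Computable.snd.comp
    | apply Computable.unpair.comp

variable {U : Set ℕ}

/-- The Goedel number of a term with constants from `U`. -/
def closedCode (s : grp.Term U) : ℕ := termCode (s.relabel Subtype.val)

@[simp] theorem closedCode_var (u : U) : closedCode (.var u) = Nat.pair 0 u := by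
  simp [closedCode, Term.relabel]
@[simp] theorem closedCode_tOne : closedCode (tOne : grp.Term U) = Nat.pair 1 0 := by
  simp [closedCode]
@[simp] theorem closedCode_tInv (s : grp.Term U) :
    closedCode (tInv s) = Nat.pair 2 (closedCode s) := by
  simp [closedCode]
@[simp] theorem closedCode_tMul (s t : grp.Term U) :
    closedCode (tMul s t) = Nat.pair 3 (Nat.pair (closedCode s) (closedCode t)) := by
  simp [closedCode]

theorem closedCode_injective : Function.Injective (closedCode (U := U)) := by
  intro s
  induction s using term_induction with
  | hvar a => intro t h; induction t using term_induction <;> simp_all [Subtype.ext_iff]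
  | hone => intro t h; induction t using term_induction <;> simp_all
  | hinv s ih =>
    intro t h
    induction t using term_induction with
    | hinv t _ => rw [ih (by simpa using h)]
    | _ => simp at h
  | hmul s s' ih ih' =>
    intro t h
    induction t using term_induction with
    | hmul t t' _ _ =>
      simp only [closedCode_tMul, Nat.pair_eq_pair, true_and] at h
      rw [ih h.1, ih' h.2]
    | _ => simp at h

theorem closedCode_eq_zero {s : grp.Term U} {n : ℕ} (h : closedCode s = Nat.pair 0 n) :
    ∃ u : U, s = .var u ∧ (u : ℕ) = n := by
  induction s using term_induction <;> simp_all

theorem closedCode_eq_two {s : grp.Term U} {n : ℕ} (h : closedCode s = Nat.pair 2 n) :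
    ∃ t, s = tInv t ∧ closedCode t = n := by
  induction s using term_induction with
  | hinv t _ => exact ⟨t, rfl, by simpa using h⟩
  | _ => simp at h

theorem closedCode_eq_three {s : grp.Term U} {n n' : ℕ}
    (h : closedCode s = Nat.pair 3 (Nat.pair n n')) :
    ∃ t t', s = tMul t t' ∧ closedCode t = n ∧ closedCode t' = n' := by
  induction s using term_induction with
  | hmul t t' _ _ => exact ⟨t, t', rfl, by simpa using h⟩
  | _ => simp at h

theorem closedCode_tag (s : grp.Term U) : (closedCode s).unpair.1 < 4 ∧
    (¬ (closedCode s).unpair.1 = 1 ∨ (closedCode s).unpair.2 = 0) := by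
  induction s using term_induction <;> simp

section
variable [grp.Structure U]

theorem eqc_mem_atomicDiagram {c c' : ℕ} : eqc c c' ∈ atomicDiagram U ↔
    ∃ s t : grp.Term U, closedCode s = c ∧ closedCode t = c' ∧ s.realize id = t.realize id := by
  constructor
  · rintro ⟨s, t, ⟨h, hc⟩ | ⟨h, hc⟩⟩
    · simp only [eqc, QFFormula.code, Nat.pair_eq_pair, true_and] at hc
      exact ⟨s, t, hc.1.symm, hc.2.symm, h⟩
    · simp [eqc, QFFormula.code] at hc
  · rintro ⟨s, t, rfl, rfl, h⟩
    exact ⟨s, t, .inl ⟨h, rfl⟩⟩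

theorem nec_mem_atomicDiagram {c c' : ℕ} : nec c c' ∈ atomicDiagram U ↔
    ∃ s t : grp.Term U, closedCode s = c ∧ closedCode t = c' ∧ s.realize id ≠ t.realize id := by
  constructor
  · rintro ⟨s, t, ⟨h, hc⟩ | ⟨h, hc⟩⟩
    · simp [nec, QFFormula.code] at hc
    · simp only [nec, QFFormula.code, Nat.pair_eq_pair, true_and] at hc
      exact ⟨s, t, hc.1.symm, hc.2.symm, h⟩
  · rintro ⟨s, t, rfl, rfl, h⟩
    exact ⟨s, t, .inr ⟨h, rfl⟩⟩

theorem tag_of_mem_atomicDiagram {c : ℕ} (h : c ∈ atomicDiagram U) : c.unpair.1 < 2 := by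
  obtain ⟨s, t, ⟨-, rfl⟩ | ⟨-, rfl⟩⟩ := h <;> simp [QFFormula.code]

theorem valc_mem_atomicDiagram {c n : ℕ} : valc c n ∈ atomicDiagram U ↔
    ∃ s : grp.Term U, closedCode s = c ∧ (s.realize id : U) = n := by
  rw [valc, eqc_mem_atomicDiagram]
  constructor
  · rintro ⟨s, t, hs, ht, h⟩
    obtain ⟨u, rfl, hu⟩ := closedCode_eq_zero ht
    exact ⟨s, hs, by rw [h, ← hu]; rfl⟩
  · rintro ⟨s, hs, h⟩
    exact ⟨s, .var (s.realize id), hs, by simp [h], rfl⟩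

theorem valc_closedCode {s : grp.Term U} {n : ℕ} :
    valc (closedCode s) n ∈ atomicDiagram U ↔ (s.realize id : U) = n := by
  rw [valc_mem_atomicDiagram]
  refine ⟨?_, fun h => ⟨s, rfl, h⟩⟩
  rintro ⟨t, ht, h⟩
  rwa [closedCode_injective ht] at h

theorem diagramAxioms_atomicDiagram :
    DiagramAxioms (· ∈ atomicDiagram U) (· ∉ atomicDiagram U) := by
  rintro ⟨c, c', n, n', m, m'⟩
  simp only [← imp_iff_not_or]
  refine ⟨em _, ?_, ?_, ?_, ?_, ?_, ?_, ?_, ?_, ?_, ?_, ?_, ?_, ?_, ?_, ?_,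
    tag_of_mem_atomicDiagram⟩
  · intro k
    obtain ⟨s, hs, h⟩ := valc_mem_atomicDiagram.1 k
    obtain ⟨u, rfl, hu⟩ := closedCode_eq_zero hs
    rw [← h, ← hu]; rfl
  · intro k
    obtain ⟨s, hs, h⟩ := valc_mem_atomicDiagram.1 k
    exact valc_mem_atomicDiagram.2 ⟨.var (s.realize id), by simp [h], h⟩
  · intro k k'
    obtain ⟨s, rfl, h⟩ := valc_mem_atomicDiagram.1 k
    rw [valc_closedCode] at k'
    rw [← h, ← k']
  · exact ⟨_, valc_mem_atomicDiagram.2 ⟨tOne, by simp, rfl⟩⟩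
  · intro k
    obtain ⟨s, hs, h⟩ := valc_mem_atomicDiagram.1 k
    obtain ⟨t, rfl, rfl⟩ := closedCode_eq_two hs
    exact ⟨_, valc_closedCode.2 rfl, valc_mem_atomicDiagram.2
      ⟨tInv (.var (t.realize id)), by simp, by rw [← h]; simp⟩⟩
  · intro k k'
    obtain ⟨s, rfl, h⟩ := valc_mem_atomicDiagram.1 k
    obtain ⟨t, ht, h'⟩ := valc_mem_atomicDiagram.1 k'
    obtain ⟨t, rfl, ht'⟩ := closedCode_eq_two ht
    obtain ⟨u, rfl, hu⟩ := closedCode_eq_zero ht'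
    have : u = s.realize id := Subtype.ext (hu.trans h.symm)
    exact valc_mem_atomicDiagram.2 ⟨tInv s, by simp, by rw [← h', this]; simp⟩
  · intro k
    obtain ⟨s, rfl, h⟩ := valc_mem_atomicDiagram.1 k
    exact ⟨_, valc_mem_atomicDiagram.2 ⟨tInv s, by simp, rfl⟩⟩
  · intro k
    obtain ⟨s, hs, h⟩ := valc_mem_atomicDiagram.1 k
    obtain ⟨t, t', rfl, rfl, rfl⟩ := closedCode_eq_three hs
    exact ⟨_, _, valc_closedCode.2 rfl, valc_closedCode.2 rfl, valc_mem_atomicDiagram.2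
      ⟨tMul (.var (t.realize id)) (.var (t'.realize id)), by simp, by rw [← h]; simp⟩⟩
  · intro k k' k''
    obtain ⟨s, rfl, h⟩ := valc_mem_atomicDiagram.1 k
    obtain ⟨s', rfl, h'⟩ := valc_mem_atomicDiagram.1 k'
    obtain ⟨t, ht, h''⟩ := valc_mem_atomicDiagram.1 k''
    obtain ⟨t, t', rfl, ht1, ht2⟩ := closedCode_eq_three ht
    obtain ⟨u, rfl, hu⟩ := closedCode_eq_zero ht1
    obtain ⟨u', rfl, hu'⟩ := closedCode_eq_zero ht2
    have h1 : u = s.realize id := Subtype.ext (hu.trans h.symm)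
    have h2 : u' = s'.realize id := Subtype.ext (hu'.trans h'.symm)
    exact valc_mem_atomicDiagram.2 ⟨tMul s s', by simp, by rw [← h'', h1, h2]; simp⟩
  · intro k k'
    obtain ⟨s, rfl, h⟩ := valc_mem_atomicDiagram.1 k
    obtain ⟨s', rfl, h'⟩ := valc_mem_atomicDiagram.1 k'
    exact ⟨_, valc_mem_atomicDiagram.2 ⟨tMul s s', by simp, rfl⟩⟩
  · intro k
    obtain ⟨s, rfl, h⟩ := valc_mem_atomicDiagram.1 k
    have := closedCode_tag s
    rwa [← imp_iff_not_or] at this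
  · intro k
    obtain ⟨s, t, rfl, rfl, h⟩ := eqc_mem_atomicDiagram.1 k
    exact ⟨_, valc_closedCode.2 rfl, valc_closedCode.2 (by rw [h])⟩
  · intro k k'
    obtain ⟨s, rfl, h⟩ := valc_mem_atomicDiagram.1 k
    obtain ⟨s', rfl, h'⟩ := valc_mem_atomicDiagram.1 k'
    exact eqc_mem_atomicDiagram.2 ⟨s, s', rfl, rfl, Subtype.ext (h.trans h'.symm)⟩
  · intro k
    obtain ⟨s, t, rfl, rfl, h⟩ := nec_mem_atomicDiagram.1 k
    exact ⟨_, _, fun h' => h (Subtype.ext h'), valc_closedCode.2 rfl, valc_closedCode.2 rfl⟩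
  · intro k k'
    obtain ⟨s, rfl, h⟩ := valc_mem_atomicDiagram.1 k
    obtain ⟨s', rfl, h'⟩ := valc_mem_atomicDiagram.1 k'
    by_cases hn : n = n'
    · exact .inl hn
    · exact .inr (nec_mem_atomicDiagram.2 ⟨s, s', rfl, rfl, fun h1 => hn (by rw [← h, ← h', h1])⟩)

end

/-- A structure for the language of groups from its three operations. -/
@[reducible] def structureOfOps {M : Type u} (o : M) (i : M → M) (p : M → M → M) :
    grp.Structure M where
  funMap {_} f x :=
    match f, x with
    | GroupFunc.one, _ => o
    | GroupFunc.inv, x => i (x 0)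
    | GroupFunc.mul, x => p (x 0) (x 1)
  RelMap {_} r _ := nomatch r

/-- The converse of `diagramAxioms_atomicDiagram`: the operations are read off from the atomic
formulas about the values of `1`, `xₐ⁻¹` and `xₐ * x_b`, and the values of all other terms are
determined by recursion on their codes. -/
theorem exists_structure_of_diagramAxioms {D : Set ℕ} (h : DiagramAxioms (· ∈ D) (· ∉ D)) :
    ∃ (U : Set ℕ) (_ : grp.Structure U), D = atomicDiagram U := by
  simp only [DiagramAxioms, ← imp_iff_not_or, Prod.forall] at h
  have h2 := fun c n => (h c 0 n 0 0 0).2.1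
  have h3 := fun c n => (h c 0 n 0 0 0).2.2.1
  have h4 := fun c n n' => (h c 0 n n' 0 0).2.2.2.1
  have h5 := (h 0 0 0 0 0 0).2.2.2.2.1
  have h6 := fun c n => (h c 0 n 0 0 0).2.2.2.2.2.1
  have h7 := fun c m n => (h c 0 n 0 m 0).2.2.2.2.2.2.1
  have h8 := fun c m => (h c 0 0 0 m 0).2.2.2.2.2.2.2.1
  have h9 := fun c c' n => (h c c' n 0 0 0).2.2.2.2.2.2.2.2.1
  have h10 := fun c c' m m' n => (h c c' n 0 m m').2.2.2.2.2.2.2.2.2.1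
  have h11 := fun c c' m m' => (h c c' 0 0 m m').2.2.2.2.2.2.2.2.2.2.1
  have h12 := fun c n => (h c 0 n 0 0 0).2.2.2.2.2.2.2.2.2.2.2.1
  have h13 := fun c c' => (h c c' 0 0 0 0).2.2.2.2.2.2.2.2.2.2.2.2.1
  have h14 := fun c c' n => (h c c' n 0 0 0).2.2.2.2.2.2.2.2.2.2.2.2.2.1
  have h15 := fun c c' => (h c c' 0 0 0 0).2.2.2.2.2.2.2.2.2.2.2.2.2.2.1
  have h16 := fun c c' n n' => (h c c' n n' 0 0).2.2.2.2.2.2.2.2.2.2.2.2.2.2.2.1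
  have h17 := fun c => (h c 0 0 0 0 0).2.2.2.2.2.2.2.2.2.2.2.2.2.2.2.2
  clear h
  let U : Set ℕ := {n | valc (Nat.pair 0 n) n ∈ D}
  obtain ⟨o, ho⟩ := h5
  have hinv : ∀ u : U, ∃ k, valc (Nat.pair 2 (Nat.pair 0 u)) k ∈ D := fun u => h8 _ _ u.2
  have hmul : ∀ u v : U, ∃ k, valc (Nat.pair 3 (Nat.pair (Nat.pair 0 u) (Nat.pair 0 v))) k ∈ D :=
    fun u v => h11 _ _ _ _ u.2 v.2
  choose i hi using hinv
  choose p hp using hmul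
  let S : grp.Structure U := structureOfOps ⟨o, h3 _ _ ho⟩ (fun u => ⟨i u, h3 _ _ (hi u)⟩)
    fun u v => ⟨p u v, h3 _ _ (hp u v)⟩
  have hV : ∀ s : grp.Term U, valc (closedCode s) (s.realize id : U) ∈ D := by
    intro s
    induction s using term_induction with
    | hvar u => rw [closedCode_var]; exact u.2
    | hone => rw [closedCode_tOne, realize_tOne]; exact ho
    | hinv s ih => rw [closedCode_tInv, realize_tInv]; exact h7 _ _ _ ih (hi _)
    | hmul s t ih₁ ih₂ => rw [closedCode_tMul, realize_tMul]; exact h10 _ _ _ _ _ ih₁ ih₂ (hp _ _)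
  have hV' : ∀ c n, valc c n ∈ D → ∃ s : grp.Term U, closedCode s = c ∧
      (s.realize id : U) = n := by
    intro c
    induction c using Nat.strong_induction_on with
    | _ c ih =>
      intro n hn
      obtain ⟨hlt, h1⟩ := h12 _ _ hn
      obtain ⟨t, c', rfl⟩ : ∃ t c', c = Nat.pair t c' := ⟨_, _, (Nat.pair_unpair c).symm⟩
      simp only [Nat.unpair_pair] at hlt h1
      have hc' : t ≠ 0 → c' < Nat.pair t c' := fun ht => by
        have := Nat.add_le_pair t c'
        omega
      interval_cases t
      · obtain rfl := h2 _ _ hn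
        exact ⟨.var ⟨n, hn⟩, by simp, rfl⟩
      · obtain rfl := h1 rfl
        obtain rfl := h4 _ _ _ ho hn
        exact ⟨tOne, by simp, rfl⟩
      · obtain ⟨k, hk, hkn⟩ := h6 _ _ hn
        obtain ⟨s, rfl, rfl⟩ := ih c' (hc' two_ne_zero) k hk
        exact ⟨tInv s, by simp, h4 _ _ _ (hi (s.realize id)) hkn⟩
      · obtain ⟨a, b, rfl⟩ : ∃ a b, c' = Nat.pair a b := ⟨_, _, (Nat.pair_unpair c').symm⟩
        obtain ⟨k, k', hk, hk', hkn⟩ := h9 _ _ _ hn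
        have hlt := hc' three_ne_zero
        obtain ⟨s, rfl, rfl⟩ := ih a ((Nat.left_le_pair _ _).trans_lt hlt) k hk
        obtain ⟨t, rfl, rfl⟩ := ih b ((Nat.right_le_pair _ _).trans_lt hlt) k' hk'
        exact ⟨tMul s t, by simp, h4 _ _ _ (hp (s.realize id) (t.realize id)) hkn⟩
  refine ⟨U, S, Set.ext fun c => ?_⟩
  obtain ⟨t, c', rfl⟩ : ∃ t c', c = Nat.pair t c' := ⟨_, _, (Nat.pair_unpair c).symm⟩
  obtain ⟨a, b, rfl⟩ : ∃ a b, c' = Nat.pair a b := ⟨_, _, (Nat.pair_unpair c').symm⟩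
  by_cases ht : t < 2
  · interval_cases t
    · change eqc a b ∈ D ↔ eqc a b ∈ atomicDiagram U
      rw [eqc_mem_atomicDiagram]
      constructor
      · intro hab
        obtain ⟨k, hk, hk'⟩ := h13 _ _ hab
        obtain ⟨s, hs, hsk⟩ := hV' _ _ hk
        obtain ⟨t, ht, htk⟩ := hV' _ _ hk'
        exact ⟨s, t, hs, ht, Subtype.ext (hsk.trans htk.symm)⟩
      · rintro ⟨s, t, rfl, rfl, hst⟩
        exact h14 _ _ _ (hV s) (by rw [hst]; exact hV t)
    · change nec a b ∈ D ↔ nec a b ∈ atomicDiagram U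
      rw [nec_mem_atomicDiagram]
      constructor
      · intro hab
        obtain ⟨k, k', hne, hk, hk'⟩ := h15 _ _ hab
        obtain ⟨s, hs, hsk⟩ := hV' _ _ hk
        obtain ⟨t, ht, htk⟩ := hV' _ _ hk'
        exact ⟨s, t, hs, ht, fun h => hne (by rw [← hsk, ← htk, h])⟩
      · rintro ⟨s, t, rfl, rfl, hst⟩
        exact (h16 _ _ _ _ (hV s) (hV t)).resolve_left fun h => hst (Subtype.ext h)
  · refine iff_of_false (fun h => ht ?_) (fun h => ht ?_)
    · simpa using h17 _ h
    · simpa using tag_of_mem_atomicDiagram h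

/-- The number `e` is an index of the atomic diagram of the structure on `U`. -/
def IsDiagramIndex (e : ℕ) (U : Set ℕ) [grp.Structure U] : Prop :=
  ∀ c, phi e c = Part.some ((atomicDiagram U).indicator 1 c)

theorem IsDiagramIndex.acc_iff {e : ℕ} [grp.Structure U] (h : IsDiagramIndex e U) (c : ℕ) :
    Acc e c ↔ c ∈ atomicDiagram U := by
  by_cases hc : c ∈ atomicDiagram U <;> simp [Acc, h c, hc]

theorem IsDiagramIndex.rej_iff {e : ℕ} [grp.Structure U] (h : IsDiagramIndex e U) (c : ℕ) :
    Rej e c ↔ c ∉ atomicDiagram U := by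
  by_cases hc : c ∈ atomicDiagram U <;> simp [Rej, h c, hc]

/-- The numbers with `DiagramAxioms` are exactly the indices of atomic diagrams. -/
theorem exists_isDiagramIndex_iff (e : ℕ) :
    (∃ (U : Set ℕ) (_ : grp.Structure U), IsDiagramIndex e U) ↔
      DiagramAxioms (Acc e) (Rej e) := by
  constructor
  · rintro ⟨U, _, h⟩
    rw [show Acc e = (· ∈ atomicDiagram U) from funext fun c => propext (h.acc_iff c),
      show Rej e = (· ∉ atomicDiagram U) from funext fun c => propext (h.rej_iff c)]
    exact diagramAxioms_atomicDiagram
  · intro h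
    have htot : ∀ c, Acc e c ∨ Rej e c := fun c => (h (c, 0, 0, 0, 0, 0)).1
    have hrej : Rej e = fun c => ¬ Acc e c := by
      funext c
      refine propext ⟨fun h0 h1 => ?_, fun h1 => (htot c).resolve_left h1⟩
      exact zero_ne_one (Part.mem_unique h0 h1)
    rw [hrej] at h
    obtain ⟨U, S, hU⟩ := exists_structure_of_diagramAxioms (D := {c | Acc e c}) h
    refine ⟨U, S, fun c => ?_⟩
    rw [← hU]
    by_cases hc : Acc e c
    · rw [Set.indicator_of_mem (s := {c | Acc e c}) (show c ∈ {c | Acc e c} from hc)]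
      exact Part.eq_some_iff.2 hc
    · rw [Set.indicator_of_notMem (s := {c | Acc e c}) (show c ∉ {c | Acc e c} from hc)]
      exact Part.eq_some_iff.2 ((htot c).resolve_left hc)

end Diagrams

/-! ### The index set is a difference of `Σ⁰₂` sets -/

section Upper

/-- The natural numbers, with the operations on the Goedel numbers of terms. -/
def TermNum : Type := ℕ

instance : Primcodable TermNum := inferInstanceAs (Primcodable ℕ)

instance : grp.Structure TermNum := structureOfOps (M := ℕ) (Nat.pair 1 0) (fun c => Nat.pair 2 c)
  fun c d => Nat.pair 3 (Nat.pair c d)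

instance : ComputableStructure TermNum where
  computable_inv := computable_natPair (α := ℕ) (Computable.const 2) Computable.id
  computable_mul := computable_natPair (α := ℕ × ℕ) (Computable.const 3)
    (computable_natPair Computable.fst Computable.snd)

/-- The Goedel number of the variable `xₙ`. -/
def TermNum.var (n : ℕ) : TermNum := Nat.pair 0 n

/-- The result of the substitution of the variable `x_{β i}` for `xᵢ`, for all `i`, in terms of
Goedel numbers. -/
def substCode (β : ℕ → ℕ) (c : ℕ) : ℕ :=
  (evalCode (D := TermNum) (fun i => some (.var (β i))) c).getD (0 : ℕ)

theorem computable_substCode {α : Type} [Primcodable α] {β : α → ℕ → ℕ} (hβ : Computable₂ β)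
    {f : α → ℕ} (hf : Computable f) : Computable fun a => substCode (β a) (f a) := by
  have h1 : Computable₂ fun (a : α) (i : ℕ) => (some (.var (β a i)) : Option TermNum) :=
    Computable.option_some.comp (computable_natPair (α := α × ℕ) (Computable.const 0) hβ)
  have h2 := (computable_evalCode h1).comp Computable.id hf
  exact Computable.option_getD h2 (Computable.const (0 : ℕ))

variable {U : Set ℕ}

theorem substCode_termCode {β : ℕ → ℕ} {b : ℕ → U} {s : grp.Term ℕ}
    (h : ∀ i ∈ s.varFinset, β i = b i) :
    substCode β (termCode s) = closedCode (s.relabel b) := by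
  have key : ∀ s : grp.Term ℕ, (∀ i ∈ s.varFinset, β i = b i) →
      s.realize (fun i => TermNum.var (β i)) = closedCode (s.relabel b) := by
    intro s
    induction s using term_induction with
    | hvar i => 
      intro h
      change Nat.pair 0 (β i) = closedCode (.var (b i))
      rw [closedCode_var, h i (by simp)]
    | hone => intro _; simp; rfl
    | hinv s ih =>
      intro h
      rw [realize_tInv, relabel_tInv, closedCode_tInv, ih (by simpa using h)]; rfl
    | hmul s t ih₁ ih₂ =>
      intro h
      simp only [varFinset_tMul, Finset.mem_union] at h
      rw [realize_tMul, relabel_tMul, closedCode_tMul, ih₁ fun i hi => h i (.inl hi),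
        ih₂ fun i hi => h i (.inr hi)]; rfl
  rw [substCode, evalCode_termCode (D := TermNum) (a := fun i => .var (β i)) s
    fun i _ => rfl]
  exact key s h

variable [grp.Structure U]

theorem eqc_closedCode {s t : grp.Term U} :
    eqc (closedCode s) (closedCode t) ∈ atomicDiagram U ↔ s.realize id = t.realize id := by
  rw [eqc_mem_atomicDiagram]
  refine ⟨?_, fun h => ⟨s, t, rfl, rfl, h⟩⟩
  rintro ⟨s', t', hs, ht, h⟩
  rwa [closedCode_injective hs, closedCode_injective ht] at h

theorem eqc_substCode {β : ℕ → ℕ} {b : ℕ → U} {s t : grp.Term ℕ}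
    (hs : ∀ i ∈ s.varFinset, β i = b i) (ht : ∀ i ∈ t.varFinset, β i = b i) :
    eqc (substCode β (termCode s)) (substCode β (termCode t)) ∈ atomicDiagram U ↔
      s.realize b = t.realize b := by
  rw [substCode_termCode hs, substCode_termCode ht, eqc_closedCode]
  simp

theorem valc_var_mem {n : ℕ} : valc (Nat.pair 0 n) n ∈ atomicDiagram U ↔ n ∈ U := by
  rw [valc_mem_atomicDiagram]
  constructor
  · rintro ⟨s, -, rfl⟩
    exact Subtype.prop _
  · exact fun h => ⟨.var ⟨n, h⟩, by simp, rfl⟩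

theorem eqc_var_mem {x y : U} :
    eqc (Nat.pair 0 (x : ℕ)) (Nat.pair 0 (y : ℕ)) ∈ atomicDiagram U ↔ x = y := by
  rw [← closedCode_var, ← closedCode_var, eqc_closedCode]
  rfl

/-- The assignment of the elements of `U` in the list `l` to the variables. -/
theorem exists_assignment (U : Set ℕ) [grp.Structure U] (l : List ℕ) (k : ℕ)
    (h : ∀ i < k, l.getD i 0 ∈ U) : ∃ b : ℕ → U, ∀ i < k, l.getD i 0 = b i := by
  classical
  exact ⟨fun i => if h : l.getD i 0 ∈ U then ⟨l.getD i 0, h⟩ else sOne U, fun i hi => by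
    beta_reduce
    rw [dif_pos (h i hi)]⟩

theorem getD_map_range (b : ℕ → ℕ) {k i : ℕ} (hi : i < k) :
    ((List.range k).map b).getD i 0 = b i := by
  simp [List.getD_eq_getElem?_getD, hi]

end Upper

section Conditions

variable {T : Type} [CommGroup T] {N : ℕ} {r : ℕ} {τ : Fin N ≃ T}

theorem exists_isPi02_abelianAxioms : ∃ p : ℕ → Prop, IsPi02 p ∧
    ∀ e (U : Set ℕ) [grp.Structure U], IsDiagramIndex e U → (p e ↔ AbelianAxioms U) := by
  refine ⟨fun e => ∀ z : ℕ × ℕ × ℕ,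
    let x : ℕ := Nat.pair 0 z.1
    let y : ℕ := Nat.pair 0 z.2.1
    let z' : ℕ := Nat.pair 0 z.2.2
    let m : ℕ → ℕ → ℕ := fun c d => Nat.pair 3 (Nat.pair c d)
    Rej e (valc x z.1) ∨ Rej e (valc y z.2.1) ∨ Rej e (valc z' z.2.2) ∨
      (Acc e (eqc (m (m x y) z') (m x (m y z'))) ∧ Acc e (eqc (m (Nat.pair 1 0) x) x) ∧
        Acc e (eqc (m (Nat.pair 2 x) x) (Nat.pair 1 0)) ∧ Acc e (eqc (m x y) (m y x))),
    isPi02_forall ?_, fun e U _ he => ?_⟩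
  · simp only [valc, eqc]
    repeat' with_reducible first
      | apply rePred_or
      | apply rePred_and
      | apply rePred_acc
      | apply rePred_rej
      | apply computable_natPair
      | exact Computable.fst
      | exact Computable.snd
      | exact Computable.const _
      | apply Computable.fst.comp
      | apply Computable.snd.comp
  · simp only [he.acc_iff, he.rej_iff, valc_var_mem]
    have key : ∀ x y z : U,
        (eqc (Nat.pair 3 (Nat.pair (Nat.pair 3 (Nat.pair (Nat.pair 0 x) (Nat.pair 0 y)))
          (Nat.pair 0 z))) (Nat.pair 3 (Nat.pair (Nat.pair 0 x)
            (Nat.pair 3 (Nat.pair (Nat.pair 0 y) (Nat.pair 0 z))))) ∈ atomicDiagram U ∧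
        eqc (Nat.pair 3 (Nat.pair (Nat.pair 1 0) (Nat.pair 0 x))) (Nat.pair 0 x) ∈
          atomicDiagram U ∧
        eqc (Nat.pair 3 (Nat.pair (Nat.pair 2 (Nat.pair 0 x)) (Nat.pair 0 x))) (Nat.pair 1 0) ∈
          atomicDiagram U ∧
        eqc (Nat.pair 3 (Nat.pair (Nat.pair 0 x) (Nat.pair 0 y)))
          (Nat.pair 3 (Nat.pair (Nat.pair 0 y) (Nat.pair 0 x))) ∈ atomicDiagram U) ↔
        sMul (sMul x y) z = sMul x (sMul y z) ∧ sMul (sOne U) x = x ∧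
          sMul (sInv x) x = sOne U ∧ sMul x y = sMul y x := by
      intro x y z
      simp only [← closedCode_var, ← closedCode_tOne (U := U), ← closedCode_tMul,
        ← closedCode_tInv, eqc_closedCode, realize_tMul, realize_tInv, realize_tOne]
      rfl
    constructor
    · intro h x y z
      exact (key x y z).1 ((((h (x, y, z)).resolve_left (not_not_intro x.2)).resolve_left
        (not_not_intro y.2)).resolve_left (not_not_intro z.2))
    · rintro h ⟨x, y, z⟩
      by_cases hx : x ∈ U
      · by_cases hy : y ∈ U
        · by_cases hz : z ∈ U
          · exact .inr (.inr (.inr ((key ⟨x, hx⟩ ⟨y, hy⟩ ⟨z, hz⟩).2 (h _ _ _))))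
          · exact .inr (.inr (.inl hz))
        · exact .inr (.inl hy)
      · exact .inl hx

theorem computable_getD_zero {α : Type} [Primcodable α] {f : α → List ℕ} {g : α → ℕ}
    (hf : Computable f) (hg : Computable g) : Computable fun a => (f a).getD (g a) 0 :=
  (Computable.option_getD (Computable.list_getElem?.comp hf hg) (Computable.const 0)).of_eq
    fun _ => (List.getD_eq_getElem?_getD ..).symm

/-- The equation with code `c` holds under the assignment `β`, according to `P`. -/
def substEq (P : ℕ → Prop) (β : ℕ → ℕ) (c : ℕ) : Prop :=
  P (eqc (substCode β c.unpair.1) (substCode β c.unpair.2))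

theorem rePred_substEq_acc {α : Type} [Primcodable α] {β : α → ℕ → ℕ} (hβ : Computable₂ β)
    {f g : α → ℕ} (hf : Computable f) (hg : Computable g) :
    REPred fun a => substEq (Acc (g a)) (β a) (f a) :=
  rePred_acc hg (computable_natPair (Computable.const 0) (computable_natPair
    (computable_substCode hβ (Computable.fst.comp (Computable.unpair.comp hf)))
    (computable_substCode hβ (Computable.snd.comp (Computable.unpair.comp hf)))))

theorem rePred_substEq_rej {α : Type} [Primcodable α] {β : α → ℕ → ℕ} (hβ : Computable₂ β)
    {f g : α → ℕ} (hf : Computable f) (hg : Computable g) :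
    REPred fun a => substEq (Rej (g a)) (β a) (f a) :=
  rePred_rej hg (computable_natPair (Computable.const 0) (computable_natPair
    (computable_substCode hβ (Computable.fst.comp (Computable.unpair.comp hf)))
    (computable_substCode hβ (Computable.snd.comp (Computable.unpair.comp hf)))))

theorem rePred_exists_notMem {α : Type} [Primcodable α] {f : α → List ℕ} {g : α → ℕ}
    (hf : Computable f) (hg : Computable g) (k : ℕ) :
    REPred fun a => ∃ i, i < k ∧
      Rej (g a) (valc (Nat.pair 0 ((f a).getD i 0)) ((f a).getD i 0)) := by
  have h : Computable fun x : α × ℕ => (f x.1).getD x.2 0 :=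
    computable_getD_zero (hf.comp Computable.fst) Computable.snd
  exact rePred_ex (rePred_and (computablePred_lt Computable.snd (Computable.const k)).to_re
    (rePred_rej (hg.comp Computable.fst) (computable_natPair (Computable.const 0)
      (computable_natPair (computable_natPair (Computable.const 0) h)
        (computable_natPair (Computable.const 0) h)))))

theorem exists_isPi02_rankCond (r : ℕ) : ∃ p : ℕ → Prop, IsPi02 p ∧
    ∀ e (U : Set ℕ) [grp.Structure U], IsDiagramIndex e U → (p e ↔ RankCond r U) := by
  have hR := computablePred_termPair (computable_bas (r + 1)) (r + 1)
    (R := fun x y => x ≠ y) (computablePred_eq Computable.fst Computable.snd).not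
  have hl : Computable₂ fun (x : (ℕ × List ℕ) × ℕ) (i : ℕ) => x.1.2.getD i 0 :=
    computable_getD_zero (Computable.snd.comp (Computable.fst.comp Computable.fst)) Computable.snd
  refine ⟨fun e => ∀ l : List ℕ,
    (∃ i, i < r + 1 ∧ Rej e (valc (Nat.pair 0 (l.getD i 0)) (l.getD i 0))) ∨
      ∃ c, (∃ s t : grp.Term ℕ, c = Nat.pair (termCode s) (termCode t) ∧
        ↑s.varFinset ⊆ Set.Iio (r + 1) ∧ ↑t.varFinset ⊆ Set.Iio (r + 1) ∧
        s.realize (bas (r + 1)) ≠ t.realize (bas (r + 1))) ∧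
        substEq (Acc e) (fun i => l.getD i 0) c,
    isPi02_forall ?_, fun e U _ he => ?_⟩
  · exact rePred_or (rePred_exists_notMem Computable.snd Computable.fst (r + 1))
      (rePred_ex (rePred_and (rePred_comp hR.to_re Computable.snd)
        (rePred_substEq_acc hl Computable.snd (Computable.fst.comp Computable.fst))))
  simp only [he.acc_iff, he.rej_iff, valc_var_mem, substEq]
  constructor
  · intro h z
    have hz : ∀ i < r + 1, ((List.range (r + 1)).map fun i => (z i : ℕ)).getD i 0 = z i :=
      fun i hi => getD_map_range _ hi
    obtain ⟨i, hi, h⟩ | ⟨_, ⟨s, t, rfl, hs, ht, hst⟩, h⟩ :=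
      h ((List.range (r + 1)).map fun i => (z i : ℕ))
    · rw [hz i hi] at h
      exact absurd (z i).2 h
    · simp only [Nat.unpair_pair] at h
      exact ⟨s, t, hs, ht, hst, (eqc_substCode (fun i hi => hz i (hs hi))
        fun i hi => hz i (ht hi)).1 h⟩
  · intro h l
    by_cases hl : ∀ i < r + 1, l.getD i 0 ∈ U
    · obtain ⟨b, hb⟩ := exists_assignment U l (r + 1) hl
      obtain ⟨s, t, hs, ht, hst, h⟩ := h b
      refine .inr ⟨_, ⟨s, t, rfl, hs, ht, hst⟩, ?_⟩
      simp only [Nat.unpair_pair]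
      exact (eqc_substCode (fun i hi => hb i (hs hi)) fun i hi => hb i (ht hi)).2 h
    · push Not at hl
      exact .inl hl

theorem exists_isPi02_not_sigmaCond (τ : Fin N ≃ T) : ∃ p : ℕ → Prop, IsPi02 p ∧
    ∀ e (U : Set ℕ) [grp.Structure U], IsDiagramIndex e U → (p e ↔ ¬ SigmaCond r τ U) := by
  classical
  have : Finite T := Finite.of_equiv _ τ
  have : Primcodable T := Primcodable.ofEquiv _ τ.symm
  have : ComputableStructure T := computableStructure_of_finite T
  have h1 := computablePred_termPair (computable_gen (r := r) (τ := τ)) (r + N)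
    (R := fun x y => x = y) (computablePred_eq Computable.fst Computable.snd)
  have h2 := computablePred_termPair (computable_gen (r := r) (τ := τ)) (r + N)
    (R := fun x y => x ≠ y) (computablePred_eq Computable.fst Computable.snd).not
  have h3 := computablePred_termPair (computable_expAssign (r := r) (r + N)) (r + N + 1)
    (R := fun x y => ForcesTorsion r (x / y))
    (computablePred_comp computablePred_forcesTorsion (computable_div _))
  have hl : Computable₂ fun (x : (ℕ × List ℕ) × ℕ) (i : ℕ) => x.1.2.getD i 0 :=
    computable_getD_zero (Computable.snd.comp (Computable.fst.comp Computable.fst)) Computable.snd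
  have hl' : Computable₂ fun (x : ((ℕ × List ℕ) × ℕ) × ℕ) (i : ℕ) =>
      if i = r + N then x.2 else x.1.1.2.getD i 0 :=
    computable_ite (computablePred_eq Computable.snd (Computable.const _))
      (Computable.snd.comp Computable.fst) (computable_getD_zero (Computable.snd.comp
        (Computable.fst.comp (Computable.fst.comp Computable.fst))) Computable.snd)
  refine ⟨fun e => ∀ l : List ℕ,
    (∃ i, i < r + N ∧ Rej e (valc (Nat.pair 0 (l.getD i 0)) (l.getD i 0))) ∨
    (∃ c, (∃ s t : grp.Term ℕ, c = Nat.pair (termCode s) (termCode t) ∧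
        ↑s.varFinset ⊆ Set.Iio (r + N) ∧ ↑t.varFinset ⊆ Set.Iio (r + N) ∧
        s.realize (gen r τ) = t.realize (gen r τ)) ∧
        substEq (Rej e) (fun i => l.getD i 0) c) ∨
    (∃ c, (∃ s t : grp.Term ℕ, c = Nat.pair (termCode s) (termCode t) ∧
        ↑s.varFinset ⊆ Set.Iio (r + N) ∧ ↑t.varFinset ⊆ Set.Iio (r + N) ∧
        s.realize (gen r τ) ≠ t.realize (gen r τ)) ∧
        substEq (Acc e) (fun i => l.getD i 0) c) ∨
    (∃ c, ∃ y, (∃ s t : grp.Term ℕ, c = Nat.pair (termCode s) (termCode t) ∧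
        ↑s.varFinset ⊆ Set.Iio (r + N + 1) ∧ ↑t.varFinset ⊆ Set.Iio (r + N + 1) ∧
        ForcesTorsion r (s.realize (expAssign r (r + N)) / t.realize (expAssign r (r + N)))) ∧
        substEq (Acc e) (fun i => if i = r + N then y else l.getD i 0) c ∧
        Acc e (valc (Nat.pair 0 y) y) ∧
        ∀ j < N, Rej e (eqc (Nat.pair 0 y) (Nat.pair 0 (l.getD (r + j) 0)))),
    isPi02_forall ?_, fun e U _ he => ?_⟩
  · refine rePred_or (rePred_exists_notMem Computable.snd Computable.fst (r + N)) (rePred_or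
      (rePred_ex (rePred_and (rePred_comp h1.to_re Computable.snd)
        (rePred_substEq_rej hl Computable.snd (Computable.fst.comp Computable.fst)))) (rePred_or
      (rePred_ex (rePred_and (rePred_comp h2.to_re Computable.snd)
        (rePred_substEq_acc hl Computable.snd (Computable.fst.comp Computable.fst))))
      (rePred_ex (rePred_ex (rePred_and
        (rePred_comp h3.to_re (Computable.snd.comp Computable.fst)) (rePred_and
        (rePred_substEq_acc hl' (Computable.snd.comp Computable.fst)
          (Computable.fst.comp (Computable.fst.comp Computable.fst)))
        (rePred_and (rePred_acc (Computable.fst.comp (Computable.fst.comp Computable.fst))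
          (computable_natPair (Computable.const 0) (computable_natPair
            (computable_natPair (Computable.const 0) Computable.snd)
            (computable_natPair (Computable.const 0) Computable.snd))))
          (rePred_forall_lt_const N fun j => ?_))))))))
    exact rePred_rej (Computable.fst.comp (Computable.fst.comp Computable.fst))
      (computable_natPair (Computable.const 0) (computable_natPair
        (computable_natPair (Computable.const 0) Computable.snd)
        (computable_natPair (Computable.const 0) (computable_getD_zero
          (Computable.snd.comp (Computable.fst.comp Computable.fst)) (Computable.const _)))))
  · simp only [he.acc_iff, he.rej_iff, valc_var_mem, substEq]
    rw [← not_iff_not, not_not]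
    constructor
    · intro h
      push Not at h
      obtain ⟨l, hl, h1, h2, h3⟩ := h
      obtain ⟨b, hb⟩ := exists_assignment U l (r + N) hl
      refine ⟨b, fun s t hs ht => ?_, fun y s t hs ht hF heq => ?_⟩
      · have key := eqc_substCode (fun i hi => hb i (hs hi)) fun i hi => hb i (ht hi)
        rw [← key]
        constructor
        · intro h
          by_contra hne
          exact h2 _ ⟨s, t, rfl, hs, ht, hne⟩ (by simpa using h)
        · intro h
          simpa using h1 _ ⟨s, t, rfl, hs, ht, h⟩
      · have hu : ∀ i < r + N + 1, (if i = r + N then (y : ℕ) else l.getD i 0) =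
            (Function.update b (r + N) y i : U) := fun i hi => by
          by_cases hi' : i = r + N
          · simp [hi']
          · rw [if_neg hi', Function.update_of_ne hi', hb i (by omega)]
        have key := (eqc_substCode (fun i hi => hu i (hs hi)) fun i hi => hu i (ht hi)).2 heq
        obtain ⟨j, hj, h⟩ := h3 _ y ⟨s, t, rfl, hs, ht, hF⟩ (by simpa using key) y.2
        rw [hb (r + j) (by omega), eqc_var_mem] at h
        exact ⟨j, hj, h⟩
    · rintro ⟨b, h1, h2⟩ h
      have hb : ∀ i < r + N, ((List.range (r + N)).map fun i => (b i : ℕ)).getD i 0 = b i :=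
        fun i hi => getD_map_range _ hi
      obtain ⟨i, hi, h⟩ | ⟨_, ⟨s, t, rfl, hs, ht, hst⟩, h⟩ | ⟨_, ⟨s, t, rfl, hs, ht, hst⟩, h⟩ |
        ⟨_, y, ⟨s, t, rfl, hs, ht, hF⟩, heq, hy, h⟩ :=
        h ((List.range (r + N)).map fun i => (b i : ℕ))
      · rw [hb i hi] at h
        exact h (b i).2
      · simp only [Nat.unpair_pair] at h
        rw [eqc_substCode (fun i hi => hb i (hs hi)) fun i hi => hb i (ht hi)] at h
        exact h ((h1 s t hs ht).2 hst)
      · simp only [Nat.unpair_pair] at h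
        rw [eqc_substCode (fun i hi => hb i (hs hi)) fun i hi => hb i (ht hi)] at h
        exact hst ((h1 s t hs ht).1 h)
      · simp only [Nat.unpair_pair] at heq
        have hu : ∀ i < r + N + 1, (if i = r + N then y else
            ((List.range (r + N)).map fun i => (b i : ℕ)).getD i 0) =
            (Function.update b (r + N) ⟨y, hy⟩ i : U) := fun i hi => by
          by_cases hi' : i = r + N
          · simp [hi']
          · rw [if_neg hi', Function.update_of_ne hi', hb i (by omega)]
        rw [eqc_substCode (fun i hi => hu i (hs hi)) fun i hi => hu i (ht hi)] at heq
        obtain ⟨j, hj, hyj⟩ := h2 ⟨y, hy⟩ s t hs ht hF heq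
        have hjj := h j hj
        rw [hb (r + j) (by omega)] at hjj
        exact hjj (eqc_var_mem.2 hyj)

/-- The index set of a finitely generated abelian group is a difference of two `Σ⁰₂` sets: that
`e` is the index of an atomic diagram is a `Π⁰₂` property, and then so are the axioms of abelian
groups, `RankCond` and the negation of `SigmaCond`. -/
theorem isDSigma02_indexSet (τ : Fin N ≃ T) {G : Type u} [Group G] (e : G ≃* Zpow r × T) :
    IsDSigma02 (indexSet G) := by
  obtain ⟨p, hp, hp'⟩ := exists_isPi02_abelianAxioms
  obtain ⟨q, hq, hq'⟩ := exists_isPi02_rankCond r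
  obtain ⟨s, hs, hs'⟩ := exists_isPi02_not_sigmaCond (r := r) τ
  refine ⟨_, _, hs.isSigma02, (isPi02_diagramAxioms.and (hp.and hq)).isSigma02, Set.ext fun i => ?_⟩
  have hG : ∀ (U : Set ℕ) [grp.Structure U], Nonempty (U ≃[grp] G) ↔
      SigmaCond r τ U ∧ AbelianAxioms U ∧ RankCond r U := fun U _ => by
    obtain ⟨e'⟩ := nonempty_grpEquiv_iff.2 ⟨e⟩
    rw [← nonempty_equiv_iff (τ := τ)]
    exact ⟨fun ⟨f⟩ => ⟨e'.comp f⟩, fun ⟨f⟩ => ⟨e'.symm.comp f⟩⟩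
  simp only [Set.mem_sdiff, Set.mem_ofPred_eq, not_not, ← exists_isDiagramIndex_iff]
  constructor
  · rintro ⟨U, S, hU, hi⟩
    obtain ⟨h1, h2, h3⟩ := (hG U).1 hU
    exact ⟨fun h => (hs' i U hi).1 h h1, ⟨U, S, hi⟩, (hp' i U hi).2 h2, (hq' i U hi).2 h3⟩
  · rintro ⟨h1, ⟨U, S, hi⟩, h2, h3⟩
    exact ⟨U, S, (hG U).2 ⟨not_not.1 fun h => h1 ((hs' i U hi).2 h), (hp' i U hi).1 h2,
      (hq' i U hi).1 h3⟩, hi⟩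

end Conditions

/-! ### Computable copies of groups with a uniformly solvable word problem -/

section Copies

theorem le_termCode {s : grp.Term ℕ} {i : ℕ} (h : i ∈ s.varFinset) : i ≤ termCode s := by
  induction s using term_induction with
  | hvar j =>
    rw [varFinset_var, Finset.mem_singleton] at h
    simpa [h] using Nat.right_le_pair 0 j
  | hone => simp at h
  | hinv s ih => exact (ih (by simpa using h)).trans (by simpa using Nat.right_le_pair _ _)
  | hmul s t ih₁ ih₂ =>
    simp only [varFinset_tMul, Finset.mem_union] at h
    rw [termCode_tMul]
    have h' := Nat.right_le_pair 3 (Nat.pair (termCode s) (termCode t))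
    exact h.elim (fun h => (ih₁ h).trans ((Nat.left_le_pair _ _).trans h'))
      fun h => (ih₂ h).trans ((Nat.right_le_pair _ _).trans h')

theorem mem_of_mem_varFinset_relabel {U : Set ℕ} (s : grp.Term U) :
    ↑(s.relabel Subtype.val : grp.Term ℕ).varFinset ⊆ U := by
  classical
  induction s using term_induction with
  | hvar u => simp [Term.relabel]
  | hone => simp
  | hinv s ih => simpa using ih
  | hmul s t ih₁ ih₂ => simpa using ⟨ih₁, ih₂⟩

theorem exists_relabel_eq {U : Set ℕ} (s : grp.Term ℕ) (h : ↑s.varFinset ⊆ U) :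
    ∃ s' : grp.Term U, s'.relabel Subtype.val = s := by
  induction s using term_induction with
  | hvar i => exact ⟨.var ⟨i, h (by simp)⟩, rfl⟩
  | hone => exact ⟨tOne, by simp⟩
  | hinv s ih =>
    obtain ⟨s', rfl⟩ := ih (by simpa using h)
    exact ⟨tInv s', by simp⟩
  | hmul s t ih₁ ih₂ =>
    simp only [varFinset_tMul, Finset.coe_union, Set.union_subset_iff] at h
    obtain ⟨s', rfl⟩ := ih₁ h.1
    obtain ⟨t', rfl⟩ := ih₂ h.2
    exact ⟨tMul s' t', by simp⟩

theorem realize_eq_of_atomicDiagram_eq {U : Set ℕ} (S S' : grp.Structure U)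
    (h : @atomicDiagram U S = @atomicDiagram U S') (s : grp.Term U) :
    @Term.realize grp U S _ id s = @Term.realize grp U S' _ id s := by
  have h1 := (@valc_closedCode U S s (@Term.realize grp U S _ id s)).2 rfl
  rw [h] at h1
  exact Subtype.ext ((@valc_closedCode U S' s _).1 h1).symm

/-- A structure is determined by its atomic diagram. -/
theorem nonempty_equiv_of_atomicDiagram_eq {U U' : Set ℕ} [S : grp.Structure U]
    [S' : grp.Structure U'] (h : atomicDiagram U = atomicDiagram U') : Nonempty (U ≃[grp] U') := by
  obtain rfl : U = U' := Set.ext fun n => by rw [← valc_var_mem, h, valc_var_mem]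
  have key := realize_eq_of_atomicDiagram_eq S S' h
  have h1 := key tOne
  have h2 := fun x => key (tInv (.var x))
  have h3 := fun x y => key (tMul (.var x) (.var y))
  simp only [realize_tOne, realize_tInv, realize_tMul] at h1 h2 h3
  exact ⟨@grpEquiv _ _ S S' (Equiv.refl U) h1 h2 h3⟩

instance : ComputableStructure Unit := computableStructure_of_finite Unit

/-- If a sequence of groups `B n` with enumerations `π n` has a uniformly solvable word problem,
then indices of isomorphic copies of the groups `B n` can be computed. The universe of the copy of
`B n` consists of the least representatives of the elements. -/
theorem exists_computable_copies {B : ℕ → Type} [∀ n, Group (B n)] (π : ∀ n, ℕ → B n)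
    (hπ : ∀ n, Function.Surjective (π n))
    (hw : ComputablePred fun x : ℕ × ℕ => ∃ s t : grp.Term ℕ,
      x.2 = Nat.pair (termCode s) (termCode t) ∧ s.realize (π x.1) = t.realize (π x.1)) :
    ∃ f : ℕ → ℕ, Computable f ∧ ∀ (G : Type u) [Group G] (n : ℕ),
      f n ∈ indexSet G ↔ Nonempty (B n ≃* G) := by
  classical
  have hword : ∀ (n : ℕ) (s t : grp.Term ℕ), (∃ s' t' : grp.Term ℕ,
      Nat.pair (termCode s) (termCode t) = Nat.pair (termCode s') (termCode t') ∧
      s'.realize (π n) = t'.realize (π n)) ↔ s.realize (π n) = t.realize (π n) := by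
    refine fun n s t => ⟨?_, fun h => ⟨s, t, rfl, h⟩⟩
    rintro ⟨s', t', h, h'⟩
    rw [Nat.pair_eq_pair] at h
    rwa [termCode_injective h.1, termCode_injective h.2]
  let U : ℕ → Set ℕ := fun n => {m | ∀ m' < m, π n m' ≠ π n m}
  have hU : ComputablePred fun x : ℕ × ℕ => x.2 ∈ U x.1 := by
    refine computablePred_forall_lt (p := fun (x : ℕ × ℕ) m' => π x.1 m' ≠ π x.1 x.2)
      (ComputablePred.not ?_) Computable.snd
    refine (computablePred_comp hw (f := fun x : (ℕ × ℕ) × ℕ =>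
      (x.1.1, Nat.pair (Nat.pair 0 x.2) (Nat.pair 0 x.1.2))) ((Computable.fst.comp
        Computable.fst).pair (computable_natPair (computable_natPair (Computable.const 0)
          Computable.snd) (computable_natPair (Computable.const 0)
            (Computable.snd.comp Computable.fst))))).of_eq fun x => ?_
    have := hword x.1.1 (.var x.2) (.var x.1.2)
    rwa [termCode_var, termCode_var] at this
  have hbij : ∀ n, Function.Bijective fun m : U n => π n m := by
    refine fun n => ⟨fun x y h => ?_, fun b => ?_⟩
    · rcases lt_trichotomy (x : ℕ) y with hxy | hxy | hxy
      · exact absurd h (y.2 _ hxy)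
      · exact Subtype.ext hxy
      · exact absurd h.symm (x.2 _ hxy)
    · have h := hπ n b
      exact ⟨⟨Nat.find h, fun m' hm' h' => Nat.find_min h hm' (h'.trans (Nat.find_spec h))⟩,
        Nat.find_spec h⟩
  let φ : ∀ n, U n ≃ B n := fun n => Equiv.ofBijective _ (hbij n)
  let : ∀ n, Group (U n) := fun n => (φ n).group
  let ψ : ∀ n, U n ≃* B n := fun n => (φ n).mulEquiv
  have hreal : ∀ (n : ℕ) (s : grp.Term (U n)),
      ψ n (s.realize id) = (s.relabel Subtype.val : grp.Term ℕ).realize (π n) := by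
    intro n s
    rw [Term.realize_relabel]
    exact map_realize (ψ n).toMonoidHom id s
  have hpair : ComputablePred fun x : ℕ × ℕ => ∃ s t : grp.Term ℕ,
      x.2 = Nat.pair (termCode s) (termCode t) ∧ ↑s.varFinset ⊆ {i | i ∈ U x.1} ∧
      ↑t.varFinset ⊆ {i | i ∈ U x.1} ∧ True :=
    computablePred_realize (D := Unit) (a := fun _ _ => ()) (X := fun n i => i ∈ U n)
      (R := fun _ _ _ => True) (Computable.const ()) hU (computablePred_const True)
  let χ : ℕ × ℕ → Prop := fun x => (x.2.unpair.1 = 0 ∧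
      (∃ s t : grp.Term ℕ, x.2.unpair.2 = Nat.pair (termCode s) (termCode t) ∧
        ↑s.varFinset ⊆ {i | i ∈ U x.1} ∧ ↑t.varFinset ⊆ {i | i ∈ U x.1} ∧ True) ∧
      ∃ s t : grp.Term ℕ, x.2.unpair.2 = Nat.pair (termCode s) (termCode t) ∧
        s.realize (π x.1) = t.realize (π x.1)) ∨ (x.2.unpair.1 = 1 ∧
      (∃ s t : grp.Term ℕ, x.2.unpair.2 = Nat.pair (termCode s) (termCode t) ∧
        ↑s.varFinset ⊆ {i | i ∈ U x.1} ∧ ↑t.varFinset ⊆ {i | i ∈ U x.1} ∧ True) ∧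
      ¬ ∃ s t : grp.Term ℕ, x.2.unpair.2 = Nat.pair (termCode s) (termCode t) ∧
        s.realize (π x.1) = t.realize (π x.1))
  have hχ : ComputablePred χ := by
    have hu : Computable fun x : ℕ × ℕ => x.2.unpair := Computable.unpair.comp Computable.snd
    have hu2 : Computable fun x : ℕ × ℕ => (x.1, x.2.unpair.2) :=
      Computable.fst.pair (Computable.snd.comp hu)
    have h1 := computablePred_comp hpair hu2
    have h2 := computablePred_comp hw hu2
    exact computablePred_or (computablePred_and (computablePred_eq (Computable.fst.comp hu)
      (Computable.const 0)) (computablePred_and h1 h2)) (computablePred_and (computablePred_eq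
        (Computable.fst.comp hu) (Computable.const 1)) (computablePred_and h1 h2.not))
  have hdiag : ∀ n c, c ∈ atomicDiagram (U n) ↔ χ (n, c) := by
    intro n c
    constructor
    · rintro ⟨s, t, ⟨h, rfl⟩ | ⟨h, rfl⟩⟩
      · refine .inl ⟨by simp [QFFormula.code], ⟨_, _, by simp only [QFFormula.code,
          Nat.unpair_pair], mem_of_mem_varFinset_relabel s, mem_of_mem_varFinset_relabel t,
          trivial⟩, ?_⟩
        simp only [QFFormula.code, Nat.unpair_pair]
        rw [hword, ← hreal, ← hreal, h]
      · refine .inr ⟨by simp [QFFormula.code], ⟨_, _, by simp only [QFFormula.code,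
          Nat.unpair_pair], mem_of_mem_varFinset_relabel s, mem_of_mem_varFinset_relabel t,
          trivial⟩, ?_⟩
        simp only [QFFormula.code, Nat.unpair_pair]
        rw [hword, ← hreal, ← hreal, (ψ n).injective.eq_iff]
        exact h
    · rintro (⟨h0, ⟨s, t, hc, hs, ht, -⟩, h⟩ | ⟨h0, ⟨s, t, hc, hs, ht, -⟩, h⟩)
      · obtain ⟨s, rfl⟩ := exists_relabel_eq (U := U n) s hs
        obtain ⟨t, rfl⟩ := exists_relabel_eq (U := U n) t ht
        simp only [hc] at h
        rw [hword, ← hreal, ← hreal, (ψ n).injective.eq_iff] at h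
        refine ⟨s, t, .inl ⟨h, ?_⟩⟩
        rw [QFFormula.code, ← hc, ← h0, Nat.pair_unpair]
      · obtain ⟨s, rfl⟩ := exists_relabel_eq (U := U n) s hs
        obtain ⟨t, rfl⟩ := exists_relabel_eq (U := U n) t ht
        simp only [hc] at h
        rw [hword, ← hreal, ← hreal, (ψ n).injective.eq_iff] at h
        refine ⟨s, t, .inr ⟨h, ?_⟩⟩
        rw [QFFormula.code, ← hc, ← h0, Nat.pair_unpair]
  have hcomp : Computable fun m : ℕ => if χ m.unpair then 1 else 0 :=
    computable_ite (computablePred_comp hχ Computable.unpair) (Computable.const 1)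
      (Computable.const 0)
  obtain ⟨c₀, hc₀⟩ := Nat.Partrec.Code.exists_code.1 (Partrec.nat_iff.1 hcomp.partrec)
  refine ⟨fun n => Encodable.encode (Nat.Partrec.Code.curry c₀ n), (Primrec.encode.comp
    (Nat.Partrec.Code.primrec₂_curry.comp (Primrec.const c₀) Primrec.id)).to_comp,
    fun G _ n => ?_⟩
  have hphi : ∀ c, phi (Encodable.encode (Nat.Partrec.Code.curry c₀ n)) c =
      Part.some ((atomicDiagram (U n)).indicator 1 c) := by
    intro c
    rw [phi, Denumerable.ofNat_encode, Nat.Partrec.Code.eval_curry, hc₀]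
    by_cases h : c ∈ atomicDiagram (U n)
    · have h' := (hdiag n c).1 h
      simp [h, h']
    · have h' : ¬ χ (n, c) := fun h' => h ((hdiag n c).2 h')
      simp [h, h']
  constructor
  · rintro ⟨V, S, ⟨g⟩, hV⟩
    have hVU : atomicDiagram (U n) = atomicDiagram V := Set.ext fun c => by
      have := Part.some_inj.1 ((hphi c).symm.trans (hV c))
      by_cases h1 : c ∈ atomicDiagram (U n) <;> by_cases h2 : c ∈ atomicDiagram V <;>
        simp_all
    obtain ⟨g'⟩ := nonempty_equiv_of_atomicDiagram_eq hVU
    obtain ⟨g''⟩ := nonempty_grpEquiv_iff.1 ⟨g.comp g'⟩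
    exact ⟨(ψ n).symm.trans g''⟩
  · rintro ⟨g⟩
    exact ⟨U n, structureOfGroup (U n), nonempty_grpEquiv_iff.2 ⟨(ψ n).trans g⟩, hphi⟩

end Copies

/-! ### Limits of free abelian groups of rank two -/

section Limits

open Filter

/-- The free abelian group of rank two. -/
abbrev ZSq : Type := Multiplicative ℤ × Multiplicative ℤ

/-- The homomorphism onto the first factor that maps `(0, 1)` to `(s + 1, 0)`. -/
def collapse (s : ℕ) : ZSq →* ZSq :=
  (MonoidHom.fst _ _ * (powMonoidHom (s + 1)).comp (MonoidHom.snd _ _)).prod 1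

@[simp] theorem collapse_apply (s : ℕ) (x : ZSq) : collapse s x = (x.1 * x.2 ^ (s + 1), 1) := rfl

variable (A E : ℕ → Prop)

open Classical in
/-- The map from stage `s` to stage `s + 1`: the second factor is collapsed if `E s`, and the
result is doubled if `A s`. -/
noncomputable def stage (s : ℕ) : ZSq →* ZSq :=
  (if A s then powMonoidHom 2 else MonoidHom.id _).comp
    (if E s then collapse s else MonoidHom.id _)

variable {A E}

theorem stage_of_not_of_not {s : ℕ} (hA : ¬ A s) (hE : ¬ E s) (x : ZSq) : stage A E s x = x := by
  simp [stage, hA, hE]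

theorem stage_of_not_of {s : ℕ} (hA : ¬ A s) (hE : E s) (x : ZSq) :
    stage A E s x = (x.1 * x.2 ^ (s + 1), 1) := by
  simp [stage, hA, hE]

theorem stage_fst_of {s : ℕ} (hA : A s) (a : Multiplicative ℤ) :
    stage A E s (a, 1) = (a, 1) ^ 2 := by
  by_cases hE : E s <;> simp [stage, hA, hE]

theorem stage_fst_of_not {s : ℕ} (hA : ¬ A s) (a : Multiplicative ℤ) :
    stage A E s (a, 1) = (a, 1) := by
  by_cases hE : E s <;> simp [stage, hA, hE]

theorem sq_eq_one_iff {x : Multiplicative ℤ} : x ^ 2 = 1 ↔ x = 1 := by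
  rw [← toAdd_eq_zero, ← toAdd_eq_zero (x := x), toAdd_pow]
  simp

variable (A E)

/-- The map from stage `s` to stage `s + k`. -/
noncomputable def run (s : ℕ) : ℕ → ZSq →* ZSq
  | 0 => MonoidHom.id _
  | k + 1 => (stage A E (s + k)).comp (run s k)

variable {A E}

theorem run_succ' (s k : ℕ) (x : ZSq) :
    run A E s (k + 1) x = run A E (s + 1) k (stage A E s x) := by
  induction k with
  | zero => rfl
  | succ k ih =>
    rw [run, MonoidHom.comp_apply, ih, run, MonoidHom.comp_apply]
    congr 2
    omega

/-- Only the first collapse at stage `s` or later can map elements of stage `s` to the identity. -/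
theorem run_eq_one_iff (s k : ℕ) (x : ZSq) : run A E s k x = 1 ↔ x = 1 ∨
    ∃ t, s ≤ t ∧ t < s + k ∧ E t ∧ (∀ u, s ≤ u → u < t → ¬ E u) ∧ x.1 * x.2 ^ (t + 1) = 1 := by
  induction k generalizing s x with
  | zero =>
    refine ⟨.inl, ?_⟩
    rintro (h | ⟨t, h1, h2, -⟩)
    · exact h
    · omega
  | succ k ih =>
    rw [run_succ', ih]
    by_cases hE : E s
    · have h1 : stage A E s x = 1 ↔ x.1 * x.2 ^ (s + 1) = 1 := by
        by_cases hA : A s <;> simp [stage, hA, hE, Prod.ext_iff]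
      have h2 : (stage A E s x).2 = 1 := by
        by_cases hA : A s <;> simp [stage, hA, hE]
      constructor
      · intro h
        refine .inr ⟨s, le_rfl, by omega, hE, fun u h1 h2 => by omega, h1.1 ?_⟩
        rcases h with h | ⟨t, -, -, -, -, h⟩
        · exact h
        · exact Prod.ext (by simpa [h2] using h) h2
      · rintro (rfl | ⟨t, hst, -, -, ht, h⟩)
        · exact .inl (map_one _)
        · rcases hst.eq_or_lt with rfl | hlt
          · exact .inl (h1.2 h)
          · exact absurd hE (ht s le_rfl hlt)
    · have h1 : stage A E s x = 1 ↔ x = 1 := by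
        by_cases hA : A s <;> simp [stage, hA, hE, Prod.ext_iff]
      have h2 : ∀ t : ℕ, (stage A E s x).1 * (stage A E s x).2 ^ (t + 1) = 1 ↔
          x.1 * x.2 ^ (t + 1) = 1 := fun t => by
        by_cases hA : A s
        · rw [← sq_eq_one_iff (x := x.1 * x.2 ^ (t + 1))]
          simp [stage, hA, hE, mul_pow, ← pow_mul, mul_comm]
        · simp [stage, hA, hE]
      rw [h1]
      refine or_congr Iff.rfl (exists_congr fun t => ?_)
      rw [h2]
      constructor
      · rintro ⟨hst, htk, hEt, ht, h⟩
        refine ⟨by omega, by omega, hEt, fun u hu hut => ?_, h⟩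
        rcases hu.eq_or_lt with rfl | hlt
        · exact hE
        · exact ht u hlt hut
      · rintro ⟨hst, htk, hEt, ht, h⟩
        have : s ≠ t := by rintro rfl; exact hE hEt
        exact ⟨by omega, by omega, hEt, fun u hu hut => ht u (by omega) hut, h⟩

variable (A E)

/-- The map from stage `s` to the limit, whose elements are realized as germs at infinity of
sequences. -/
noncomputable def toGerm (s : ℕ) : ZSq →* Germ (atTop : Filter ℕ) ZSq where
  toFun x := ((fun j => run A E s (j - s) x : ℕ → ZSq) : Germ atTop ZSq)
  map_one' := by simp only [map_one]; rfl
  map_mul' x y := by simp only [map_mul]; rfl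

variable {A E}

theorem toGerm_stage (s : ℕ) (x : ZSq) :
    toGerm A E (s + 1) (stage A E s x) = toGerm A E s x := by
  refine Germ.coe_eq.2 ((eventually_ge_atTop (s + 1)).mono fun j hj => ?_)
  obtain ⟨k, rfl⟩ := Nat.exists_eq_add_of_le hj
  beta_reduce
  rw [show s + 1 + k - s = k + 1 by omega, run_succ', Nat.add_sub_cancel_left]

theorem toGerm_run (s k : ℕ) (x : ZSq) :
    toGerm A E (s + k) (run A E s k x) = toGerm A E s x := by
  induction k with
  | zero => rfl
  | succ k ih => rw [← ih, ← toGerm_stage (s + k)]; rfl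

theorem toGerm_eq_one_iff_run (s : ℕ) (x : ZSq) :
    toGerm A E s x = 1 ↔ ∃ k, run A E s k x = 1 := by
  constructor
  · intro h
    have h' : (fun j => run A E s (j - s) x) =ᶠ[atTop] fun _ => 1 := Germ.coe_eq.1 h
    obtain ⟨j, hj⟩ := h'.exists
    exact ⟨_, hj⟩
  · rintro ⟨k, hk⟩
    rw [← toGerm_run s k, hk, map_one]

/-- The kernel of the map to the limit is decidable, because a collapse at stage `t` maps `x ≠ 1` to
the identity only if `t < |x.1|`. -/
theorem toGerm_eq_one_iff (s : ℕ) (x : ZSq) : toGerm A E s x = 1 ↔ x = 1 ∨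
    ∃ t < x.1.toAdd.natAbs, s ≤ t ∧ E t ∧ (∀ u < t, s ≤ u → ¬ E u) ∧ x.1 * x.2 ^ (t + 1) = 1 := by
  rw [toGerm_eq_one_iff_run]
  simp only [run_eq_one_iff]
  constructor
  · rintro ⟨k, h | ⟨t, hst, -, hE, ht, h⟩⟩
    · exact .inl h
    by_cases hx : x = 1
    · exact .inl hx
    refine .inr ⟨t, ?_, hst, hE, fun u h1 h2 => ht u h2 h1, h⟩
    have h0 : x.1.toAdd + (t + 1 : ℕ) * x.2.toAdd = 0 := by
      simpa using congrArg toAdd h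
    have h2 : x.2.toAdd ≠ 0 := by
      intro h2
      rw [h2] at h0
      exact hx (Prod.ext (toAdd_eq_zero.1 (by simpa using h0)) (toAdd_eq_zero.1 h2))
    have h1 : x.1.toAdd = -((t + 1 : ℕ) * x.2.toAdd) := by linarith
    rw [h1, Int.natAbs_neg, Int.natAbs_mul, Int.natAbs_natCast]
    exact Nat.le_mul_of_pos_right _ (Int.natAbs_pos.2 h2)
  · rintro (h | ⟨t, -, hst, hE, ht, h⟩)
    · exact ⟨0, .inl h⟩
    · exact ⟨t + 1, .inr ⟨t, hst, by omega, hE, fun u h1 h2 => ht u h2 h1, h⟩⟩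

variable (A E)

/-- The limit of the sequence `stage A E`. -/
noncomputable def Limit : Subgroup (Germ (atTop : Filter ℕ) ZSq) :=
  ⨆ s, (toGerm A E s).range

variable {A E}

theorem range_toGerm_mono : Monotone fun s => (toGerm A E s).range := by
  refine monotone_nat_of_le_succ fun s => ?_
  rintro _ ⟨x, rfl⟩
  exact ⟨stage A E s x, toGerm_stage s x⟩

variable (A E)

/-- The map from stage `s` to the limit. -/
noncomputable def toLimit (s : ℕ) : ZSq →* Limit A E :=
  (toGerm A E s).codRestrict _ fun x =>
    (le_iSup (fun s => (toGerm A E s).range) s) ⟨x, rfl⟩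

variable {A E}

theorem exists_toLimit (g : Limit A E) (s₀ : ℕ) : ∃ s, s₀ ≤ s ∧ ∃ x, toLimit A E s x = g := by
  obtain ⟨s, hs⟩ := (Subgroup.mem_iSup_of_directed range_toGerm_mono.directed_le).1 g.2
  obtain ⟨x, hx⟩ := range_toGerm_mono (le_max_right s₀ s) hs
  exact ⟨_, le_max_left s₀ s, x, Subtype.ext hx⟩

theorem toLimit_stage (s : ℕ) (x : ZSq) : toLimit A E (s + 1) (stage A E s x) = toLimit A E s x :=
  Subtype.ext (toGerm_stage s x)

theorem toLimit_run (s k : ℕ) (x : ZSq) : toLimit A E (s + k) (run A E s k x) = toLimit A E s x :=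
  Subtype.ext (toGerm_run s k x)

theorem toLimit_eq_one_iff (s : ℕ) (x : ZSq) : toLimit A E s x = 1 ↔ x = 1 ∨
    ∃ t < x.1.toAdd.natAbs, s ≤ t ∧ E t ∧ (∀ u < t, s ≤ u → ¬ E u) ∧ x.1 * x.2 ^ (t + 1) = 1 := by
  rw [← toGerm_eq_one_iff (A := A)]
  exact Subtype.ext_iff

theorem toLimit_fst_eq_one_iff (s : ℕ) (a : Multiplicative ℤ) :
    toLimit A E s (a, 1) = 1 ↔ a = 1 := by
  rw [toLimit_eq_one_iff]
  constructor
  · rintro (h | ⟨t, -, -, -, -, h⟩)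
    · exact congrArg Prod.fst h
    · simpa using h
  · rintro rfl
    exact .inl rfl

/-- If there are infinitely many doublings, the generator of the first factor at stage `0` is
infinitely often divisible by `2`. -/
theorem exists_pow_eq_of_frequently (hA : ∀ s₀, ∃ s ≥ s₀, A s) (k : ℕ) :
    ∃ y : Limit A E, y ^ 2 ^ k = toLimit A E 0 (ofAdd 1, 1) := by
  have hstep : ∀ s k, ∃ j,
      toLimit A E s (ofAdd 1, 1) = toLimit A E (s + k) (ofAdd 1, 1) ^ 2 ^ j := by
    intro s k
    induction k with
    | zero => exact ⟨0, by simp⟩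
    | succ k ih =>
      obtain ⟨j, hj⟩ := ih
      rw [hj, ← toLimit_stage (s + k)]
      by_cases h : A (s + k)
      · exact ⟨j + 1, by rw [stage_fst_of h, map_pow, pow_succ' 2 j, pow_mul, Nat.add_assoc]⟩
      · exact ⟨j, by rw [stage_fst_of_not h, Nat.add_assoc]⟩
  have key : ∀ k, ∃ s j, k ≤ j ∧
      toLimit A E 0 (ofAdd 1, 1) = toLimit A E s (ofAdd 1, 1) ^ 2 ^ j := by
    intro k
    induction k with
    | zero => exact ⟨0, 0, le_rfl, by simp⟩
    | succ k ih =>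
      obtain ⟨s, j, hj, h⟩ := ih
      obtain ⟨t, hst, ht⟩ := hA s
      obtain ⟨d, rfl⟩ := Nat.exists_eq_add_of_le hst
      obtain ⟨i, hi⟩ := hstep s d
      refine ⟨s + d + 1, 1 + i + j, by omega, ?_⟩
      rw [h, hi, ← toLimit_stage (s + d), stage_fst_of ht, map_pow, pow_add, pow_add, pow_one,
        pow_mul, pow_mul]
  obtain ⟨s, j, hj, h⟩ := key k
  obtain ⟨d, rfl⟩ := Nat.exists_eq_add_of_le hj
  exact ⟨toLimit A E s (ofAdd 1, 1) ^ 2 ^ d, by rw [h, ← pow_mul, ← pow_add, add_comm k d]⟩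

/-- If there are finitely many doublings and infinitely many collapses, the limit is infinite
cyclic. -/
theorem nonempty_limit_equiv_int {s₀ : ℕ} (hA : ∀ s ≥ s₀, ¬ A s) (hE : ∀ s, ∃ t ≥ s, E t) :
    Nonempty (Limit A E ≃* Multiplicative ℤ) := by
  let f : Multiplicative ℤ →* Limit A E :=
    (toLimit A E s₀).comp (MonoidHom.inl (Multiplicative ℤ) (Multiplicative ℤ))
  have hf : ∀ (k : ℕ) a, toLimit A E (s₀ + k) (a, 1) = f a := by
    intro k a
    induction k with
    | zero => rfl
    | succ k ih =>
      rw [← ih, ← toLimit_stage (s₀ + k), stage_fst_of_not (hA _ (by omega)), Nat.add_assoc]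
  have hsurj : Function.Surjective f := by
    have key : ∀ (k s : ℕ), s₀ ≤ s → E (s + k) → ∀ x, ∃ a, f a = toLimit A E s x := by
      intro k
      induction k with
      | zero =>
        intro s hs hEs x
        obtain ⟨d, rfl⟩ := Nat.exists_eq_add_of_le hs
        refine ⟨x.1 * x.2 ^ (s₀ + d + 1), ?_⟩
        rw [← toLimit_stage, stage_of_not_of (hA _ (by omega)) (by simpa using hEs), ← hf (d + 1),
          Nat.add_assoc]
      | succ k ih =>
        intro s hs hEs x
        obtain ⟨a, ha⟩ := ih (s + 1) (by omega) (by rwa [show s + 1 + k = s + (k + 1) by omega])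
          (stage A E s x)
        exact ⟨a, by rw [ha, toLimit_stage]⟩
    intro g
    obtain ⟨s, hs, x, rfl⟩ := exists_toLimit g s₀
    obtain ⟨t, hst, ht⟩ := hE s
    obtain ⟨k, rfl⟩ := Nat.exists_eq_add_of_le hst
    exact key k s hs ht x
  refine ⟨(MulEquiv.ofBijective f ⟨(injective_iff_map_eq_one f).2 fun a ha => ?_, hsurj⟩).symm⟩
  exact (toLimit_fst_eq_one_iff s₀ a).1 ha

/-- If there are finitely many doublings and collapses, the limit is free of rank two. -/
theorem nonempty_limit_equiv_zSq {s₀ : ℕ} (hA : ∀ s ≥ s₀, ¬ A s) (hE : ∀ s ≥ s₀, ¬ E s) :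
    Nonempty (Limit A E ≃* ZSq) := by
  have hf : ∀ (k : ℕ) x, toLimit A E (s₀ + k) x = toLimit A E s₀ x := by
    intro k x
    induction k with
    | zero => rfl
    | succ k ih =>
      rw [← ih, ← toLimit_stage (s₀ + k), stage_of_not_of_not (hA _ (by omega)) (hE _ (by omega)),
        Nat.add_assoc]
  refine ⟨(MulEquiv.ofBijective (toLimit A E s₀) ⟨(injective_iff_map_eq_one _).2 fun x hx => ?_,
    fun g => ?_⟩).symm⟩
  · obtain h | ⟨t, -, hst, ht, -⟩ := (toLimit_eq_one_iff s₀ x).1 hx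
    · exact h
    · exact absurd ht (hE t hst)
  · obtain ⟨s, hs, x, rfl⟩ := exists_toLimit g s₀
    obtain ⟨k, rfl⟩ := Nat.exists_eq_add_of_le hs
    exact ⟨x, (hf k x).symm⟩

variable {T : Type} [CommGroup T] {N : ℕ} {r : ℕ}

theorem nonempty_limit_prod_equiv_iff (τ : Fin N ≃ T) :
    Nonempty (Limit A E × (Zpow r × T) ≃* Zpow (r + 1) × T) ↔
      (¬ ∀ s₀, ∃ s ≥ s₀, A s) ∧ ∀ s₀, ∃ s ≥ s₀, E s := by
  constructor
  · rintro ⟨e⟩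
    have hA : ¬ ∀ s₀, ∃ s ≥ s₀, A s := by
      intro hA
      have h := pow_eq_one_of_divisible τ (x := e (toLimit A E 0 (ofAdd 1, 1), 1)) fun k => by
        obtain ⟨y, hy⟩ := exists_pow_eq_of_frequently (E := E) hA k
        exact ⟨e (y, 1), by rw [← map_pow, Prod.pow_mk, hy, one_pow]⟩
      rw [← map_pow, Prod.pow_mk, one_pow, ← map_pow, ← e.map_one, e.injective.eq_iff] at h
      have h1 : toLimit A E 0 ((ofAdd 1 : Multiplicative ℤ) ^ N, 1) = 1 := by
        simpa using congrArg Prod.fst h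
      rw [toLimit_fst_eq_one_iff, ← toAdd_eq_zero] at h1
      simp [pos_of_equiv τ] at h1
    refine ⟨hA, fun s₀ => ?_⟩
    by_contra! hE
    push Not at hA
    obtain ⟨s₁, hA⟩ := hA
    obtain ⟨f⟩ := nonempty_limit_equiv_zSq (A := A) (E := E) (s₀ := max s₀ s₁)
      (fun s hs => hA s ((le_max_right _ _).trans hs)) fun s hs => hE s ((le_max_left _ _).trans hs)
    have : Finite T := Finite.of_equiv _ τ
    let g : (Zpow (r + 1) × T) × Multiplicative ℤ ≃* ZSq × (Zpow r × T) :=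
      MulEquiv.prodComm.trans ((MulEquiv.prodCongr (MulEquiv.refl _) (splitFirst r T)).trans
        MulEquiv.prodAssoc.symm)
    exact not_mulEquiv_prod_int.false (g.trans ((f.symm.prodCongr (MulEquiv.refl _)).trans e))
  · rintro ⟨hA, hE⟩
    push Not at hA
    obtain ⟨s₀, hA⟩ := hA
    obtain ⟨f⟩ := nonempty_limit_equiv_int hA hE
    exact ⟨(f.prodCongr (MulEquiv.refl _)).trans (splitFirst r T).symm⟩

end Limits

/-! ### Hardness of the index set -/

section Events

/-- A `Π⁰₂` property holds iff infinitely many events of a computable sequence happen. -/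
theorem IsSigma02.exists_events {S : Set ℕ} (hS : IsSigma02 S) : ∃ E : ℕ → ℕ → Prop,
    ComputablePred (fun x : ℕ × ℕ => E x.1 x.2) ∧ ∀ n, n ∉ S ↔ ∀ s₀, ∃ s ≥ s₀, E n s := by
  obtain ⟨R, hR, hS⟩ := hS
  -- `F n x y` says that the first `x + 1` instances of `∀ x, ∃ y, ¬ R` have witnesses up to `y`.
  -- The events are the pairs `(x, y)` with the least such `y` for `x`.
  let F : ℕ → ℕ → ℕ → Prop := fun n x y => ∀ x' < x + 1, ∃ y' < y + 1, ¬ R (n, x', y')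
  have hF : ComputablePred fun z : (ℕ × ℕ) × ℕ => F z.1.1 z.1.2 z.2 := by
    have h1 : ComputablePred fun z : (((ℕ × ℕ) × ℕ) × ℕ) × ℕ => ¬ R (z.1.1.1.1, z.1.2, z.2) :=
      (computablePred_comp hR ((Computable.fst.comp (Computable.fst.comp (Computable.fst.comp
        Computable.fst))).pair ((Computable.snd.comp Computable.fst).pair Computable.snd))).not
    have h2 := computablePred_exists_lt (α := ((ℕ × ℕ) × ℕ) × ℕ)
      (p := fun z y' => ¬ R (z.1.1.1, z.2, y')) h1
      (Computable.succ.comp (Computable.snd.comp Computable.fst))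
    exact computablePred_forall_lt (α := (ℕ × ℕ) × ℕ)
      (p := fun z x' => ∃ y' < z.2 + 1, ¬ R (z.1.1, x', y')) h2
      (Computable.succ.comp (Computable.snd.comp Computable.fst))
  refine ⟨fun n s => F n s.unpair.1 s.unpair.2 ∧ ∀ y < s.unpair.2, ¬ F n s.unpair.1 y, ?_,
    fun n => ?_⟩
  · have hu : Computable fun x : ℕ × ℕ => x.2.unpair := Computable.unpair.comp Computable.snd
    have hp : Computable fun x : ℕ × ℕ => (x.1, x.2.unpair.1) :=
      Computable.fst.pair (Computable.fst.comp hu)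
    refine computablePred_and (computablePred_comp hF (hp.pair (Computable.snd.comp hu)))
      (computablePred_forall_lt (p := fun (x : ℕ × ℕ) y => ¬ F x.1 x.2.unpair.1 y)
        (computablePred_comp hF ((hp.comp Computable.fst).pair Computable.snd)).not
        (Computable.snd.comp hu))
  · rw [hS]
    push Not
    classical
    constructor
    · intro h s₀
      have hx : ∃ y, F n s₀ y := by
        choose g hg using h
        refine ⟨(Finset.range (s₀ + 1)).sup g, fun x' hx' => ⟨g x', ?_, hg x'⟩⟩
        exact Nat.lt_succ_of_le (Finset.le_sup (Finset.mem_range.2 hx'))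
      refine ⟨Nat.pair s₀ (Nat.find hx), Nat.left_le_pair _ _, ?_⟩
      simp only [Nat.unpair_pair]
      exact ⟨Nat.find_spec hx, fun y hy => Nat.find_min hx hy⟩
    · intro h x
      by_contra! hx
      have hfin :
          {s : ℕ | F n s.unpair.1 s.unpair.2 ∧ ∀ y < s.unpair.2, ¬ F n s.unpair.1 y}.Finite := by
        refine Set.Finite.of_injOn (f := fun s => s.unpair.1) (t := Set.Iio x) ?_ ?_
          (Set.finite_Iio x)
        · rintro s ⟨hs, -⟩
          by_contra hxs
          obtain ⟨y, -, hy⟩ := hs x (Nat.lt_succ_of_le (not_lt.1 hxs))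
          exact hy (hx y)
        · rintro s ⟨hs, hs'⟩ t ⟨ht, ht'⟩ hst
          beta_reduce at hst
          rw [hst] at hs hs'
          have h1 := fun h => hs' _ h ht
          have h2 := fun h => ht' _ h hs
          rw [← Nat.pair_unpair s, ← Nat.pair_unpair t, hst,
            le_antisymm (not_lt.1 h2) (not_lt.1 h1)]
      obtain ⟨b, hb⟩ := hfin.bddAbove
      obtain ⟨s, hs, hs'⟩ := h (b + 1)
      have := hb hs'
      omega

end Events

section Hardness

variable {A E : ℕ → ℕ → Prop}

theorem computable_collapse {α : Type} [Primcodable α] {f : α → ℕ} {g : α → ZSq}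
    (hf : Computable f) (hg : Computable g) :
    Computable fun a => (g a).1 * (g a).2 ^ (f a + 1) := by
  have h : Computable fun a => (ofAdd ((f a + 1 : ℕ) * (g a).2.toAdd) : Multiplicative ℤ) :=
    primrec_ofAdd.to_comp.comp (primrec_natCast_mul.to_comp.comp (Computable.succ.comp hf)
      (primrec_toAdd.to_comp.comp (Computable.snd.comp hg)))
  refine ((computable_mul (Multiplicative ℤ)).comp (Computable.fst.comp hg) h).of_eq fun a => ?_
  congr 1

theorem computable_stage (hA : ComputablePred fun x : ℕ × ℕ => A x.1 x.2)
    (hE : ComputablePred fun x : ℕ × ℕ => E x.1 x.2) {α : Type} [Primcodable α] {f g : α → ℕ}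
    {h : α → ZSq} (hf : Computable f) (hg : Computable g) (hh : Computable h) :
    Computable fun a => stage (A (f a)) (E (f a)) (g a) (h a) := by
  classical
  have h1 : Computable fun a => if E (f a) (g a) then ((h a).1 * (h a).2 ^ (g a + 1), 1) else h a :=
    computable_ite (computablePred_comp hE (hf.pair hg))
      ((computable_collapse hg hh).pair (Computable.const 1)) hh
  refine (computable_ite (computablePred_comp hA (hf.pair hg)) ((computable_mul ZSq).comp h1 h1)
    h1).of_eq fun a => ?_
  by_cases hA' : A (f a) (g a) <;> by_cases hE' : E (f a) (g a) <;>
    simp [stage, hA', hE', pow_two]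

theorem computable_run (hA : ComputablePred fun x : ℕ × ℕ => A x.1 x.2)
    (hE : ComputablePred fun x : ℕ × ℕ => E x.1 x.2) {α : Type} [Primcodable α] {f g k : α → ℕ}
    {h : α → ZSq} (hf : Computable f) (hg : Computable g) (hk : Computable k) (hh : Computable h) :
    Computable fun a => run (A (f a)) (E (f a)) (g a) (k a) (h a) := by
  have hs : Computable fun x : α × ℕ × ZSq =>
      stage (A (f x.1)) (E (f x.1)) (g x.1 + x.2.1) x.2.2 :=
    computable_stage hA hE (hf.comp Computable.fst)
      (Primrec.nat_add.to_comp.comp (hg.comp Computable.fst)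
        (Computable.fst.comp Computable.snd)) (Computable.snd.comp Computable.snd)
  refine (Computable.nat_rec (h := fun a y => stage (A (f a)) (E (f a)) (g a + y.1) y.2)
    hk hh hs).of_eq fun a => ?_
  generalize k a = k
  induction k with
  | zero => rfl
  | succ k ih => simp only [ih]; rfl

theorem computablePred_toLimit_eq_one (hE : ComputablePred fun x : ℕ × ℕ => E x.1 x.2) :
    ComputablePred fun z : (ℕ × ℕ) × ZSq => toLimit (A z.1.1) (E z.1.1) z.1.2 z.2 = 1 := by
  have h1 : ComputablePred fun z : (((ℕ × ℕ) × ZSq) × ℕ) × ℕ =>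
      ¬ z.1.1.1.2 ≤ z.2 ∨ ¬ E z.1.1.1.1 z.2 := by
    have h0 : Computable fun z : (((ℕ × ℕ) × ZSq) × ℕ) × ℕ => z.1.1.1 :=
      Computable.fst.comp (Computable.fst.comp Computable.fst)
    exact computablePred_or (computablePred_le (Computable.snd.comp h0) Computable.snd).not
      (computablePred_comp hE ((Computable.fst.comp h0).pair Computable.snd)).not
  have h2 : ComputablePred fun z : ((ℕ × ℕ) × ZSq) × ℕ =>
      z.1.1.2 ≤ z.2 ∧ E z.1.1.1 z.2 ∧ (∀ u < z.2, ¬ z.1.1.2 ≤ u ∨ ¬ E z.1.1.1 u) ∧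
        z.1.2.1 * z.1.2.2 ^ (z.2 + 1) = 1 := by
    have h0 : Computable fun z : ((ℕ × ℕ) × ZSq) × ℕ => z.1.1 := Computable.fst.comp Computable.fst
    refine computablePred_and (computablePred_le (Computable.snd.comp h0) Computable.snd)
      (computablePred_and (computablePred_comp hE ((Computable.fst.comp h0).pair Computable.snd))
        (computablePred_and (computablePred_forall_lt (α := ((ℕ × ℕ) × ZSq) × ℕ)
          (p := fun z u => ¬ z.1.1.2 ≤ u ∨ ¬ E z.1.1.1 u) h1 Computable.snd)
          (computablePred_eq ?_ (Computable.const 1))))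
    exact computable_collapse Computable.snd (Computable.snd.comp Computable.fst)
  have h3 : Computable fun z : (ℕ × ℕ) × ZSq => z.2.1.toAdd.natAbs :=
    primrec_natAbs.to_comp.comp (primrec_toAdd.to_comp.comp (Computable.fst.comp Computable.snd))
  refine (computablePred_or (computablePred_eq Computable.snd (Computable.const 1))
    (computablePred_exists_lt (α := (ℕ × ℕ) × ZSq) (p := fun z t => z.1.2 ≤ t ∧ E z.1.1 t ∧
      (∀ u < t, ¬ z.1.2 ≤ u ∨ ¬ E z.1.1 u) ∧ z.2.1 * z.2.2 ^ (t + 1) = 1) h2 h3)).of_eq fun z => ?_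
  rw [toLimit_eq_one_iff]
  simp only [imp_iff_not_or]

variable {K : Type} [Group K] [Primcodable K]

/-- The element of `ZSq × K` with code `q`. -/
def decodeElt (K : Type) [Group K] [Primcodable K] (q : ℕ) : ZSq × K :=
  (Encodable.decode q).getD 1

theorem computable_decodeElt : Computable (decodeElt K) :=
  Computable.option_getD Computable.decode (Computable.const 1)

variable (A E K)

/-- The enumeration of the product of the `n`-th limit and `K`. The number `⟨s, q⟩` stands for the
element with code `q` at stage `s`. -/
noncomputable def enumLimit (n m : ℕ) : Limit (A n) (E n) × K :=
  (toLimit (A n) (E n) m.unpair.1 (decodeElt K m.unpair.2).1, (decodeElt K m.unpair.2).2)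

variable {A E K}

theorem enumLimit_surjective (n : ℕ) : Function.Surjective (enumLimit A E K n) := by
  rintro ⟨g, k⟩
  obtain ⟨s, -, x, rfl⟩ := exists_toLimit g 0
  exact ⟨Nat.pair s (Encodable.encode (x, k)), by simp [enumLimit, decodeElt]⟩

/-- The word problem of the limits is uniformly solvable: the variables that occur in terms with
Goedel numbers below `c` stand for elements of stages up to `c`, and the terms can be evaluated at
stage `c`. -/
theorem computablePred_word_problem [ComputableStructure K]
    (hA : ComputablePred fun x : ℕ × ℕ => A x.1 x.2)
    (hE : ComputablePred fun x : ℕ × ℕ => E x.1 x.2) :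
    ComputablePred fun x : ℕ × ℕ => ∃ s t : grp.Term ℕ,
      x.2 = Nat.pair (termCode s) (termCode t) ∧
      s.realize (enumLimit A E K x.1) = t.realize (enumLimit A E K x.1) := by
  let a : ℕ × ℕ → ℕ → ZSq × K := fun x m => (run (A x.1) (E x.1) m.unpair.1 (x.2 - m.unpair.1)
    (decodeElt K m.unpair.2).1, (decodeElt K m.unpair.2).2)
  let ι : ∀ x : ℕ × ℕ, ZSq × K →* Limit (A x.1) (E x.1) × K := fun x =>
    (toLimit (A x.1) (E x.1) x.2).prodMap (MonoidHom.id K)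
  have ha : Computable₂ a := by
    have hu : Computable fun x : (ℕ × ℕ) × ℕ => x.2.unpair := Computable.unpair.comp Computable.snd
    have hd : Computable fun x : (ℕ × ℕ) × ℕ => decodeElt K x.2.unpair.2 :=
      computable_decodeElt.comp (Computable.snd.comp hu)
    exact (computable_run hA hE (Computable.fst.comp Computable.fst) (Computable.fst.comp hu)
      (Primrec.nat_sub.to_comp.comp (Computable.snd.comp Computable.fst) (Computable.fst.comp hu))
      (Computable.fst.comp hd)).pair (Computable.snd.comp hd)
  have hR : ComputablePred fun x : (ℕ × ℕ) × (ZSq × K) × (ZSq × K) =>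
      toLimit (A x.1.1) (E x.1.1) x.1.2 (x.2.1.1 / x.2.2.1) = 1 ∧ x.2.1.2 = x.2.2.2 := by
    have h1 : Computable fun x : (ℕ × ℕ) × (ZSq × K) × (ZSq × K) => x.2.1.1 / x.2.2.1 :=
      (computable_div ZSq).comp (Computable.fst.comp (Computable.fst.comp Computable.snd))
        (Computable.fst.comp (Computable.snd.comp Computable.snd))
    exact computablePred_and (computablePred_comp (computablePred_toLimit_eq_one hE)
      (Computable.fst.pair h1)) (computablePred_eq
        (Computable.snd.comp (Computable.fst.comp Computable.snd))
        (Computable.snd.comp (Computable.snd.comp Computable.snd)))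
  have hRι : ∀ x (y z : ZSq × K), (toLimit (A x.1) (E x.1) x.2 (y.1 / z.1) = 1 ∧ y.2 = z.2) ↔
      ι x y = ι x z := by
    intro x y z
    rw [map_div, div_eq_one, Prod.ext_iff]
    rfl
  have key := computablePred_realize (a := a) ha (X := fun _ _ => True)
    (computablePred_const True) (R := fun x y z => toLimit (A x.1) (E x.1) x.2 (y.1 / z.1) = 1 ∧
      y.2 = z.2) hR
  have hι : ∀ x m, m ≤ x.2 → ι x (a x m) = enumLimit A E K x.1 m := by
    intro x m hm
    refine Prod.ext ?_ rfl
    have h := toLimit_run (A := A x.1) (E := E x.1) m.unpair.1 (x.2 - m.unpair.1)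
      (decodeElt K m.unpair.2).1
    rw [Nat.add_sub_cancel' ((Nat.unpair_left_le m).trans hm)] at h
    exact h
  have hreal : ∀ x (s : grp.Term ℕ), termCode s ≤ x.2 →
      ι x (s.realize (a x)) = s.realize (enumLimit A E K x.1) := by
    intro x s hs
    rw [map_realize]
    exact ScottGroup.realize_congr fun i hi => hι x i ((le_termCode hi).trans hs)
  refine (computablePred_comp key (f := fun x : ℕ × ℕ => (x, x.2))
    (Computable.id.pair Computable.snd)).of_eq fun x => ?_
  refine exists_congr fun s => exists_congr fun t => and_congr_right fun h => ?_
  have hs : termCode s ≤ x.2 := by rw [h]; exact Nat.left_le_pair _ _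
  have ht : termCode t ≤ x.2 := by rw [h]; exact Nat.right_le_pair _ _
  rw [hRι, hreal x s hs, hreal x t ht]
  simp

variable {T : Type} [CommGroup T] {N : ℕ} {r : ℕ}

/-- Every difference of two `Σ⁰₂` sets is reducible to the index set of an infinite finitely
generated abelian group. -/
theorem manyOneReducible_indexSet (τ : Fin N ≃ T) {G : Type u} [Group G]
    (e : G ≃* Zpow (r + 1) × T) {S : Set ℕ} (hS : IsDSigma02 S) :
    (fun n => n ∈ S) ≤₀ fun n => n ∈ indexSet G := by
  obtain ⟨S₁, S₂, h₁, h₂, rfl⟩ := hS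
  obtain ⟨A, hA, hA'⟩ := h₁.exists_events
  obtain ⟨E, hE, hE'⟩ := h₂.exists_events
  have : Finite T := Finite.of_equiv _ τ
  have : Primcodable T := Primcodable.ofEquiv _ τ.symm
  have : ComputableStructure T := computableStructure_of_finite T
  obtain ⟨f, hf, h⟩ := exists_computable_copies (enumLimit A E (Zpow r × T)) enumLimit_surjective
    (computablePred_word_problem hA hE)
  refine ⟨f, hf, fun n => ?_⟩
  beta_reduce
  rw [h G n, Set.mem_sdiff, hE', ← not_not (a := n ∈ S₁), hA', ← nonempty_limit_prod_equiv_iff τ]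
  exact ⟨fun ⟨g⟩ => ⟨g.trans e.symm⟩, fun ⟨g⟩ => ⟨g.trans e⟩⟩

end Hardness

/-! ### Finitely generated abelian groups -/

theorem exists_mulEquiv_zpow_prod (G : Type u) [CommGroup G] [Group.FG G] :
    ∃ (r N : ℕ) (T : Type) (_ : CommGroup T) (_ : Fin N ≃ T), Nonempty (G ≃* Zpow r × T) := by
  obtain ⟨ι, j, _, _, p, hp, k, ⟨e⟩⟩ := CommGroup.equiv_free_prod_prod_multiplicative_zmod G
  have : ∀ i, NeZero (p i ^ k i) := fun i => ⟨pow_ne_zero _ (hp i).ne_zero⟩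
  have : Finite (∀ i, Multiplicative (ZMod (p i ^ k i))) := Pi.finite
  exact ⟨Fintype.card j, _, _, inferInstance, (Finite.equivFin _).symm, ⟨e.trans
    ((MulEquiv.arrowCongr (Fintype.equivFin j) (MulEquiv.refl _)).prodCongr (MulEquiv.refl _))⟩⟩

end ScottGroup

theorem mainTheorem1 (G : Type u) [CommGroup G] [Group.FG G] :
    (∃ φ : ScottGroup.InfFormula, φ.IsComputableDSigmaTwoSentence ∧
      ScottGroup.InfFormula.IsScottSentence.{u, v} φ G) ∧
    (Infinite G →
      ScottGroup.IsMComplete ScottGroup.IsDSigma02 (ScottGroup.indexSet G) ∧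
      ∀ φ : ScottGroup.InfFormula, φ.IsComputableSigma 2 ∨ φ.IsComputablePi 2 →
        ¬ ScottGroup.InfFormula.IsScottSentence.{u, v} φ G) := by
  obtain ⟨r, N, T, _, τ, ⟨e⟩⟩ := ScottGroup.exists_mulEquiv_zpow_prod G
  refine ⟨ScottGroup.exists_scottSentence τ e, fun hG => ?_⟩
  have : Finite T := Finite.of_equiv _ τ
  obtain _ | r := r
  · exact absurd (Finite.of_equiv _ e.symm.toEquiv) hG.not_finite
  · exact ⟨⟨ScottGroup.isDSigma02_indexSet τ e,
      fun S hS => ScottGroup.manyOneReducible_indexSet τ e hS⟩,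
      fun φ hφ => ScottGroup.not_isScottSentence_of_sigma_or_pi τ e hφ⟩
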